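/- Let $G$ be a (finite-dimensional) complex Lie group with Lie algebra $\mathfrak g$ (for example a connected complex algebraic group), $H\le G$ a closed complex Lie subgroup with Lie algebra $\mathfrak h$, and $X=G/H$, with its complex structure for which $\pi:G\to X$ is a holomorphic submersion. Write $L_a$ and $R_b$ for left and right translations. For a holomorphic principal $K$-bundle $p:P\to X$ ($K$ a complex Lie group with Lie algebra $\mathfrak k$, acting on the right of $P$), let $\mathrm{ad}\,P=P\times^K\mathfrak k$ (adjoint action) and $\mathrm{At}\,P=\Theta_P/K$. Its Atiyah sequence is the short exact sequence of holomorphic vector bundles on $X$ $$0\to \mathrm{ad}\,P\to \mathrm{At}\,P\to\Theta_X\to 0,$$ where $[y,\eta]\in \mathrm{ad}\,P$ goes to the class of the derivative of $k\mapsto y\cdot k$ at $1$ in the direction $\eta$, and the class of $v\in\Theta_P$ goes to $dp(v)$. (1) The projection $\pi$ makes $G$ a holomorphic principal $H$-bundle $G_H$ over $X$, and its Atiyah sequence is isomorphic, as a short exact sequence of holomorphic vector bundles on $X$, to the one associated to the short exact sequence of $H$-representations $$0\to\mathfrak h\to\mathfrak g\to\mathfrak g/\mathfrak h\to 0.$$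 The isomorphism is the identity $G_H\times^H\mathfrak h=\mathrm{ad}\,G_H$ on the first term, and on the others it is given by $[a,\xi]\mapsto[dL_a\xi]$, $G_H\times^H\mathfrak g\to\mathrm{At}\,G_H$, and $[a,\xi+\mathfrak h]\mapsto d\pi(dL_a\xi)$. In particular $\Theta_X\cong G_H\times^H(\mathfrak g/\mathfrak h)$. (2) Let $M$ be another complex Lie group, with Lie algebra $\mathfrak m$, let $\tau:H\to M$ be a holomorphic homomorphism, and let $G^\tau=G_H\times^\tau M=(G\times M)/H$ for the action $(a,b)\cdot h=(ah,\tau(h)^{-1}b)$, with the complex structure for which the quotient map $\rho:G\times M\to G^\tau$ is a holomorphic submersion. Then $G^\tau$, with the projection $[a,b]\mapsto aH$ and the right action $[a,b]\cdot m=[a,bm]$, is a holomorphic principal $M$-bundle over $X$, and its Atiyah sequence is isomorphic, as a short exact sequence of holomorphic vector bundles on $X$, to the one associated to the short exact sequence of $H$-representations $$0\to\mathfrak m\to(\mathfrak g\oplus\mathfrak m)/\mathfrak h\to\mathfrak g/\mathfrak h\to 0.$$ Here $H$ acts on $\mathfrak m$ through $\tau$ and the adjoint representation of $M$, the inclusion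 $\mathfrak h\hookrightarrow\mathfrak g\oplus\mathfrak m$ is $\xi\mapsto(\xi,-d\tau(\xi))$, the first map is $\eta\mapsto\overline{(0,\eta)}$ and the second is $\overline{(\xi,\eta)}\mapsto\xi+\mathfrak h$. The isomorphism is given, for $a\in G$ and any $b\in M$, by $[a,\eta]\mapsto[[a,b],\mathrm{Ad}_{b^{-1}}\eta]$, $[a,\overline{(\xi,\eta)}]\mapsto[d\rho_{(a,b)}(dL_a\xi,dR_b\eta)]$ and $[a,\xi+\mathfrak h]\mapsto d\pi(dL_a\xi)$ on the three terms. -/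

import Mathlib

open scoped Manifold ContDiff

noncomputable section

/-! ## Holomorphic vector bundles and sequences of them

Throughout, "holomorphic" is `ContMDiff … ω` over `ℂ` (complex analytic), manifolds are modelled on
finite-dimensional complex vector spaces `E` through `𝓘(ℂ, E)`. -/

/-- A family of complex vector spaces over `X` together with the notion of a holomorphic section
over a subset. A section over `U` is given by any family of values; only its values over `U`
matter. -/
structure HolFamily.{w, u} (X : Type u) where
  /-- The fibre over a point. -/
  fiber : X → Type w
  [addCommGroup : ∀ x, AddCommGroup (fiber x)]
  [module : ∀ x, Module ℂ (fiber x)]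
  /-- `IsHolOn U σ`: the section `σ` is holomorphic over `U`. -/
  IsHolOn : Set X → (∀ x, fiber x) → Prop

attribute [instance] HolFamily.addCommGroup HolFamily.module

namespace HolFamily

/-- The family is a holomorphic vector bundle: around every point there is a local frame such that,
over the open subsets of its domain, a section is holomorphic if and only if its coefficients are
holomorphic functions. (The frames are local trivializations with holomorphic transition
functions.) -/
def IsVectorBundle {EX X : Type*} [NormedAddCommGroup EX] [NormedSpace ℂ EX] [TopologicalSpace X]
    [ChartedSpace EX X] (F : HolFamily X) : Prop :=
  ∀ x₀ : X, ∃ U : Set X, IsOpen U ∧ x₀ ∈ U ∧ ∃ (r : ℕ) (e : Fin r → ∀ x, F.fiber x),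
    (∀ x ∈ U, LinearIndependent ℂ (fun i => e i x) ∧
      Submodule.span ℂ (Set.range fun i => e i x) = ⊤) ∧
    ∀ V : Set X, IsOpen V → V ⊆ U → ∀ (σ : ∀ x, F.fiber x) (c : Fin r → X → ℂ),
      (∀ x ∈ V, σ x = ∑ i, c i x • e i x) →
      (F.IsHolOn V σ ↔ ∀ i, ContMDiffOn 𝓘(ℂ, EX) 𝓘(ℂ) ω (c i) V)

/-- A fibrewise linear map over the identity of `X` is a morphism of holomorphic vector bundles:
it maps holomorphic local sections to holomorphic local sections. -/
def IsMorphism {X : Type*} [TopologicalSpace X] (F F' : HolFamily X)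
    (f : ∀ x, F.fiber x →ₗ[ℂ] F'.fiber x) : Prop :=
  ∀ U : Set X, IsOpen U → ∀ σ : ∀ x, F.fiber x, F.IsHolOn U σ → F'.IsHolOn U fun x => f x (σ x)

/-- A fibrewise linear isomorphism over the identity of `X` is an isomorphism of holomorphic vector
bundles: it and its inverse map holomorphic local sections to holomorphic local sections. -/
def IsIso {X : Type*} [TopologicalSpace X] (F F' : HolFamily X)
    (f : ∀ x, F.fiber x ≃ₗ[ℂ] F'.fiber x) : Prop :=
  IsMorphism F F' (fun x => (f x : F.fiber x →ₗ[ℂ] F'.fiber x)) ∧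
    IsMorphism F' F (fun x => ((f x).symm : F'.fiber x →ₗ[ℂ] F.fiber x))

end HolFamily

set_option linter.checkUnivs false in
/-- A sequence `left ⟶ mid ⟶ right` of families over `X` with fibrewise linear maps. -/
structure HolSeq.{w₁, w₂, w₃, u} (X : Type u) where
  left : HolFamily.{w₁} X
  mid : HolFamily.{w₂} X
  right : HolFamily.{w₃} X
  inc : ∀ x, left.fiber x →ₗ[ℂ] mid.fiber x
  proj : ∀ x, mid.fiber x →ₗ[ℂ] right.fiber x

namespace HolSeq

/-- `0 ⟶ left ⟶ mid ⟶ right ⟶ 0` is a short exact sequence of holomorphic vector bundles. -/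
structure IsShortExact {EX X : Type*} [NormedAddCommGroup EX] [NormedSpace ℂ EX]
    [TopologicalSpace X] [ChartedSpace EX X] (S : HolSeq X) : Prop where
  left_bundle : S.left.IsVectorBundle (EX := EX)
  mid_bundle : S.mid.IsVectorBundle (EX := EX)
  right_bundle : S.right.IsVectorBundle (EX := EX)
  inc_hol : HolFamily.IsMorphism S.left S.mid S.inc
  proj_hol : HolFamily.IsMorphism S.mid S.right S.proj
  injective : ∀ x, Function.Injective (S.inc x)
  exact : ∀ x, Function.Exact (S.inc x) (S.proj x)
  surjective : ∀ x, Function.Surjective (S.proj x)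

/-- An isomorphism of sequences of holomorphic vector bundles over `X` (over the identity). -/
structure Iso {X : Type*} [TopologicalSpace X] (S T : HolSeq X) where
  left : ∀ x, S.left.fiber x ≃ₗ[ℂ] T.left.fiber x
  mid : ∀ x, S.mid.fiber x ≃ₗ[ℂ] T.mid.fiber x
  right : ∀ x, S.right.fiber x ≃ₗ[ℂ] T.right.fiber x
  left_iso : HolFamily.IsIso S.left T.left left
  mid_iso : HolFamily.IsIso S.mid T.mid mid
  right_iso : HolFamily.IsIso S.right T.right right
  comm_inc : ∀ x v, mid x (S.inc x v) = T.inc x (left x v)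
  comm_proj : ∀ x v, right x (S.proj x v) = T.proj x (mid x v)

end HolSeq

/-! ## Complex Lie groups: adjoint representation and differentials of homomorphisms -/

section LieGroups

variable {EG G EK K : Type*} [NormedAddCommGroup EG] [NormedSpace ℂ EG] [TopologicalSpace G]
  [ChartedSpace EG G] [Group G]
  [NormedAddCommGroup EK] [NormedSpace ℂ EK] [TopologicalSpace K] [ChartedSpace EK K] [Group K]

/-- The differential at the identity of a homomorphism of Lie groups. -/
def lieMap (φ : K →* G) : GroupLieAlgebra 𝓘(ℂ, EK) K →ₗ[ℂ] GroupLieAlgebra 𝓘(ℂ, EG) G where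
  toFun ξ := (mfderiv 𝓘(ℂ, EK) 𝓘(ℂ, EG) (φ : K → G) 1 ξ : EG)
  map_add' ξ η := map_add (mfderiv 𝓘(ℂ, EK) 𝓘(ℂ, EG) (φ : K → G) 1) ξ η
  map_smul' c ξ := map_smul (mfderiv 𝓘(ℂ, EK) 𝓘(ℂ, EG) (φ : K → G) 1) c ξ

theorem conj_contMDiff [LieGroup 𝓘(ℂ, EG) ω G] (g : G) :
    ContMDiff 𝓘(ℂ, EG) 𝓘(ℂ, EG) ω (MulAut.conj g).toMonoidHom := by
  have h1 : ContMDiff 𝓘(ℂ, EG) 𝓘(ℂ, EG) ω (fun x : G => g * x) := contMDiff_mul_left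
  have h2 : ContMDiff 𝓘(ℂ, EG) 𝓘(ℂ, EG) ω (fun x : G => x * g⁻¹) := contMDiff_mul_right
  exact h2.comp h1

theorem lieMap_comp {EL L : Type*} [NormedAddCommGroup EL] [NormedSpace ℂ EL] [TopologicalSpace L]
    [ChartedSpace EL L] [Group L] {φ : K →* G} {ψ : L →* K}
    (hφ : ContMDiff 𝓘(ℂ, EK) 𝓘(ℂ, EG) ω φ) (hψ : ContMDiff 𝓘(ℂ, EL) 𝓘(ℂ, EK) ω ψ)
    (ξ : GroupLieAlgebra 𝓘(ℂ, EL) L) :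
    lieMap (EK := EL) (EG := EG) (φ.comp ψ) ξ =
      lieMap (EK := EK) (EG := EG) φ (lieMap (EK := EL) (EG := EK) ψ ξ) := by
  have h1 : MDifferentiableAt 𝓘(ℂ, EK) 𝓘(ℂ, EG) φ (ψ 1) := (hφ _).mdifferentiableAt (by simp)
  have h2 : MDifferentiableAt 𝓘(ℂ, EL) 𝓘(ℂ, EK) ψ 1 := (hψ _).mdifferentiableAt (by simp)
  have h := mfderiv_comp (1 : L) h1 h2
  have e : ψ 1 = 1 := map_one ψ
  change mfderiv 𝓘(ℂ, EL) 𝓘(ℂ, EG) (φ ∘ ψ) 1 ξ = _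
  rw [h, ContinuousLinearMap.comp_apply]
  change mfderiv 𝓘(ℂ, EK) 𝓘(ℂ, EG) φ (ψ 1) _ = mfderiv 𝓘(ℂ, EK) 𝓘(ℂ, EG) φ 1 _
  rw [e]
  rfl

/-- The adjoint representation `Ad` of a Lie group on its Lie algebra. -/
def adRep (EG : Type*) (G : Type*) [NormedAddCommGroup EG] [NormedSpace ℂ EG] [TopologicalSpace G]
    [ChartedSpace EG G] [Group G] [LieGroup 𝓘(ℂ, EG) ω G] :
    Representation ℂ G (GroupLieAlgebra 𝓘(ℂ, EG) G) where
  toFun g := lieMap (MulAut.conj g).toMonoidHom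
  map_one' := by
    ext ξ
    have : ((MulAut.conj (1 : G)).toMonoidHom : G → G) = id := by ext x; simp
    change mfderiv 𝓘(ℂ, EG) 𝓘(ℂ, EG) ((MulAut.conj (1 : G)).toMonoidHom : G → G) 1 ξ = ξ
    rw [this, mfderiv_id]
    rfl
  map_mul' g g' := by
    ext ξ
    have := lieMap_comp (conj_contMDiff (EG := EG) g) (conj_contMDiff (EG := EG) g') ξ
    rw [Module.End.mul_apply, ← this]
    congr 2
    ext x
    simp

theorem lieMap_adRep [LieGroup 𝓘(ℂ, EG) ω G] [LieGroup 𝓘(ℂ, EK) ω K] {φ : K →* G}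
    (hφ : ContMDiff 𝓘(ℂ, EK) 𝓘(ℂ, EG) ω φ) (k : K) (ξ : GroupLieAlgebra 𝓘(ℂ, EK) K) :
    lieMap (EG := EG) φ (adRep EK K k ξ) = adRep EG G (φ k) (lieMap φ ξ) := by
  have h1 := lieMap_comp hφ (conj_contMDiff (EG := EK) k) ξ
  have h2 := lieMap_comp (conj_contMDiff (EG := EG) (φ k)) hφ ξ
  change lieMap φ (lieMap (MulAut.conj k).toMonoidHom ξ) =
    lieMap (MulAut.conj (φ k)).toMonoidHom (lieMap φ ξ)
  rw [← h1, ← h2]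
  congr 2
  ext x
  simp

end LieGroups

/-! ## Holomorphic principal bundles, associated bundles and Atiyah sequences -/

/-- A holomorphic map of complex manifolds whose differential is everywhere surjective. The complex
structure of a quotient is the unique one for which the quotient map has this property. -/
structure IsHolSubmersion {EA HA A EB B : Type*} [NormedAddCommGroup EA] [NormedSpace ℂ EA]
    [TopologicalSpace HA] [TopologicalSpace A] [ChartedSpace HA A] [NormedAddCommGroup EB]
    [NormedSpace ℂ EB] [TopologicalSpace B] [ChartedSpace EB B] (I : ModelWithCorners ℂ EA HA)
    (q : A → B) : Prop where
  contMDiff : ContMDiff I 𝓘(ℂ, EB) ω q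
  surjective : ∀ a, Function.Surjective (mfderiv I 𝓘(ℂ, EB) q a)

section Principal

variable {EP P EX X EK K : Type*}
  [NormedAddCommGroup EP] [NormedSpace ℂ EP] [TopologicalSpace P] [ChartedSpace EP P]
  [NormedAddCommGroup EX] [NormedSpace ℂ EX] [TopologicalSpace X] [ChartedSpace EX X]
  [NormedAddCommGroup EK] [NormedSpace ℂ EK] [TopologicalSpace K] [ChartedSpace EK K] [Group K]

/-- `π : P → X` with the right action `act p k = p · k` is a holomorphic principal `K`-bundle:
it is locally `K`-equivariantly biholomorphic over the base to `X × K`. -/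
structure IsPrincipalBundle (π : P → X) (act : P → K → P) : Prop where
  act_one : ∀ p, act p 1 = p
  act_mul : ∀ p k l, act p (k * l) = act (act p k) l
  proj_act : ∀ p k, π (act p k) = π p
  contMDiff_proj : ContMDiff 𝓘(ℂ, EP) 𝓘(ℂ, EX) ω π
  contMDiff_act : ContMDiff (𝓘(ℂ, EP).prod 𝓘(ℂ, EK)) 𝓘(ℂ, EP) ω fun q : P × K => act q.1 q.2
  locally_trivial : ∀ x : X, ∃ (U : Set X) (φ : OpenPartialHomeomorph P (X × K)),
    IsOpen U ∧ x ∈ U ∧ φ.source = π ⁻¹' U ∧ φ.target = U ×ˢ Set.univ ∧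
    ContMDiffOn 𝓘(ℂ, EP) (𝓘(ℂ, EX).prod 𝓘(ℂ, EK)) ω φ φ.source ∧
    ContMDiffOn (𝓘(ℂ, EX).prod 𝓘(ℂ, EK)) 𝓘(ℂ, EP) ω φ.symm φ.target ∧
    ∀ p ∈ φ.source, (φ p).1 = π p ∧ ∀ k, (φ (act p k)).2 = (φ p).2 * k

/-- The fibre over `x` of the associated bundle `P ×^K V = (P × V) / K`, for the action
`(p, v) · k = (p · k, k⁻¹ v)`. A `K`-orbit in `π⁻¹(x) × V` is the graph of a `K`-equivariant function
`f : π⁻¹(x) → V`; the class `[p, v]` is the one with `f p = v`. -/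
def assocFiber {V : Type*} [AddCommGroup V] [Module ℂ V] (π : P → X) (act : P → K → P)
    (ρ : Representation ℂ K V) (x : X) : Submodule ℂ ({p : P // π p = x} → V) where
  carrier := {f | ∀ (p q : {p : P // π p = x}) (k : K), q.1 = act p.1 k → f q = ρ k⁻¹ (f p)}
  add_mem' := by
    intro f g hf hg p q k h
    simp [hf p q k h, hg p q k h]
  zero_mem' := by
    intro p q k h
    simp
  smul_mem' := by
    intro c f hf p q k h
    simp [hf p q k h]

variable (EP) in
/-- The associated holomorphic vector bundle `P ×^K V`, for a finite-dimensional representation `V`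
of `K`. A section is holomorphic if the corresponding equivariant function `P → V` is, which in the
finite-dimensional space `V` is tested on linear functionals. -/
def assocBundle {V : Type*} [AddCommGroup V] [Module ℂ V] (π : P → X) (act : P → K → P)
    (ρ : Representation ℂ K V) : HolFamily X where
  fiber x := assocFiber π act ρ x
  IsHolOn U σ := ∀ ℓ : Module.Dual ℂ V,
    ContMDiffOn 𝓘(ℂ, EP) 𝓘(ℂ) ω (fun p : P => ℓ ((σ (π p)).1 ⟨p, rfl⟩)) (π ⁻¹' U)

/-- The map of associated bundles `[p, v] ↦ [p, T v]` induced by a map of representations. -/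
def assocMap {V W : Type*} [AddCommGroup V] [Module ℂ V] [AddCommGroup W] [Module ℂ W]
    (π : P → X) (act : P → K → P) {ρ : Representation ℂ K V} {ρ' : Representation ℂ K W}
    (T : ρ.IntertwiningMap ρ') (x : X) : assocFiber π act ρ x →ₗ[ℂ] assocFiber π act ρ' x where
  toFun f := ⟨fun p => T (f.1 p), by
    intro p q k h
    have h1 := f.2 p q k h
    have h2 := LinearMap.congr_fun (T.isIntertwining' k⁻¹) (f.1 p)
    exact (congrArg T h1).trans h2⟩
  map_add' f g := by
    ext p
    exact map_add T.toLinearMap _ _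
  map_smul' c f := by
    ext p
    exact map_smul T.toLinearMap _ _

variable (EP) in
/-- The sequence of associated bundles of a sequence of representations `V₁ ⟶ V₂ ⟶ V₃`. -/
def assocSeq {V₁ V₂ V₃ : Type*} [AddCommGroup V₁] [Module ℂ V₁] [AddCommGroup V₂] [Module ℂ V₂]
    [AddCommGroup V₃] [Module ℂ V₃] (π : P → X) (act : P → K → P) {ρ₁ : Representation ℂ K V₁}
    {ρ₂ : Representation ℂ K V₂} {ρ₃ : Representation ℂ K V₃} (S : ρ₁.IntertwiningMap ρ₂)
    (T : ρ₂.IntertwiningMap ρ₃) : HolSeq X where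
  left := assocBundle EP π act ρ₁
  mid := assocBundle EP π act ρ₂
  right := assocBundle EP π act ρ₃
  inc := assocMap π act S
  proj := assocMap π act T

variable (EP) in
/-- The fibre over `x` of the Atiyah bundle `At P = Θ_P / K`: a `K`-orbit of tangent vectors to `P`
over `x` is the same as a `K`-invariant field of tangent vectors to `P` along `π⁻¹(x)`. -/
def atiyahFiber (π : P → X) (act : P → K → P) (x : X) :
    Submodule ℂ (∀ p : {p : P // π p = x}, TangentSpace 𝓘(ℂ, EP) p.1) where
  carrier := {v | ∀ (p q : {p : P // π p = x}) (k : K), q.1 = act p.1 k →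
    (v q : EP) = mfderiv 𝓘(ℂ, EP) 𝓘(ℂ, EP) (fun y => act y k) p.1 (v p)}
  add_mem' := by
    intro v w hv hw p q k h
    have e := map_add (mfderiv 𝓘(ℂ, EP) 𝓘(ℂ, EP) (fun y => act y k) p.1) (v p) (w p)
    refine Eq.trans ?_ e.symm
    exact congrArg₂ (fun a b : EP => a + b) (hv p q k h) (hw p q k h)
  zero_mem' := by
    intro p q k h
    exact (map_zero (mfderiv 𝓘(ℂ, EP) 𝓘(ℂ, EP) (fun y => act y k) p.1)).symm
  smul_mem' := by
    intro c v hv p q k h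
    have e := map_smul (mfderiv 𝓘(ℂ, EP) 𝓘(ℂ, EP) (fun y => act y k) p.1) c (v p)
    refine Eq.trans ?_ e.symm
    exact congrArg (fun a : EP => c • a) (hv p q k h)

/-- The Atiyah bundle `At P = Θ_P / K = (π_* Θ_P)^K`: a section over `U` is a `K`-invariant vector
field on `π⁻¹(U)`, and it is holomorphic if this vector field is. -/
def atiyahBundle [IsManifold 𝓘(ℂ, EP) 1 P] (π : P → X) (act : P → K → P) : HolFamily X where
  fiber x := atiyahFiber EP π act x
  IsHolOn U σ := ContMDiffOn 𝓘(ℂ, EP) 𝓘(ℂ, EP).tangent ω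
    (fun p : P => (⟨p, (σ (π p)).1 ⟨p, rfl⟩⟩ : TangentBundle 𝓘(ℂ, EP) P)) (π ⁻¹' U)

/-- The holomorphic tangent bundle `Θ_X`. -/
def tangentFamily [IsManifold 𝓘(ℂ, EX) 1 X] : HolFamily X where
  fiber x := TangentSpace 𝓘(ℂ, EX) x
  IsHolOn U σ := ContMDiffOn 𝓘(ℂ, EX) 𝓘(ℂ, EX).tangent ω
    (fun x : X => (⟨x, σ x⟩ : TangentBundle 𝓘(ℂ, EX) X)) U

variable {π : P → X} {act : P → K → P}

theorem IsPrincipalBundle.exists_proj_eq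
    (h : IsPrincipalBundle (EP := EP) (EX := EX) (EK := EK) π act) (x : X) : ∃ p, π p = x := by
  obtain ⟨U, φ, -, hx, hs, ht, -, -, hφ⟩ := h.locally_trivial x
  have hm : ((x, 1) : X × K) ∈ φ.target := by simp [ht, hx]
  refine ⟨φ.symm (x, 1), ?_⟩
  rw [← (hφ _ (φ.map_target hm)).1, φ.right_inv hm]

theorem IsPrincipalBundle.exists_act_eq
    (h : IsPrincipalBundle (EP := EP) (EX := EX) (EK := EK) π act) (p q : P) (hpq : π p = π q) :
    ∃ k, act p k = q := by
  obtain ⟨U, φ, -, hx, hs, ht, -, -, hφ⟩ := h.locally_trivial (π p)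
  have hp : p ∈ φ.source := by rw [hs]; exact hx
  have hq : q ∈ φ.source := by rw [hs]; simpa [← hpq] using hx
  have hk : ∀ k, act p k ∈ φ.source := fun k => by
    rw [hs]; simpa [h.proj_act] using hx
  refine ⟨(φ p).2⁻¹ * (φ q).2, φ.injOn (hk _) hq (Prod.ext ?_ ?_)⟩
  · rw [(hφ _ (hk _)).1, (hφ _ hq).1, h.proj_act, hpq]
  · rw [(hφ _ hp).2]; group

theorem IsPrincipalBundle.contMDiff_act_right
    (h : IsPrincipalBundle (EP := EP) (EX := EX) (EK := EK) π act) (k : K) :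
    ContMDiff 𝓘(ℂ, EP) 𝓘(ℂ, EP) ω fun y => act y k :=
  h.contMDiff_act.comp (contMDiff_id.prodMk contMDiff_const)

theorem IsPrincipalBundle.contMDiff_orbit
    (h : IsPrincipalBundle (EP := EP) (EX := EX) (EK := EK) π act) (p : P) :
    ContMDiff 𝓘(ℂ, EK) 𝓘(ℂ, EP) ω fun k => act p k :=
  h.contMDiff_act.comp (contMDiff_const.prodMk contMDiff_id)

/-- The inclusion `ad P → At P`, `[p, η] ↦ [d/dt (p · exp tη)]`, induced by the identification of the
vertical tangent bundle of `P` with `P × 𝔨` through the action. -/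
def atiyahInc [LieGroup 𝓘(ℂ, EK) ω K]
    (h : IsPrincipalBundle (EP := EP) (EX := EX) (EK := EK) π act) (x : X) :
    assocFiber π act (adRep EK K) x →ₗ[ℂ] atiyahFiber EP π act x where
  toFun f := ⟨fun p => (mfderiv 𝓘(ℂ, EK) 𝓘(ℂ, EP) (fun k => act p.1 k) 1 (f.1 p) : EP), by
    intro p q k hq
    have hf : f.1 q = mfderiv 𝓘(ℂ, EK) 𝓘(ℂ, EK) (MulAut.conj k⁻¹).toMonoidHom 1 (f.1 p) :=
      f.2 p q k hq
    have h1 : MDifferentiableAt 𝓘(ℂ, EK) 𝓘(ℂ, EP) (fun l => act q.1 l)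
        ((MulAut.conj k⁻¹).toMonoidHom 1) := (h.contMDiff_orbit q.1 _).mdifferentiableAt (by simp)
    have h2 : MDifferentiableAt 𝓘(ℂ, EK) 𝓘(ℂ, EK) (MulAut.conj k⁻¹).toMonoidHom 1 :=
      (conj_contMDiff k⁻¹ _).mdifferentiableAt (by simp)
    have h3 : MDifferentiableAt 𝓘(ℂ, EP) 𝓘(ℂ, EP) (fun y => act y k) (act p.1 1) :=
      (h.contMDiff_act_right k _).mdifferentiableAt (by simp)
    have h4 : MDifferentiableAt 𝓘(ℂ, EK) 𝓘(ℂ, EP) (fun l => act p.1 l) 1 :=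
      (h.contMDiff_orbit p.1 _).mdifferentiableAt (by simp)
    have hc : (fun l => act q.1 l) ∘ (MulAut.conj k⁻¹).toMonoidHom =
        (fun y => act y k) ∘ fun l => act p.1 l := by
      ext l
      simp [hq, ← h.act_mul, mul_assoc]
    have e1 := mfderiv_comp (1 : K) h1 h2
    have e2 := mfderiv_comp (1 : K) h3 h4
    rw [hc] at e1
    have e3 := DFunLike.congr_fun (e1.symm.trans e2) (f.1 p)
    rw [map_one] at e3
    have e4 : ∀ w : EP, (mfderiv 𝓘(ℂ, EP) 𝓘(ℂ, EP) (fun y => act y k) (act p.1 1) w : EP) =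
        mfderiv 𝓘(ℂ, EP) 𝓘(ℂ, EP) (fun y => act y k) p.1 w := by
      intro w
      rw [h.act_one]
    change mfderiv 𝓘(ℂ, EK) 𝓘(ℂ, EP) (fun l => act q.1 l) 1 (f.1 q) = _
    rw [hf]
    exact e3.trans (e4 _)⟩
  map_add' f g := by
    ext p
    exact map_add (mfderiv 𝓘(ℂ, EK) 𝓘(ℂ, EP) (fun k => act p.1 k) 1) (f.1 p) (g.1 p)
  map_smul' c f := by
    ext p
    exact map_smul (mfderiv 𝓘(ℂ, EK) 𝓘(ℂ, EP) (fun k => act p.1 k) 1) c (f.1 p)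

/-- The projection `At P → Θ_X`, `[v] ↦ dπ(v)`, evaluated on a representative of the class. -/
def atiyahProj (h : IsPrincipalBundle (EP := EP) (EX := EX) (EK := EK) π act) (x : X) :
    atiyahFiber EP π act x →ₗ[ℂ] TangentSpace 𝓘(ℂ, EX) x where
  toFun v := (mfderiv 𝓘(ℂ, EP) 𝓘(ℂ, EX) π (h.exists_proj_eq x).choose
    (v.1 ⟨_, (h.exists_proj_eq x).choose_spec⟩) : EX)
  map_add' v w := map_add (mfderiv 𝓘(ℂ, EP) 𝓘(ℂ, EX) π (h.exists_proj_eq x).choose)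
    (v.1 ⟨_, (h.exists_proj_eq x).choose_spec⟩) (w.1 ⟨_, (h.exists_proj_eq x).choose_spec⟩)
  map_smul' c v := map_smul (mfderiv 𝓘(ℂ, EP) 𝓘(ℂ, EX) π (h.exists_proj_eq x).choose) c
    (v.1 ⟨_, (h.exists_proj_eq x).choose_spec⟩)

/-- The projection `At P → Θ_X` does not depend on the representative. -/
theorem atiyahProj_eq (h : IsPrincipalBundle (EP := EP) (EX := EX) (EK := EK) π act) (x : X)
    (v : atiyahFiber EP π act x) (p : {p : P // π p = x}) :
    (atiyahProj h x v : EX) = mfderiv 𝓘(ℂ, EP) 𝓘(ℂ, EX) π p.1 (v.1 p) := by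
  have hq := (h.exists_proj_eq x).choose_spec
  change (mfderiv 𝓘(ℂ, EP) 𝓘(ℂ, EX) π (h.exists_proj_eq x).choose (v.1 ⟨_, hq⟩) : EX) = _
  generalize (h.exists_proj_eq x).choose = q at hq
  obtain ⟨k, hk⟩ := h.exists_act_eq p.1 q (p.2.trans hq.symm)
  have hv := v.2 p ⟨q, hq⟩ k hk.symm
  have h1 : MDifferentiableAt 𝓘(ℂ, EP) 𝓘(ℂ, EX) π (act p.1 k) :=
    (h.contMDiff_proj _).mdifferentiableAt (by simp)
  have h2 : MDifferentiableAt 𝓘(ℂ, EP) 𝓘(ℂ, EP) (fun y => act y k) p.1 :=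
    (h.contMDiff_act_right k _).mdifferentiableAt (by simp)
  have e := mfderiv_comp p.1 h1 h2
  have hc : π ∘ (fun y => act y k) = π := by
    ext y
    exact h.proj_act y k
  rw [hc] at e
  have e2 := DFunLike.congr_fun e (v.1 p)
  rw [hk] at e2
  refine Eq.trans ?_ e2.symm
  exact congrArg (fun w : EP => (mfderiv 𝓘(ℂ, EP) 𝓘(ℂ, EX) π q (w : EP) : EX)) hv

/-- The Atiyah sequence `ad P ⟶ At P ⟶ Θ_X` of a holomorphic principal bundle, where
`ad P = P ×^K 𝔨` for the adjoint representation. -/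
def atiyahSeq [LieGroup 𝓘(ℂ, EK) ω K] [IsManifold 𝓘(ℂ, EP) 1 P] [IsManifold 𝓘(ℂ, EX) 1 X]
    (h : IsPrincipalBundle (EP := EP) (EX := EX) (EK := EK) π act) : HolSeq X where
  left := assocBundle EP π act (adRep EK K)
  mid := atiyahBundle (EP := EP) π act
  right := tangentFamily (EX := EX)
  inc := atiyahInc h
  proj := atiyahProj h

end Principal

/-! ## Homogeneous spaces -/

section Homogeneous

variable {EG G EH EM M : Type*}
  [NormedAddCommGroup EG] [NormedSpace ℂ EG] [TopologicalSpace G] [ChartedSpace EG G] [Group G]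
  [NormedAddCommGroup EH] [NormedSpace ℂ EH] {H : Subgroup G} [ChartedSpace EH H]
  [NormedAddCommGroup EM] [NormedSpace ℂ EM] [TopologicalSpace M] [ChartedSpace EM M] [Group M]

variable (EG EH H) in
/-- The complex structure on `H` (whose topology is the subspace topology) is that of a complex Lie
subgroup: the inclusion into `G` is a holomorphic immersion. -/
structure IsHolSubgroup : Prop where
  contMDiff : ContMDiff 𝓘(ℂ, EH) 𝓘(ℂ, EG) ω (H.subtype : H → G)
  injective : ∀ h : H, Function.Injective (mfderiv 𝓘(ℂ, EH) 𝓘(ℂ, EG) (H.subtype : H → G) h)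

/-- The projection `G → G/H`, `g ↦ g H`. -/
abbrev cosetProj (H : Subgroup G) : G → G ⧸ H := QuotientGroup.mk

/-- The right action of `H` on `G` by multiplication. -/
abbrev cosetAct (H : Subgroup G) : G → H → G := fun g h => g * h

/-- The right-invariant vector field on `M` with value `η` at the identity: `b ↦ dR_b η`. (The
left-invariant one, `a ↦ dL_a ξ`, is `mulInvariantVectorField ξ`.) -/
def rightInvariantField (η : GroupLieAlgebra 𝓘(ℂ, EM) M) (b : M) : TangentSpace 𝓘(ℂ, EM) b :=
  (mfderiv 𝓘(ℂ, EM) 𝓘(ℂ, EM) (fun y => y * b) 1 η : EM)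

variable [LieGroup 𝓘(ℂ, EG) ω G] [LieGroup 𝓘(ℂ, EH) ω H] [LieGroup 𝓘(ℂ, EM) ω M]

variable (EG EH H) in
/-- The inclusion `𝔥 → 𝔤`. -/
def lieIncl : GroupLieAlgebra 𝓘(ℂ, EH) H →ₗ[ℂ] GroupLieAlgebra 𝓘(ℂ, EG) G :=
  lieMap H.subtype

variable (EG H) in
/-- `𝔤` as a representation of `H`, through the adjoint representation of `G`. -/
def adRestrict : Representation ℂ H (GroupLieAlgebra 𝓘(ℂ, EG) G) :=
  (adRep EG G).comp H.subtype

/-- The representation `𝔤/𝔥` of `H`. -/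
def isotropyRep (hH : IsHolSubgroup EG EH H) :
    Representation ℂ H (GroupLieAlgebra 𝓘(ℂ, EG) G ⧸ LinearMap.range (lieIncl EG EH H)) :=
  (adRestrict EG H).quotient (LinearMap.range (lieIncl EG EH H)) (by
    rintro h _ ⟨ξ, rfl⟩
    exact ⟨adRep EH H h ξ, lieMap_adRep hH.contMDiff h ξ⟩)

/-- The inclusion `𝔥 → 𝔤` as a map of `H`-representations. -/
def inclRep (hH : IsHolSubgroup EG EH H) :
    (adRep EH H).IntertwiningMap (adRestrict EG H) where
  toLinearMap := lieIncl EG EH H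
  isIntertwining' h := by
    ext ξ
    exact lieMap_adRep hH.contMDiff h ξ

/-- The quotient map `𝔤 → 𝔤/𝔥` as a map of `H`-representations. -/
def quotRep (hH : IsHolSubgroup EG EH H) :
    (adRestrict EG H).IntertwiningMap (isotropyRep hH) where
  toLinearMap := (LinearMap.range (lieIncl EG EH H)).mkQ
  isIntertwining' h := by
    ext ξ
    rfl

/-- `𝔪` as a representation of `H` through `τ : H → M` and the adjoint representation of `M`. -/
def adPull (EM : Type*) [NormedAddCommGroup EM] [NormedSpace ℂ EM] [ChartedSpace EM M]
    [LieGroup 𝓘(ℂ, EM) ω M] (τ : H →* M) : Representation ℂ H (GroupLieAlgebra 𝓘(ℂ, EM) M) :=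
  (adRep EM M).comp τ

/-- The map `𝔥 → 𝔤 ⊕ 𝔪`, `ξ ↦ (ξ, -dτ(ξ))`. -/
def twistedIncl (EG EH EM : Type*) [NormedAddCommGroup EG] [NormedSpace ℂ EG] [ChartedSpace EG G]
    [NormedAddCommGroup EH] [NormedSpace ℂ EH] [ChartedSpace EH H]
    [NormedAddCommGroup EM] [NormedSpace ℂ EM] [ChartedSpace EM M] (τ : H →* M) :
    GroupLieAlgebra 𝓘(ℂ, EH) H →ₗ[ℂ]
      GroupLieAlgebra 𝓘(ℂ, EG) G × GroupLieAlgebra 𝓘(ℂ, EM) M :=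
  (lieIncl EG EH H).prod (-lieMap τ)

/-- The representation `(𝔤 ⊕ 𝔪)/𝔥` of `H`, with `𝔥` embedded by `ξ ↦ (ξ, -dτ(ξ))`. -/
def twistedRep (hH : IsHolSubgroup EG EH H) {τ : H →* M}
    (hτ : ContMDiff 𝓘(ℂ, EH) 𝓘(ℂ, EM) ω τ) :
    Representation ℂ H ((GroupLieAlgebra 𝓘(ℂ, EG) G × GroupLieAlgebra 𝓘(ℂ, EM) M) ⧸
      LinearMap.range (twistedIncl EG EH EM τ)) :=
  ((adRestrict EG H).prod (adPull EM τ)).quotient (LinearMap.range (twistedIncl EG EH EM τ)) (by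
    rintro h _ ⟨ξ, rfl⟩
    refine ⟨adRep EH H h ξ, Prod.ext (lieMap_adRep hH.contMDiff h ξ) ?_⟩
    exact (congrArg Neg.neg (lieMap_adRep hτ h ξ)).trans
      (map_neg (adRep EM M (τ h)) (lieMap τ ξ)).symm)

/-- The map `𝔪 → (𝔤 ⊕ 𝔪)/𝔥`, `η ↦ [(0, η)]`, as a map of `H`-representations. -/
def twistedInc (hH : IsHolSubgroup EG EH H) {τ : H →* M}
    (hτ : ContMDiff 𝓘(ℂ, EH) 𝓘(ℂ, EM) ω τ) :
    (adPull EM τ).IntertwiningMap (twistedRep hH hτ) where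
  toLinearMap := (LinearMap.range (twistedIncl EG EH EM τ)).mkQ ∘ₗ LinearMap.inr ℂ _ _
  isIntertwining' h := by
    ext η
    refine congrArg (LinearMap.range (twistedIncl EG EH EM τ)).mkQ (Prod.ext ?_ rfl)
    exact (map_zero (adRestrict EG H h)).symm

/-- The map `(𝔤 ⊕ 𝔪)/𝔥 → 𝔤/𝔥`, `[(ξ, η)] ↦ [ξ]`, as a map of `H`-representations. -/
def twistedProj (hH : IsHolSubgroup EG EH H) {τ : H →* M}
    (hτ : ContMDiff 𝓘(ℂ, EH) 𝓘(ℂ, EM) ω τ) :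
    (twistedRep hH hτ).IntertwiningMap (isotropyRep hH) where
  toLinearMap := Submodule.mapQ _ _ (LinearMap.fst ℂ _ _) (by
    rintro _ ⟨ξ, rfl⟩
    exact ⟨ξ, rfl⟩)
  isIntertwining' h := by
    apply Submodule.linearMap_qext
    ext v <;> rfl

/-- The orbit relation of the right action `(a, b) · h = (a h, τ(h)⁻¹ b)` of `H` on `G × M`. -/
def extSetoid (τ : H →* M) : Setoid (G × M) where
  r u v := ∃ h : H, v = (u.1 * h, (τ h)⁻¹ * u.2)
  iseqv :=
    { refl := fun u => ⟨1, by simp⟩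
      symm := by
        rintro u _ ⟨h, rfl⟩
        exact ⟨h⁻¹, by simp⟩
      trans := by
        rintro u _ _ ⟨h, rfl⟩ ⟨k, rfl⟩
        exact ⟨h * k, by simp [mul_assoc]⟩ }

/-- The extension of structure group `G^τ = G ×^τ M = (G × M) / H`, with the quotient topology. -/
def ExtBundle (τ : H →* M) : Type _ := Quotient (extSetoid τ)

instance (τ : H →* M) : TopologicalSpace (ExtBundle τ) :=
  inferInstanceAs (TopologicalSpace (Quotient (extSetoid τ)))

/-- The quotient map `ρ : G × M → G^τ`. -/
def extMk (τ : H →* M) (u : G × M) : ExtBundle τ := Quotient.mk (extSetoid τ) u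

/-- The projection `G^τ → G/H`, `[a, b] ↦ a H`. -/
def extProj (τ : H →* M) : ExtBundle τ → G ⧸ H :=
  Quotient.lift (fun u : G × M => (u.1 : G ⧸ H)) (by
    rintro u _ ⟨h, rfl⟩
    simp)

/-- The right action `[a, b] · m = [a, b m]` of `M` on `G^τ`. -/
def extAct (τ : H →* M) (p : ExtBundle τ) (m : M) : ExtBundle τ :=
  Quotient.map (fun u : G × M => (u.1, u.2 * m)) (by
    rintro u _ ⟨h, rfl⟩
    exact ⟨h, by simp [mul_assoc]⟩) p

end Homogeneous

end

/-! Left translation trivialises the tangent bundle of `G`. In this trivialisation the right action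
of `h ∈ H` on tangent vectors sends `(a, ξ)` to `(ah, Ad_{h⁻¹} ξ)`, because `ah · h⁻¹xh = axh`.
Hence `Θ_G / H` is `G ×^H 𝔤`. The kernel of `ξ ↦ dπ(dL_a ξ)` is `𝔥` for every `a`
(`mem_range_lieIncl_of_tderiv_coset_eq_zero`), so `Θ_X` is `G ×^H (𝔤/𝔥)`.

For `G^τ`, trivialise the tangent bundle of `G × M` by left translations on `G` and right
translations on `M`. Differentiating `[ah, b] = [a, τ(h)b]` at `h = 1` shows that the directions of
the `H`-orbits become the constant subspace `{(ξ, -dτ ξ)}`; there are no others in the kernel of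
`dρ` (`mem_range_twistedIncl_of_twistedDeriv_eq_zero`). The right action of `M` does not change the
coordinates `(ξ, η)`, while `H` acts on them by the two adjoint representations. So invariant fields
on `G^τ` over `aH` are elements of `(𝔤 ⊕ 𝔪)/𝔥`, taken up to `H`. The factor `Ad_{b⁻¹}` on the
adjoint bundle comes from `[a, b] · b⁻¹yb = [a, yb]`, which compares right translations on `M` with
the orbit maps of the action.

All the holomorphy comes from two consequences of the inverse function theorem: submersions have
local sections (`ContMDiffAt.exists_local_section`) and immersions have local retractions
(`ContMDiffAt.exists_local_retraction`). The first gives sections of `π` and `ρ`; the second makes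
`H`-valued maps holomorphic as soon as they are so in `G`. Fields are moved to the identity by
translations depending holomorphically on a parameter (`IsHolFieldAt.map_param`), where they become
functions with values in a fixed vector space (`isHolFieldAt_const_iff`).

Exactness is proved for the associated sequences, where it is linear algebra in a single fibre, and
is carried to the Atiyah sequences by the isomorphisms (`HolSeq.IsShortExact.of_iso`). -/

noncomputable section

/-! ### Differentials, local sections of submersions and local retractions of immersions. -/

section TangentDerivative

open scoped Topology
open Filter Set

variable {E₁ H₁ A E₂ H₂ B E₃ H₃ C : Type*}
  [NormedAddCommGroup E₁] [NormedSpace ℂ E₁] [TopologicalSpace H₁] [TopologicalSpace A]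
  [ChartedSpace H₁ A]
  [NormedAddCommGroup E₂] [NormedSpace ℂ E₂] [TopologicalSpace H₂] [TopologicalSpace B]
  [ChartedSpace H₂ B]
  [NormedAddCommGroup E₃] [NormedSpace ℂ E₃] [TopologicalSpace H₃] [TopologicalSpace C]
  [ChartedSpace H₃ C]
  (I₁ : ModelWithCorners ℂ E₁ H₁) (I₂ : ModelWithCorners ℂ E₂ H₂) (I₃ : ModelWithCorners ℂ E₃ H₃)

/-- The differential of a map of manifolds, as a map between the model vector spaces. -/
def tderiv (f : A → B) (a : A) : E₁ →L[ℂ] E₂ := mfderiv I₁ I₂ f a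

variable {I₁ I₂ I₃}

/-- The chain rule applied to a vector of the model space: as the types do not mention base points,
identities such as `a * 1 = a` can be rewritten freely. -/
theorem ContMDiffAt.tderiv_comp {g : B → C} {f : A → B} {a : A}
    (hg : ContMDiffAt I₂ I₃ ω g (f a)) (hf : ContMDiffAt I₁ I₂ ω f a) (v : E₁) :
    tderiv I₁ I₃ (fun x => g (f x)) a v = tderiv I₂ I₃ g (f a) (tderiv I₁ I₂ f a v) :=
  DFunLike.congr_fun (mfderiv_comp a (hg.mdifferentiableAt (by simp))
    (hf.mdifferentiableAt (by simp))) v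

theorem tderiv_congr {f g : A → B} {a : A} (h : f =ᶠ[𝓝 a] g) :
    tderiv I₁ I₂ f a = tderiv I₁ I₂ g a :=
  h.mfderiv_eq

theorem tderiv_id (a : A) : tderiv I₁ I₁ (fun x : A => x) a = ContinuousLinearMap.id ℂ E₁ :=
  mfderiv_id

theorem tderiv_const (a : A) (b : B) : tderiv I₁ I₂ (fun _ : A => b) a = 0 :=
  mfderiv_const

theorem ContMDiffAt.tderiv_prod {f : A × B → C} {p : A × B}
    (hf : ContMDiffAt (I₁.prod I₂) I₃ ω f p) (v : E₁ × E₂) :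
    tderiv (I₁.prod I₂) I₃ f p v =
      tderiv I₁ I₃ (fun x => f (x, p.2)) p.1 v.1 + tderiv I₂ I₃ (fun y => f (p.1, y)) p.2 v.2 :=
  mfderiv_prod_eq_add_apply (hf.mdifferentiableAt (by simp))

theorem ContMDiffAt.tderiv_prodMk {f : A → B} {g : A → C} {a : A}
    (hf : ContMDiffAt I₁ I₂ ω f a) (hg : ContMDiffAt I₁ I₃ ω g a) (v : E₁) :
    tderiv I₁ (I₂.prod I₃) (fun x => (f x, g x)) a v =
      (tderiv I₁ I₂ f a v, tderiv I₁ I₃ g a v) :=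
  DFunLike.congr_fun (mfderiv_prodMk (hf.mdifferentiableAt (by simp))
    (hg.mdifferentiableAt (by simp))) v

theorem ContMDiffAt.hasFDerivAt_writtenInExtChartAt [I₁.Boundaryless] {f : A → B} {a : A}
    (hf : ContMDiffAt I₁ I₂ ω f a) :
    ContDiffAt ℂ ω (writtenInExtChartAt I₁ I₂ a f) (extChartAt I₁ a a) ∧
      HasFDerivAt (writtenInExtChartAt I₁ I₂ a f) (tderiv I₁ I₂ f a) (extChartAt I₁ a a) := by
  have h := (contMDiffAt_iff.1 hf).2
  rw [I₁.range_eq_univ, contDiffWithinAt_univ] at h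
  refine ⟨h, ?_⟩
  have h1 := (hf.mdifferentiableAt (by simp)).mfderiv
  rw [I₁.range_eq_univ, fderivWithin_univ] at h1
  have h2 : tderiv I₁ I₂ f a =
    fderiv ℂ (writtenInExtChartAt I₁ I₂ a f) (extChartAt I₁ a a) := h1
  rw [h2]
  exact (h.differentiableAt (by simp)).hasFDerivAt

theorem ContDiffAt.exists_local_inverse [CompleteSpace E₁] {g : E₁ → E₁} {a : E₁}
    (hg : ContDiffAt ℂ ω g a) (h : HasFDerivAt g (ContinuousLinearMap.id ℂ E₁) a) :
    ∃ k : E₁ → E₁, ContDiffAt ℂ ω k (g a) ∧ k (g a) = a ∧ (∀ᶠ y in 𝓝 (g a), g (k y) = y) ∧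
      ∀ᶠ x in 𝓝 a, k (g x) = x := by
  have h' : HasFDerivAt g ((ContinuousLinearEquiv.refl ℂ E₁ : E₁ ≃L[ℂ] E₁) : E₁ →L[ℂ] E₁) a := h
  have hs := hg.hasStrictFDerivAt' h' (by simp)
  exact ⟨hg.localInverse h' (by simp), hg.to_localInverse h' (by simp),
    hg.localInverse_apply_image h' (by simp), hs.eventually_right_inverse,
    hs.eventually_left_inverse⟩

/-- A holomorphic map has a holomorphic local section through every point at which its differential
is surjective. -/
theorem ContMDiffAt.exists_local_section [FiniteDimensional ℂ E₂] [I₁.Boundaryless]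
    [I₂.Boundaryless] [IsManifold I₁ ω A] [IsManifold I₂ ω B] {q : A → B} {a : A}
    (hq : ContMDiffAt I₁ I₂ ω q a) (hs : Function.Surjective (tderiv I₁ I₂ q a)) :
    ∃ (t : B → A) (W : Set B), IsOpen W ∧ q a ∈ W ∧ ContMDiffOn I₂ I₁ ω t W ∧ t (q a) = a ∧
      ∀ y ∈ W, q (t y) = y := by
  have : CompleteSpace E₂ := FiniteDimensional.complete ℂ E₂
  -- With a linear right inverse `R` of the differential, the chart expression of `q` restricted to
  -- the slice `c + R z` has derivative the identity at `z = 0`; inverting it gives the section.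
  obtain ⟨R, hR⟩ := (tderiv I₁ I₂ q a).exists_rightInverse_of_surjective
    (LinearMap.range_eq_top.2 hs)
  obtain ⟨h1, h2⟩ := hq.hasFDerivAt_writtenInExtChartAt
  set F := writtenInExtChartAt I₁ I₂ a q with hF
  set c := extChartAt I₁ a a with hc
  have hFc : F c = extChartAt I₂ (q a) (q a) := by simp [hF, hc, writtenInExtChartAt]
  let j : E₂ → E₁ := fun z => c + R z
  have hj0 : j 0 = c := by simp [j]
  have hj : ContDiff ℂ ω j := contDiff_const.add R.contDiff
  have hj' : HasFDerivAt j R 0 := R.hasFDerivAt.const_add c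
  have hg : ContDiffAt ℂ ω (F ∘ j) 0 := by
    refine ContDiffAt.comp 0 ?_ hj.contDiffAt
    rw [hj0]; exact h1
  have hg' : HasFDerivAt (F ∘ j) (ContinuousLinearMap.id ℂ E₂) 0 := by
    rw [← hR]
    refine HasFDerivAt.comp 0 ?_ hj'
    rw [hj0]; exact h2
  obtain ⟨k, hk, hk0, hkr, -⟩ := hg.exists_local_inverse hg'
  have hgc : (F ∘ j) 0 = extChartAt I₂ (q a) (q a) := by
    rw [Function.comp_apply, hj0, hFc]
  rw [hgc] at hk hk0 hkr
  let t : B → A := fun y => (extChartAt I₁ a).symm (j (k (extChartAt I₂ (q a) y)))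
  have hta : t (q a) = a := by
    change (extChartAt I₁ a).symm (j (k (extChartAt I₂ (q a) (q a)))) = a
    rw [hk0, hj0, hc, extChartAt_to_inv]
  have ht : ContMDiffAt I₂ I₁ ω t (q a) := by
    have e1 : ContMDiffAt I₂ 𝓘(ℂ, E₂) ω (extChartAt I₂ (q a)) (q a) := contMDiffAt_extChartAt
    have e2 : ContMDiffAt I₂ 𝓘(ℂ, E₁) ω (fun y => j (k (extChartAt I₂ (q a) y))) (q a) :=
      hj.contMDiff.contMDiffAt.comp (q a) (ContMDiffAt.comp (q a) hk.contMDiffAt e1)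
    have e3 : ContMDiffAt 𝓘(ℂ, E₁) I₁ ω (extChartAt I₁ a).symm
        (j (k (extChartAt I₂ (q a) (q a)))) := by
      rw [hk0, hj0]
      exact (contMDiffOn_extChartAt_symm a).contMDiffAt (extChartAt_target_mem_nhds a)
    exact ContMDiffAt.comp (q a) e3 e2
  have hqt : ∀ᶠ y in 𝓝 (q a), q (t y) = y := by
    have e1 : ∀ᶠ y in 𝓝 (q a), y ∈ (extChartAt I₂ (q a)).source := extChartAt_source_mem_nhds (q a)
    -- The inverse function theorem gives the equality in the chart only. Both points must lie in
    -- the chart domain before its injectivity applies.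
    have e2 : ∀ᶠ y in 𝓝 (q a), q (t y) ∈ (extChartAt I₂ (q a)).source := by
      have hc : ContinuousAt (fun y => q (t y)) (q a) := by
        refine ContinuousAt.comp ?_ ht.continuousAt
        rw [hta]; exact hq.continuousAt
      refine hc.eventually_mem ?_
      rw [hta]; exact extChartAt_source_mem_nhds (q a)
    have e3 := (continuousAt_extChartAt (I := I₂) (q a)).eventually hkr
    filter_upwards [e1, e2, e3] with y h1 h2 h3
    exact (extChartAt I₂ (q a)).injOn h2 h1 h3
  obtain ⟨u, hu, htu⟩ := (contMDiffAt_iff_contMDiffOn_nhds (by simp)).1 ht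
  obtain ⟨W, hW, hWo, haW⟩ := mem_nhds_iff.1 (Filter.inter_mem hu hqt)
  exact ⟨t, W, hWo, haW, htu.mono fun y hy => (hW hy).1, hta, fun y hy => (hW hy).2⟩

/-- A holomorphic map has a holomorphic local retraction near every point at which its differential
is injective. -/
theorem ContMDiffAt.exists_local_retraction [FiniteDimensional ℂ E₁] [FiniteDimensional ℂ E₂]
    [I₁.Boundaryless] [IsManifold I₁ ω A] [IsManifold I₂ ω B] {f : A → B} {a : A}
    (hf : ContMDiffAt I₁ I₂ ω f a) (hi : Function.Injective (tderiv I₁ I₂ f a)) :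
    ∃ r : B → A, ContMDiffAt I₂ I₁ ω r (f a) ∧ ∀ᶠ x in 𝓝 a, r (f x) = x := by
  have : CompleteSpace E₁ := FiniteDimensional.complete ℂ E₁
  -- Dual to the section: a left inverse `L` of the differential makes `L ∘ F` locally invertible,
  -- and the retraction is its inverse after `L`, read in charts.
  obtain ⟨L, hL⟩ : ∃ L : E₂ →L[ℂ] E₁, L ∘L tderiv I₁ I₂ f a = ContinuousLinearMap.id ℂ E₁ := by
    obtain ⟨L, hL⟩ := (tderiv I₁ I₂ f a : E₁ →ₗ[ℂ] E₂).exists_leftInverse_of_injective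
      (LinearMap.ker_eq_bot.2 hi)
    exact ⟨L.toContinuousLinearMap, by ext v; exact LinearMap.congr_fun hL v⟩
  obtain ⟨h1, h2⟩ := hf.hasFDerivAt_writtenInExtChartAt
  set F := writtenInExtChartAt I₁ I₂ a f with hF
  set c := extChartAt I₁ a a with hc
  have hFc : F c = extChartAt I₂ (f a) (f a) := by simp [hF, hc, writtenInExtChartAt]
  have hg : ContDiffAt ℂ ω (L ∘ F) c := L.contDiff.contDiffAt.comp c h1
  have hg' : HasFDerivAt (L ∘ F) (ContinuousLinearMap.id ℂ E₁) c := by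
    rw [← hL]
    exact L.hasFDerivAt.comp c h2
  obtain ⟨k, hk, hk0, -, hkl⟩ := hg.exists_local_inverse hg'
  rw [Function.comp_apply, hFc] at hk hk0
  refine ⟨fun y => (extChartAt I₁ a).symm (k (L (extChartAt I₂ (f a) y))), ?_, ?_⟩
  · have e1 : ContMDiffAt I₂ 𝓘(ℂ, E₂) ω (extChartAt I₂ (f a)) (f a) := contMDiffAt_extChartAt
    have e2 : ContMDiffAt I₂ 𝓘(ℂ, E₁) ω (fun y => L (extChartAt I₂ (f a) y)) (f a) :=
      L.contDiff.contMDiff.contMDiffAt.comp (f a) e1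
    have e2' : ContMDiffAt I₂ 𝓘(ℂ, E₁) ω (fun y => k (L (extChartAt I₂ (f a) y))) (f a) :=
      ContMDiffAt.comp (f a) hk.contMDiffAt e2
    have e3 : ContMDiffAt 𝓘(ℂ, E₁) I₁ ω (extChartAt I₁ a).symm
        (k (L (extChartAt I₂ (f a) (f a)))) := by
      rw [hk0]
      exact (contMDiffOn_extChartAt_symm a).contMDiffAt (extChartAt_target_mem_nhds a)
    exact ContMDiffAt.comp (f a) e3 e2'
  · have e1 : ∀ᶠ x in 𝓝 a, x ∈ (extChartAt I₁ a).source := extChartAt_source_mem_nhds a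
    have e3 := (continuousAt_extChartAt (I := I₁) a).eventually hkl
    filter_upwards [e1, e3] with x h1 h3
    have h4 : F (extChartAt I₁ a x) = extChartAt I₂ (f a) (f x) := by
      simp only [hF, writtenInExtChartAt, Function.comp_apply]
      rw [(extChartAt I₁ a).left_inv h1]
    rw [Function.comp_apply, h4] at h3
    rw [h3, (extChartAt I₁ a).left_inv h1]

/-- A continuous map into the source of an immersion is holomorphic if its composition with the
immersion is. -/
theorem ContMDiffAt.of_comp_immersion [FiniteDimensional ℂ E₁] [FiniteDimensional ℂ E₂]
    [I₁.Boundaryless] [IsManifold I₁ ω A] [IsManifold I₂ ω B] {f : A → B} {s : C → A} {c : C}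
    (hf : ContMDiffAt I₁ I₂ ω f (s c)) (hi : Function.Injective (tderiv I₁ I₂ f (s c)))
    (hs : ContinuousAt s c) (hfs : ContMDiffAt I₃ I₂ ω (fun x => f (s x)) c) :
    ContMDiffAt I₃ I₁ ω s c := by
  obtain ⟨r, hr, h⟩ := hf.exists_local_retraction hi
  have h1 : ContMDiffAt I₃ I₁ ω (fun x => r (f (s x))) c := ContMDiffAt.comp c hr hfs
  refine h1.congr_of_eventuallyEq ?_
  -- Continuity of `s` keeps `s x` where the retraction inverts `f`.
  filter_upwards [hs.eventually h] with x hx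
  exact hx.symm

/-- A map out of the target of a surjective holomorphic submersion is holomorphic if its composition
with the submersion is. -/
theorem ContMDiffAt.of_comp_submersion [FiniteDimensional ℂ E₂] [I₁.Boundaryless]
    [I₂.Boundaryless] [IsManifold I₁ ω A] [IsManifold I₂ ω B] {q : A → B} {a : A} {f : B → C}
    (hq : ContMDiffAt I₁ I₂ ω q a) (hs : Function.Surjective (tderiv I₁ I₂ q a))
    (hf : ContMDiffAt I₁ I₃ ω (fun x => f (q x)) a) : ContMDiffAt I₂ I₃ ω f (q a) := by
  obtain ⟨t, W, hW, haW, ht, hta, hqt⟩ := hq.exists_local_section hs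
  have h1 : ContMDiffAt I₂ I₃ ω (fun y => f (q (t y))) (q a) := by
    refine ContMDiffAt.comp (q a) (g := fun x => f (q x)) ?_ (ht.contMDiffAt (hW.mem_nhds haW))
    rw [hta]; exact hf
  refine h1.congr_of_eventuallyEq ?_
  filter_upwards [hW.mem_nhds haW] with y hy
  rw [hqt y hy]

end TangentDerivative

/-! ### Holomorphic fields of tangent vectors along a map. -/

section HolomorphicFields

open scoped Topology
open Filter Set

variable {E₀ H₀ Y E₁ H₁ A E₂ H₂ B E₃ H₃ C : Type*}
  [NormedAddCommGroup E₀] [NormedSpace ℂ E₀] [TopologicalSpace H₀] [TopologicalSpace Y]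
  [ChartedSpace H₀ Y]
  [NormedAddCommGroup E₁] [NormedSpace ℂ E₁] [TopologicalSpace H₁] [TopologicalSpace A]
  [ChartedSpace H₁ A]
  [NormedAddCommGroup E₂] [NormedSpace ℂ E₂] [TopologicalSpace H₂] [TopologicalSpace B]
  [ChartedSpace H₂ B]
  [NormedAddCommGroup E₃] [NormedSpace ℂ E₃] [TopologicalSpace H₃] [TopologicalSpace C]
  [ChartedSpace H₃ C]
  (I₀ : ModelWithCorners ℂ E₀ H₀) (I₁ : ModelWithCorners ℂ E₁ H₁)
  (I₂ : ModelWithCorners ℂ E₂ H₂) (I₃ : ModelWithCorners ℂ E₃ H₃)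

/-- The field of tangent vectors `v` along the map `g` is holomorphic at a point. -/
def IsHolFieldAt [IsManifold I₁ 1 A] (g : Y → A) (v : Y → E₁) (y : Y) : Prop :=
  ContMDiffAt I₀ I₁.tangent ω (fun y => (⟨g y, v y⟩ : TangentBundle I₁ A)) y

variable {I₀ I₁ I₂ I₃}

theorem IsHolFieldAt.contMDiffAt [IsManifold I₁ 1 A] {g : Y → A} {v : Y → E₁} {y : Y}
    (h : IsHolFieldAt I₀ I₁ g v y) : ContMDiffAt I₀ I₁ ω g y :=
  (Bundle.contMDiffAt_totalSpace.1 h).1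

theorem IsHolFieldAt.congr [IsManifold I₁ 1 A] {g g' : Y → A} {v v' : Y → E₁} {y : Y}
    (h : IsHolFieldAt I₀ I₁ g v y) (hg : ∀ᶠ z in 𝓝 y, g' z = g z)
    (hv : ∀ᶠ z in 𝓝 y, v' z = v z) : IsHolFieldAt I₀ I₁ g' v' y := by
  refine ContMDiffAt.congr_of_eventuallyEq h ?_
  filter_upwards [hg, hv] with z h1 h2
  rw [h1, h2]

theorem IsHolFieldAt.comp [IsManifold I₁ 1 A] {g : Y → A} {v : Y → E₁} {s : B → Y} {b : B}
    (h : IsHolFieldAt I₀ I₁ g v (s b)) (hs : ContMDiffAt I₂ I₀ ω s b) :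
    IsHolFieldAt I₂ I₁ (fun x => g (s x)) (fun x => v (s x)) b :=
  ContMDiffAt.comp b h hs

/-- The trivialisation of the tangent bundle centred at `a` is the identity on the fibre at `a`.
This is the passage between fields translated to the identity of a group and functions with values
in the Lie algebra. -/
theorem isHolFieldAt_const_iff [IsManifold I₁ 1 A] {a : A} {v : Y → E₁} {y : Y} :
    IsHolFieldAt I₀ I₁ (fun _ => a) v y ↔ ContMDiffAt I₀ 𝓘(ℂ, E₁) ω v y := by
  have key : (fun z => ((trivializationAt E₁ (TangentSpace I₁) a)
      (⟨a, v z⟩ : TangentBundle I₁ A)).2) = v := by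
    funext z
    exact (tangentBundleCore I₁ A).coordChange_self (achart H₁ a) a (mem_chart_source H₁ a) (v z)
  unfold IsHolFieldAt
  rw [Bundle.contMDiffAt_totalSpace]
  constructor
  · intro h
    have h2 := h.2
    change ContMDiffAt I₀ 𝓘(ℂ, E₁) ω (fun z => ((trivializationAt E₁ (TangentSpace I₁) a)
      (⟨a, v z⟩ : TangentBundle I₁ A)).2) y at h2
    rwa [key] at h2
  · intro h
    refine ⟨contMDiffAt_const, ?_⟩
    change ContMDiffAt I₀ 𝓘(ℂ, E₁) ω (fun z => ((trivializationAt E₁ (TangentSpace I₁) a)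
      (⟨a, v z⟩ : TangentBundle I₁ A)).2) y
    rwa [key]

theorem ContMDiffAt.isHolFieldAt_zero [IsManifold I₁ 1 A] {g : Y → A} {y : Y}
    (hg : ContMDiffAt I₀ I₁ ω g y) : IsHolFieldAt I₀ I₁ g (fun _ => 0) y :=
  ContMDiffAt.comp y (Bundle.contMDiff_zeroSection ℂ (TangentSpace I₁)).contMDiffAt hg

theorem IsHolFieldAt.prodMk [IsManifold I₁ 1 A] [IsManifold I₂ 1 B] {g : Y → A} {v : Y → E₁}
    {g' : Y → B} {v' : Y → E₂} {y : Y}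
    (h : IsHolFieldAt I₀ I₁ g v y) (h' : IsHolFieldAt I₀ I₂ g' v' y) :
    IsHolFieldAt I₀ (I₁.prod I₂) (fun z => (g z, g' z)) (fun z => (v z, v' z)) y :=
  ContMDiffAt.comp y (contMDiff_equivTangentBundleProd_symm (I := I₁) (M := A) (I' := I₂) (M' := B)
    (n := ω)).contMDiffAt (ContMDiffAt.prodMk h h')

/-- As `f` is holomorphic only near `g y`, its tangent map is taken within an open neighbourhood
`W`, where it agrees with the full tangent map. -/
theorem IsHolFieldAt.map [IsManifold I₁ ω A] [IsManifold I₂ ω B] {g : Y → A} {v : Y → E₁}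
    {f : A → B} {y : Y} (h : IsHolFieldAt I₀ I₁ g v y) (hf : ContMDiffAt I₁ I₂ ω f (g y)) :
    IsHolFieldAt I₀ I₂ (fun z => f (g z)) (fun z => tderiv I₁ I₂ f (g z) (v z)) y := by
  obtain ⟨u, hu, hfu⟩ := (contMDiffAt_iff_contMDiffOn_nhds (by simp)).1 hf
  obtain ⟨W, hW, hWo, hgW⟩ := mem_nhds_iff.1 hu
  have hfW := hfu.mono hW
  have h1 := hfW.contMDiffOn_tangentMapWithin (m := ω) (by simp) hWo.uniqueMDiffOn
  have ho : IsOpen (Bundle.TotalSpace.proj ⁻¹' W : Set (TangentBundle I₁ A)) :=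
    hWo.preimage (FiberBundle.continuous_proj E₁ (TangentSpace I₁))
  have h2 : ContMDiffAt I₁.tangent I₂.tangent ω (tangentMapWithin I₁ I₂ f W) ⟨g y, v y⟩ :=
    h1.contMDiffAt (ho.mem_nhds hgW)
  refine (ContMDiffAt.comp y h2 h).congr_of_eventuallyEq ?_
  filter_upwards [h.contMDiffAt.continuousAt.eventually (hWo.mem_nhds hgW)] with z hz
  exact (tangentMapWithin_eq_tangentMap (p := ⟨g z, v z⟩) (hWo.uniqueMDiffOn _ hz)
    ((hfW.contMDiffAt (hWo.mem_nhds hz)).mdifferentiableAt (by simp))).symm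

/-- Pushing forward a holomorphic field by maps depending holomorphically on a parameter. -/
theorem IsHolFieldAt.map_param [IsManifold I₁ ω A] [IsManifold I₂ ω B] [IsManifold I₃ ω C]
    {Ψ : A × B → C} (hΨ : ContMDiff (I₁.prod I₂) I₃ ω Ψ) {k : Y → A} {g : Y → B} {v : Y → E₂}
    {y : Y} (hk : ContMDiffAt I₀ I₁ ω k y) (h : IsHolFieldAt I₀ I₂ g v y) :
    IsHolFieldAt I₀ I₃ (fun z => Ψ (k z, g z))
      (fun z => tderiv I₂ I₃ (fun x => Ψ (k z, x)) (g z) (v z)) y := by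
  -- The partial differential of `Ψ` in the second variable is its total differential on `(0, v)`,
  -- so the parameter carries the zero field.
  refine (((hk.isHolFieldAt_zero).prodMk h).map hΨ.contMDiffAt).congr
    (Eventually.of_forall fun z => rfl) (Eventually.of_forall fun z => ?_)
  have := (hΨ (k z, g z)).tderiv_prod (0, v z)
  rw [this]
  simp

end HolomorphicFields

/-! ### Holomorphic maps into finite-dimensional spaces, tested on functionals. -/

section FiniteDimensionalValues

variable {E₀ H₀ Y V : Type*} [NormedAddCommGroup E₀] [NormedSpace ℂ E₀] [TopologicalSpace H₀]
  [TopologicalSpace Y] [ChartedSpace H₀ Y] {I₀ : ModelWithCorners ℂ E₀ H₀}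

theorem contMDiffAt_clm_apply {E F : Type*} [NormedAddCommGroup E] [NormedSpace ℂ E]
    [NormedAddCommGroup F] [NormedSpace ℂ F] (L : E →L[ℂ] F) {f : Y → E} {y : Y}
    (h : ContMDiffAt I₀ 𝓘(ℂ, E) ω f y) : ContMDiffAt I₀ 𝓘(ℂ, F) ω (fun x => L (f x)) y :=
  ContMDiffAt.comp y L.contDiff.contMDiff.contMDiffAt h

/-- A map into a finite-dimensional space composed with linear maps into normed spaces is
holomorphic if its compositions with linear functionals are. -/
theorem contMDiffAt_linearMap_of_forall_dual [AddCommGroup V] [Module ℂ V] [FiniteDimensional ℂ V]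
    {F : Type*} [NormedAddCommGroup F] [NormedSpace ℂ F] {f : Y → V} {y : Y} (L : V →ₗ[ℂ] F)
    (h : ∀ ℓ : Module.Dual ℂ V, ContMDiffAt I₀ 𝓘(ℂ) ω (fun x => ℓ (f x)) y) :
    ContMDiffAt I₀ 𝓘(ℂ, F) ω (fun x => L (f x)) y := by
  let b := Module.finBasis ℂ V
  have e : (fun x => L (f x)) = fun x => ∑ i, b.coord i (f x) • L (b i) := by
    funext x
    conv_lhs => rw [← b.sum_repr (f x), map_sum]
    simp only [map_smul]
    rfl
  rw [e]
  refine ContMDiffAt.sum fun i _ => ?_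
  exact (h (b.coord i)).smul contMDiffAt_const

end FiniteDimensionalValues

/-! ### Representations with holomorphic matrix coefficients. -/

section HolomorphicRepresentations

variable {EK K : Type*} [NormedAddCommGroup EK] [NormedSpace ℂ EK] [TopologicalSpace K]
  [ChartedSpace EK K] [Group K]
  {V W : Type*} [AddCommGroup V] [Module ℂ V] [AddCommGroup W] [Module ℂ W]

variable (EK) in
/-- A representation of a complex Lie group with holomorphic matrix coefficients. -/
def Representation.IsHol (ρ : Representation ℂ K V) : Prop :=
  ∀ (v : V) (ℓ : Module.Dual ℂ V), ContMDiff 𝓘(ℂ, EK) 𝓘(ℂ) ω fun k => ℓ (ρ k v)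

namespace Representation.IsHol

theorem comp {EL L : Type*} [NormedAddCommGroup EL] [NormedSpace ℂ EL] [TopologicalSpace L]
    [ChartedSpace EL L] [Group L] {ρ : Representation ℂ K V} (hρ : ρ.IsHol EK) {φ : L →* K}
    (hφ : ContMDiff 𝓘(ℂ, EL) 𝓘(ℂ, EK) ω φ) : Representation.IsHol EL (ρ.comp φ) :=
  fun v ℓ => (hρ v ℓ).comp hφ

theorem quotient {ρ : Representation ℂ K V} (hρ : ρ.IsHol EK) (N : Submodule ℂ V)
    (hN : ∀ k, N ≤ N.comap (ρ k)) : (ρ.quotient N hN).IsHol EK := by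
  intro v ℓ
  obtain ⟨v, rfl⟩ := N.mkQ_surjective v
  exact hρ v (ℓ ∘ₗ N.mkQ)

theorem prod {ρ : Representation ℂ K V} {ρ' : Representation ℂ K W} (hρ : ρ.IsHol EK)
    (hρ' : ρ'.IsHol EK) : (ρ.prod ρ').IsHol EK := by
  intro v ℓ
  have h := (hρ v.1 (ℓ ∘ₗ LinearMap.inl ℂ V W)).add (hρ' v.2 (ℓ ∘ₗ LinearMap.inr ℂ V W))
  refine h.congr fun k => ?_
  change ℓ (ρ k v.1, ρ' k v.2) = ℓ (ρ k v.1, 0) + ℓ (0, ρ' k v.2)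
  rw [← map_add]
  simp

/-- Expanding `w` in a basis writes the function as a finite sum of coordinates of `w` times matrix
coefficients along `k`. -/
theorem contMDiffAt [FiniteDimensional ℂ V] {ρ : Representation ℂ K V} (hρ : ρ.IsHol EK)
    {E₀ H₀ Y : Type*} [NormedAddCommGroup E₀] [NormedSpace ℂ E₀] [TopologicalSpace H₀]
    [TopologicalSpace Y] [ChartedSpace H₀ Y] {I₀ : ModelWithCorners ℂ E₀ H₀}
    {k : Y → K} {w : Y → V} {y : Y} (hk : ContMDiffAt I₀ 𝓘(ℂ, EK) ω k y)
    (hw : ∀ ℓ : Module.Dual ℂ V, ContMDiffAt I₀ 𝓘(ℂ) ω (fun x => ℓ (w x)) y)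
    (ℓ : Module.Dual ℂ V) : ContMDiffAt I₀ 𝓘(ℂ) ω (fun x => ℓ (ρ (k x) (w x))) y := by
  let b := Module.finBasis ℂ V
  have e : (fun x => ℓ (ρ (k x) (w x))) = fun x => ∑ i, b.coord i (w x) • ℓ (ρ (k x) (b i)) := by
    funext x
    conv_lhs => rw [← b.sum_repr (w x), map_sum, map_sum]
    simp only [map_smul]
    rfl
  rw [e]
  refine ContMDiffAt.sum fun i _ => ?_
  exact (hw (b.coord i)).smul
    (ContMDiffAt.comp y (g := fun k => ℓ (ρ k (b i))) (hρ (b i) ℓ).contMDiffAt hk)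

end Representation.IsHol

/-- Every conjugation fixes the identity, so pushing `ξ` forward by all of them is a holomorphic
field over a constant point, hence a holomorphic vector-valued function. -/
theorem contMDiff_tderiv_conj [LieGroup 𝓘(ℂ, EK) ω K] (ξ : EK) :
    ContMDiff 𝓘(ℂ, EK) 𝓘(ℂ, EK) ω
      fun k : K => tderiv 𝓘(ℂ, EK) 𝓘(ℂ, EK) (fun x => k * x * k⁻¹) 1 ξ := by
  intro k
  have hΨ : ContMDiff (𝓘(ℂ, EK).prod 𝓘(ℂ, EK)) 𝓘(ℂ, EK) ω
      (fun p : K × K => p.1 * p.2 * p.1⁻¹) :=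
    (contMDiff_fst.mul contMDiff_snd).mul (contMDiff_fst.inv)
  have h1 : IsHolFieldAt 𝓘(ℂ, EK) 𝓘(ℂ, EK) (fun _ : K => (1 : K)) (fun _ => ξ) k :=
    isHolFieldAt_const_iff.2 contMDiffAt_const
  have h2 := IsHolFieldAt.map_param hΨ (k := fun k => k) contMDiffAt_id h1
  refine (isHolFieldAt_const_iff (a := (1 : K))).1 (h2.congr ?_ ?_)
  · exact Filter.Eventually.of_forall fun z => by simp
  · exact Filter.Eventually.of_forall fun z => rfl

theorem adRep_isHol [FiniteDimensional ℂ EK] [LieGroup 𝓘(ℂ, EK) ω K] :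
    (adRep EK K).IsHol EK := by
  intro ξ ℓ k
  exact contMDiffAt_clm_apply (LinearMap.toContinuousLinearMap (E := EK) (F' := ℂ) ℓ)
    (contMDiff_tderiv_conj (EK := EK) ξ k)

end HolomorphicRepresentations

/-! ### Sections as equivariant functions and invariant fields on the total space. -/

section Sections

open scoped Topology

variable {EP P EX X K : Type*} {π : P → X} {act : P → K → P}

/-- The equivariant function of a section of an associated bundle. -/
def assocFun {V : Type*} [AddCommGroup V] [Module ℂ V] [Group K]
    {ρ : Representation ℂ K V} (σ : ∀ x, assocFiber π act ρ x) (p : P) : V :=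
  (σ (π p)).1 ⟨p, rfl⟩

/-- Changes the name of the base point without transport between fibres. -/
theorem assocFun_eq {V : Type*} [AddCommGroup V] [Module ℂ V] [Group K]
    {ρ : Representation ℂ K V} (σ : ∀ x, assocFiber π act ρ x) {p : P} {x : X} (h : π p = x) :
    assocFun σ p = (σ x).1 ⟨p, h⟩ := by
  subst h
  rfl

theorem assocFun_act {V : Type*} [AddCommGroup V] [Module ℂ V] [Group K]
    {ρ : Representation ℂ K V} (σ : ∀ x, assocFiber π act ρ x) {p q : P} {k : K}
    (hq : q = act p k) (h : π q = π p) : assocFun σ q = ρ k⁻¹ (assocFun σ p) := by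
  rw [assocFun_eq σ h]
  exact (σ (π p)).2 ⟨p, rfl⟩ ⟨q, h⟩ k hq

variable [NormedAddCommGroup EP] [NormedSpace ℂ EP] [TopologicalSpace P] [ChartedSpace EP P]

/-- The invariant vector field of a section of the Atiyah bundle. -/
def atiyahField (σ : ∀ x, atiyahFiber EP π act x) (p : P) : EP :=
  (σ (π p)).1 ⟨p, rfl⟩

variable [TopologicalSpace X]

theorem assocBundle_isHolOn_iff {V : Type*} [AddCommGroup V] [Module ℂ V] [Group K]
    {ρ : Representation ℂ K V} (hπ : Continuous π) {U : Set X} (hU : IsOpen U)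
    (σ : ∀ x, assocFiber π act ρ x) :
    (assocBundle EP π act ρ).IsHolOn U σ ↔ ∀ p, π p ∈ U → ∀ ℓ : Module.Dual ℂ V,
      ContMDiffAt 𝓘(ℂ, EP) 𝓘(ℂ) ω (fun p => ℓ (assocFun σ p)) p :=
  ⟨fun h p hp ℓ => (h ℓ).contMDiffAt ((hU.preimage hπ).mem_nhds hp),
    fun h ℓ p hp => (h p hp ℓ).contMDiffWithinAt⟩

theorem atiyahBundle_isHolOn_iff [IsManifold 𝓘(ℂ, EP) 1 P] (hπ : Continuous π) {U : Set X}
    (hU : IsOpen U) (σ : ∀ x, atiyahFiber EP π act x) :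
    (atiyahBundle (EP := EP) π act).IsHolOn U σ ↔
      ∀ p, π p ∈ U → IsHolFieldAt 𝓘(ℂ, EP) 𝓘(ℂ, EP) (fun p : P => p) (atiyahField σ) p :=
  ⟨fun h _ hp => ContMDiffOn.contMDiffAt h ((hU.preimage hπ).mem_nhds hp),
    fun h _ hp => ContMDiffAt.contMDiffWithinAt (h _ hp)⟩

variable [NormedAddCommGroup EX] [NormedSpace ℂ EX] [ChartedSpace EX X]

theorem tangentFamily_isHolOn_iff [IsManifold 𝓘(ℂ, EX) 1 X] {U : Set X} (hU : IsOpen U)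
    (σ : X → EX) :
    (tangentFamily (EX := EX) (X := X)).IsHolOn U σ ↔
      ∀ x ∈ U, IsHolFieldAt 𝓘(ℂ, EX) 𝓘(ℂ, EX) (fun x : X => x) σ x :=
  ⟨fun h _ hx => ContMDiffOn.contMDiffAt h (hU.mem_nhds hx),
    fun h x hx => ContMDiffAt.contMDiffWithinAt (h x hx)⟩

end Sections

/-! ### Fibres and local frames of bundles associated to a principal bundle. -/

section PrincipalBundles

variable {EP P EX X EK K : Type*}
  [NormedAddCommGroup EP] [NormedSpace ℂ EP] [TopologicalSpace P] [ChartedSpace EP P]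
  [NormedAddCommGroup EX] [NormedSpace ℂ EX] [TopologicalSpace X] [ChartedSpace EX X]
  [NormedAddCommGroup EK] [NormedSpace ℂ EK] [TopologicalSpace K] [ChartedSpace EK K] [Group K]
  {π : P → X} {act : P → K → P}

namespace IsPrincipalBundle

/-- In a local trivialisation the action multiplies the group coordinate on the right, and
multiplication in `K` is cancellative. -/
theorem act_injective (h : IsPrincipalBundle (EP := EP) (EX := EX) (EK := EK) π act) (p : P) :
    Function.Injective (act p) := by
  intro k l hkl
  obtain ⟨U, φ, -, hx, hs, ht, -, -, hφ⟩ := h.locally_trivial (π p)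
  have hp : p ∈ φ.source := by rw [hs]; exact hx
  have h1 := (hφ p hp).2 k
  rw [hkl, (hφ p hp).2 l] at h1
  exact (mul_left_cancel h1).symm

variable {V : Type*} [AddCommGroup V] [Module ℂ V]

/-- Evaluation at a point of the fibre identifies the fibre of an associated bundle with the
representation. -/
def assocEval (h : IsPrincipalBundle (EP := EP) (EX := EX) (EK := EK) π act)
    (ρ : Representation ℂ K V) (x : X) (p : {p : P // π p = x}) :
    assocFiber π act ρ x ≃ₗ[ℂ] V :=
  LinearEquiv.ofBijective
    { toFun := fun f => f.1 p
      map_add' := fun _ _ => rfl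
      map_smul' := fun _ _ => rfl } (by
    constructor
    · intro f g hfg
      ext q
      obtain ⟨k, hk⟩ := h.exists_act_eq p.1 q.1 (p.2.trans q.2.symm)
      have hfg' : f.1 p = g.1 p := hfg
      rw [f.2 p q k hk.symm, g.2 p q k hk.symm, hfg']
    · intro v
      choose k hk using fun q : {p : P // π p = x} =>
        h.exists_act_eq p.1 q.1 (p.2.trans q.2.symm)
      refine ⟨⟨fun q => ρ (k q)⁻¹ v, ?_⟩, ?_⟩
      · intro q q' l hl
        -- The translating element is unique by freeness, and this makes the chosen family
        -- equivariant.
        have e : k q' = k q * l := by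
          apply h.act_injective p.1
          rw [hk, h.act_mul, hk, hl]
        change ρ (k q')⁻¹ v = ρ l⁻¹ (ρ (k q)⁻¹ v)
        rw [e, mul_inv_rev, map_mul]
        rfl
      · have e : k p = 1 := by
          apply h.act_injective p.1
          rw [hk, h.act_one]
        change ρ (k p)⁻¹ v = v
        rw [e]
        simp)

theorem tderiv_act_mul (h : IsPrincipalBundle (EP := EP) (EX := EX) (EK := EK) π act)
    (p : P) (k l : K) (v : EP) :
    tderiv 𝓘(ℂ, EP) 𝓘(ℂ, EP) (fun y => act y (k * l)) p v =
      tderiv 𝓘(ℂ, EP) 𝓘(ℂ, EP) (fun y => act y l) (act p k)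
        (tderiv 𝓘(ℂ, EP) 𝓘(ℂ, EP) (fun y => act y k) p v) := by
  have e : (fun y => act y (k * l)) = fun y => act (act y k) l := by
    funext y
    exact h.act_mul y k l
  rw [e]
  exact ContMDiffAt.tderiv_comp (h.contMDiff_act_right l _) (h.contMDiff_act_right k _) v

theorem tderiv_act_one (h : IsPrincipalBundle (EP := EP) (EX := EX) (EK := EK) π act)
    (p : P) (v : EP) : tderiv 𝓘(ℂ, EP) 𝓘(ℂ, EP) (fun y => act y (1 : K)) p v = v := by
  have e : (fun y => act y (1 : K)) = fun y => y := by
    funext y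
    exact h.act_one y
  rw [e, tderiv_id]
  rfl

/-- Evaluation at a point of the fibre identifies the fibre of the Atiyah bundle with the tangent
space of the total space. -/
def atiyahEval (h : IsPrincipalBundle (EP := EP) (EX := EX) (EK := EK) π act)
    (x : X) (p : {p : P // π p = x}) : atiyahFiber EP π act x ≃ₗ[ℂ] EP :=
  LinearEquiv.ofBijective
    { toFun := fun f => (f.1 p : EP)
      map_add' := fun _ _ => rfl
      map_smul' := fun _ _ => rfl } (by
    constructor
    · intro f g hfg
      refine Subtype.ext (funext fun q => ?_)
      obtain ⟨k, hk⟩ := h.exists_act_eq p.1 q.1 (p.2.trans q.2.symm)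
      have hfg' : (f.1 p : EP) = g.1 p := hfg
      exact (f.2 p q k hk.symm).trans
        ((congrArg (tderiv 𝓘(ℂ, EP) 𝓘(ℂ, EP) (fun y => act y k) p.1) hfg').trans
          (g.2 p q k hk.symm).symm)
    · intro v
      choose k hk using fun q : {p : P // π p = x} =>
        h.exists_act_eq p.1 q.1 (p.2.trans q.2.symm)
      refine ⟨⟨fun q => tderiv 𝓘(ℂ, EP) 𝓘(ℂ, EP) (fun y => act y (k q)) p.1 v, ?_⟩, ?_⟩
      · intro q q' l hl
        have e : k q' = k q * l := by
          apply h.act_injective p.1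
          rw [hk, h.act_mul, hk, hl]
        change tderiv 𝓘(ℂ, EP) 𝓘(ℂ, EP) (fun y => act y (k q')) p.1 v =
          tderiv 𝓘(ℂ, EP) 𝓘(ℂ, EP) (fun y => act y l) q.1
            (tderiv 𝓘(ℂ, EP) 𝓘(ℂ, EP) (fun y => act y (k q)) p.1 v)
        rw [e, h.tderiv_act_mul, hk]
      · have e : k p = 1 := by
          apply h.act_injective p.1
          rw [hk, h.act_one]
        change tderiv 𝓘(ℂ, EP) 𝓘(ℂ, EP) (fun y => act y (k p)) p.1 v = v
        rw [e, h.tderiv_act_one])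

end IsPrincipalBundle

namespace IsPrincipalBundle

/-- A trivialisation `φ` yields the section `x ↦ φ⁻¹(x, 1)`; the frame consists of the classes whose
values along it are a fixed basis of `V`. By equivariance its value at `p` is `ρ((φ p)₂⁻¹) b_i`,
which is holomorphic because `ρ` is. -/
theorem isVectorBundle_assocBundle {V : Type*} [AddCommGroup V] [Module ℂ V]
    [FiniteDimensional ℂ V] [LieGroup 𝓘(ℂ, EK) ω K]
    (h : IsPrincipalBundle (EP := EP) (EX := EX) (EK := EK) π act)
    {ρ : Representation ℂ K V} (hρ : ρ.IsHol EK) :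
    (assocBundle EP π act ρ).IsVectorBundle (EX := EX) := by
  classical
  intro x₀
  obtain ⟨U, φ, hU, hx, hs, ht, hφ1, hφ2, hφ⟩ := h.locally_trivial x₀
  have hmt : ∀ x ∈ U, ((x, 1) : X × K) ∈ φ.target := fun x hx => by simp [ht, hx]
  have hsec : ∀ x ∈ U, π (φ.symm (x, 1)) = x := fun x hx => by
    rw [← (hφ _ (φ.map_target (hmt x hx))).1, φ.right_inv (hmt x hx)]
  let b := Module.finBasis ℂ V
  let e : Fin (Module.finrank ℂ V) → ∀ x, assocFiber π act ρ x := fun i x =>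
    if hx : x ∈ U then (h.assocEval ρ x ⟨φ.symm (x, 1), hsec x hx⟩).symm (b i) else 0
  have he : ∀ i x (hx : x ∈ U), h.assocEval ρ x ⟨φ.symm (x, 1), hsec x hx⟩ (e i x) = b i := by
    intro i x hx
    simp only [e, dif_pos hx, LinearEquiv.apply_symm_apply]
  have he' : ∀ i p, π p ∈ U → (e i (π p)).1 ⟨p, rfl⟩ = ρ (φ p).2⁻¹ (b i) := by
    intro i p hp
    have hps : p ∈ φ.source := by rw [hs]; exact hp
    have hm := φ.map_target (hmt _ hp)
    -- Every point is the section's point in its fibre, moved by its own group coordinate.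
    have hact : act (φ.symm (π p, 1)) (φ p).2 = p := by
      apply φ.injOn _ hps
      · apply Prod.ext
        · rw [(hφ _ _).1, (hφ _ hps).1, h.proj_act, hsec _ hp]
          rw [hs, Set.mem_preimage, h.proj_act, hsec _ hp]; exact hp
        · rw [(hφ _ hm).2, φ.right_inv (hmt _ hp), one_mul]
      · rw [hs, Set.mem_preimage, h.proj_act, hsec _ hp]; exact hp
    have := (e i (π p)).2 ⟨φ.symm (π p, 1), hsec _ hp⟩ ⟨p, rfl⟩ (φ p).2 hact.symm
    rw [this, ← he i (π p) hp]
    rfl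
  refine ⟨U, hU, hx, _, e, ?_, ?_⟩
  · intro x hx
    let T := h.assocEval ρ x ⟨φ.symm (x, 1), hsec x hx⟩
    have hT : (fun i => e i x) = fun i => T.symm (b i) := by
      funext i
      exact (LinearEquiv.eq_symm_apply T).2 (he i x hx)
    have hT' : (fun i => e i x) = b.map T.symm := by
      rw [hT]; funext i; simp
    change LinearIndependent ℂ (fun i => e i x) ∧ Submodule.span ℂ (Set.range fun i => e i x) = ⊤
    rw [hT']
    exact ⟨(b.map T.symm).linearIndependent, (b.map T.symm).span_eq⟩
  · intro W hW hWU σ c hc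
    have hσ : ∀ p, π p ∈ W →
        (σ (π p)).1 ⟨p, rfl⟩ = ∑ i, c i (π p) • ρ (φ p).2⁻¹ (b i) := by
      intro p hp
      let T := h.assocEval ρ (π p) ⟨p, rfl⟩
      refine (congrArg T (hc _ hp)).trans
        ((map_sum T (fun i => c i (π p) • e i (π p)) Finset.univ).trans
          (Finset.sum_congr rfl fun i _ => ?_))
      rw [← he' i p (hWU hp)]
      exact map_smul T (c i (π p)) (e i (π p))
    constructor
    · intro hhol i
      -- Along the section the group coordinate is 1, so the coordinates of the equivariant function
      -- are the coefficients themselves.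
      have hsm : ContMDiffOn 𝓘(ℂ, EX) 𝓘(ℂ, EP) ω (fun x => φ.symm (x, 1)) W :=
        hφ2.comp (contMDiff_id.prodMk contMDiff_const).contMDiffOn fun x hx => hmt x (hWU hx)
      have h1 := (hhol (b.coord i)).comp hsm
        (fun x hx => by rw [Set.mem_preimage, Set.mem_preimage, hsec x (hWU hx)]; exact hx)
      refine h1.congr fun x hx => ?_
      have hxU := hWU hx
      rw [Function.comp_apply, hσ _ (by rw [hsec x hxU]; exact hx), hsec x hxU,
        φ.right_inv (hmt x hxU)]
      simp [Finsupp.single_apply]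
    · intro hcc ℓ p hp
      have hps : p ∈ φ.source := by rw [hs]; exact hWU hp
      have hWo : IsOpen (π ⁻¹' W) := hW.preimage h.contMDiff_proj.continuous
      refine ContMDiffAt.contMDiffWithinAt ?_
      have h1 : ContMDiffAt 𝓘(ℂ, EP) 𝓘(ℂ) ω
          (fun p => ∑ i, c i (π p) • ℓ (ρ (φ p).2⁻¹ (b i))) p := by
        refine ContMDiffAt.sum fun i _ => ?_
        have h2 : ContMDiffAt 𝓘(ℂ, EP) 𝓘(ℂ) ω (fun p => c i (π p)) p :=
          ContMDiffAt.comp p ((hcc i).contMDiffAt (hW.mem_nhds hp)) h.contMDiff_proj.contMDiffAt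
        have h3 : ContMDiffAt 𝓘(ℂ, EP) 𝓘(ℂ, EK) ω (fun p => (φ p).2⁻¹) p :=
          ((contMDiffAt_snd.comp p (hφ1.contMDiffAt (φ.open_source.mem_nhds hps)))).inv
        exact h2.smul
          (ContMDiffAt.comp p (g := fun k => ℓ (ρ k (b i))) (hρ (b i) ℓ).contMDiffAt h3)
      refine h1.congr_of_eventuallyEq ?_
      filter_upwards [hWo.mem_nhds hp] with q hq
      rw [hσ q hq, map_sum]
      simp only [map_smul]

/-- Evaluation at one point of each fibre reduces exactness to that of the representations. The maps
are holomorphic because a functional composed with `S` or `T` is again a functional. -/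
theorem isShortExact_assocSeq {V₁ V₂ V₃ : Type*} [AddCommGroup V₁] [Module ℂ V₁]
    [AddCommGroup V₂] [Module ℂ V₂] [AddCommGroup V₃] [Module ℂ V₃]
    [FiniteDimensional ℂ V₁] [FiniteDimensional ℂ V₂] [FiniteDimensional ℂ V₃]
    [LieGroup 𝓘(ℂ, EK) ω K]
    (h : IsPrincipalBundle (EP := EP) (EX := EX) (EK := EK) π act)
    {ρ₁ : Representation ℂ K V₁} {ρ₂ : Representation ℂ K V₂} {ρ₃ : Representation ℂ K V₃}
    (h₁ : ρ₁.IsHol EK) (h₂ : ρ₂.IsHol EK) (h₃ : ρ₃.IsHol EK)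
    (S : ρ₁.IntertwiningMap ρ₂) (T : ρ₂.IntertwiningMap ρ₃)
    (hS : Function.Injective S) (hST : Function.Exact S T) (hT : Function.Surjective T) :
    (assocSeq EP π act S T).IsShortExact (EX := EX) where
  left_bundle := h.isVectorBundle_assocBundle h₁
  mid_bundle := h.isVectorBundle_assocBundle h₂
  right_bundle := h.isVectorBundle_assocBundle h₃
  inc_hol := fun U _ σ hσ ℓ => hσ (ℓ ∘ₗ S.toLinearMap)
  proj_hol := fun U _ σ hσ ℓ => hσ (ℓ ∘ₗ T.toLinearMap)
  injective := fun x f g hfg => by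
    refine Subtype.ext (funext fun p => hS ?_)
    exact congrFun (congrArg Subtype.val hfg) p
  exact := fun x f => by
    obtain ⟨p, hp⟩ := h.exists_proj_eq x
    constructor
    · intro hf
      have h0 : T (h.assocEval ρ₂ x ⟨p, hp⟩ f) = 0 := congrFun (congrArg Subtype.val hf) ⟨p, hp⟩
      obtain ⟨v, hv⟩ := (hST _).1 h0
      refine ⟨(h.assocEval ρ₁ x ⟨p, hp⟩).symm v, (h.assocEval ρ₂ x ⟨p, hp⟩).injective ?_⟩
      rw [← hv]
      exact congrArg S ((h.assocEval ρ₁ x ⟨p, hp⟩).apply_symm_apply v)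
    · rintro ⟨g, rfl⟩
      refine Subtype.ext (funext fun q => (hST _).2 ⟨g.1 q, rfl⟩)
  surjective := fun x f => by
    obtain ⟨p, hp⟩ := h.exists_proj_eq x
    obtain ⟨v, hv⟩ := hT (h.assocEval ρ₃ x ⟨p, hp⟩ f)
    refine ⟨(h.assocEval ρ₂ x ⟨p, hp⟩).symm v, (h.assocEval ρ₃ x ⟨p, hp⟩).injective ?_⟩
    rw [← hv]
    exact congrArg T ((h.assocEval ρ₂ x ⟨p, hp⟩).apply_symm_apply v)

end IsPrincipalBundle

end PrincipalBundles

/-! ### Transport of bundles and exactness along isomorphisms. -/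

section Transport

variable {EX X : Type*} [NormedAddCommGroup EX] [NormedSpace ℂ EX] [TopologicalSpace X]
  [ChartedSpace EX X]

theorem HolFamily.IsVectorBundle.of_isIso {F F' : HolFamily X}
    (hF : F.IsVectorBundle (EX := EX)) {f : ∀ x, F.fiber x ≃ₗ[ℂ] F'.fiber x}
    (hf : HolFamily.IsIso F F' f) : F'.IsVectorBundle (EX := EX) := by
  intro x₀
  obtain ⟨U, hU, hx, r, e, he, hc⟩ := hF x₀
  refine ⟨U, hU, hx, r, fun i x => f x (e i x), ?_, ?_⟩
  · intro x hx
    refine ⟨(he x hx).1.map' (f x).toLinearMap (LinearEquiv.ker _), ?_⟩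
    have : (Set.range fun i => f x (e i x)) = (f x).toLinearMap '' Set.range fun i => e i x := by
      rw [← Set.range_comp]
      rfl
    rw [this, Submodule.span_image, (he x hx).2, Submodule.map_top]
    exact LinearEquiv.range _
  · intro V hV hVU σ c hσ
    have h1 : ∀ x ∈ V, (f x).symm (σ x) = ∑ i, c i x • e i x := by
      intro x hx
      rw [hσ x hx, map_sum]
      simp
    rw [← hc V hV hVU (fun x => (f x).symm (σ x)) c h1]
    constructor
    · exact fun h => hf.2 V hV σ h
    · intro h
      have := hf.1 V hV _ h
      simpa using this

/-- This spares the construction of local frames and a direct proof of exactness for the Atiyah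
sequences. -/
theorem HolSeq.IsShortExact.of_iso {S T : HolSeq X} (hS : S.IsShortExact (EX := EX))
    (Φ : HolSeq.Iso S T) : T.IsShortExact (EX := EX) where
  left_bundle := hS.left_bundle.of_isIso Φ.left_iso
  mid_bundle := hS.mid_bundle.of_isIso Φ.mid_iso
  right_bundle := hS.right_bundle.of_isIso Φ.right_iso
  inc_hol := fun U hU σ hσ => by
    have h := Φ.mid_iso.1 U hU _ (hS.inc_hol U hU _ (Φ.left_iso.2 U hU σ hσ))
    have e : (fun x => T.inc x (σ x)) = fun x => Φ.mid x (S.inc x ((Φ.left x).symm (σ x))) := by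
      funext x
      rw [Φ.comm_inc, LinearEquiv.apply_symm_apply]
    rw [e]
    exact h
  proj_hol := fun U hU σ hσ => by
    have h := Φ.right_iso.1 U hU _ (hS.proj_hol U hU _ (Φ.mid_iso.2 U hU σ hσ))
    have e : (fun x => T.proj x (σ x)) = fun x => Φ.right x (S.proj x ((Φ.mid x).symm (σ x))) := by
      funext x
      rw [Φ.comm_proj, LinearEquiv.apply_symm_apply]
    rw [e]
    exact h
  injective := fun x v w hvw => by
    apply (Φ.left x).symm.injective
    apply hS.injective x
    apply (Φ.mid x).injective
    rw [Φ.comm_inc, Φ.comm_inc]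
    simpa using hvw
  exact := fun x v => by
    have h := hS.exact x ((Φ.mid x).symm v)
    have h1 : T.proj x v = Φ.right x (S.proj x ((Φ.mid x).symm v)) := by
      rw [Φ.comm_proj, LinearEquiv.apply_symm_apply]
    rw [h1, LinearEquiv.map_eq_zero_iff, h]
    constructor
    · rintro ⟨w, hw⟩
      exact ⟨Φ.left x w, by rw [← Φ.comm_inc, hw, LinearEquiv.apply_symm_apply]⟩
    · rintro ⟨w, hw⟩
      refine ⟨(Φ.left x).symm w, (Φ.mid x).injective ?_⟩
      rw [Φ.comm_inc, LinearEquiv.apply_symm_apply, LinearEquiv.apply_symm_apply, hw]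
  surjective := fun x v => by
    obtain ⟨w, hw⟩ := hS.surjective x ((Φ.right x).symm v)
    exact ⟨Φ.mid x w, by rw [← Φ.comm_proj, hw, LinearEquiv.apply_symm_apply]⟩

end Transport

/-! ### Left translations and cosets. -/

section Translations

variable {EG G : Type*} [NormedAddCommGroup EG] [NormedSpace ℂ EG] [TopologicalSpace G]
  [ChartedSpace EG G] [Group G] [LieGroup 𝓘(ℂ, EG) ω G]

theorem tderiv_inv_mul_mul (a x : G) (v : EG) :
    tderiv 𝓘(ℂ, EG) 𝓘(ℂ, EG) (fun y => a⁻¹ * y) (a * x)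
      (tderiv 𝓘(ℂ, EG) 𝓘(ℂ, EG) (fun y => a * y) x v) = v := by
  rw [← ContMDiffAt.tderiv_comp (contMDiff_mul_left (I := 𝓘(ℂ, EG)) (n := ω) _)
    (contMDiff_mul_left (I := 𝓘(ℂ, EG)) (n := ω) _)]
  simp only [inv_mul_cancel_left, tderiv_id]
  rfl

theorem tderiv_mul_inv_mul (a x : G) (v : EG) :
    tderiv 𝓘(ℂ, EG) 𝓘(ℂ, EG) (fun y => a * y) (a⁻¹ * x)
      (tderiv 𝓘(ℂ, EG) 𝓘(ℂ, EG) (fun y => a⁻¹ * y) x v) = v := by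
  simpa using tderiv_inv_mul_mul a⁻¹ x v

variable (EG) in
/-- Left translation identifies the Lie algebra with the tangent space at any point. -/
def leftTranslate (a : G) : GroupLieAlgebra 𝓘(ℂ, EG) G ≃ₗ[ℂ] EG where
  toFun := tderiv 𝓘(ℂ, EG) 𝓘(ℂ, EG) (fun y => a * y) 1
  map_add' := map_add (tderiv 𝓘(ℂ, EG) 𝓘(ℂ, EG) (fun y => a * y) 1)
  map_smul' := map_smul (tderiv 𝓘(ℂ, EG) 𝓘(ℂ, EG) (fun y => a * y) 1)
  invFun v := (tderiv 𝓘(ℂ, EG) 𝓘(ℂ, EG) (fun y => a⁻¹ * y) a v : EG)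
  left_inv v := by
    have := tderiv_inv_mul_mul (EG := EG) a 1 v
    rwa [mul_one] at this
  right_inv v := by
    have := tderiv_mul_inv_mul a a v
    rwa [inv_mul_cancel] at this

variable (EG G) in
/-- The Lie algebra, as a vector space, is the model space. -/
def lieAlgebraModel : GroupLieAlgebra 𝓘(ℂ, EG) G ≃ₗ[ℂ] EG where
  toFun ξ := ξ
  map_add' _ _ := rfl
  map_smul' _ _ := rfl
  invFun v := v
  left_inv _ := rfl
  right_inv _ := rfl

end Translations

section Cosets

variable {G : Type*} [Group G] {H : Subgroup G}

theorem inv_mul_mem_of_cosetProj_eq {a b : G} (h : cosetProj H a = cosetProj H b) :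
    a⁻¹ * b ∈ H :=
  QuotientGroup.eq.1 h

theorem cosetProj_mul (a : G) (h : H) : cosetProj H (a * h) = cosetProj H a :=
  QuotientGroup.mk_mul_of_mem a h.2

theorem cosetProj_out (x : G ⧸ H) : cosetProj H x.out = x := QuotientGroup.out_eq' x

end Cosets

/-! ### The principal bundle `G → G/H` and the kernel of its differential. -/

section Homogeneous

open scoped Topology
open Filter

variable {EG G EH EX : Type*}
  [NormedAddCommGroup EG] [NormedSpace ℂ EG] [TopologicalSpace G] [ChartedSpace EG G] [Group G]
  [LieGroup 𝓘(ℂ, EG) ω G]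
  {H : Subgroup G} [NormedAddCommGroup EH] [NormedSpace ℂ EH] [ChartedSpace EH H]
  [LieGroup 𝓘(ℂ, EH) ω H]

/-- The topology of `H` is induced from `G`, so continuity into `H` is automatic, and the inclusion
is an immersion. -/
theorem IsHolSubgroup.contMDiffAt_of_coe [FiniteDimensional ℂ EG] [FiniteDimensional ℂ EH]
    (hH : IsHolSubgroup EG EH H) {E₀ H₀ Y : Type*} [NormedAddCommGroup E₀] [NormedSpace ℂ E₀]
    [TopologicalSpace H₀] [TopologicalSpace Y] [ChartedSpace H₀ Y] {I₀ : ModelWithCorners ℂ E₀ H₀}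
    {k : Y → H} {y : Y} (hk : ContMDiffAt I₀ 𝓘(ℂ, EG) ω (fun z => (k z : G)) y) :
    ContMDiffAt I₀ 𝓘(ℂ, EH) ω k y :=
  ContMDiffAt.of_comp_immersion (f := (H.subtype : H → G)) hH.contMDiff.contMDiffAt
    (hH.injective (k y)) (Topology.IsInducing.subtypeVal.continuousAt_iff.2 hk.continuousAt) hk

/-- The lift takes the value 1 wherever `u` leaves `H`; being defined everywhere, it can be used in
charts without restricting domains. -/
theorem IsHolSubgroup.exists_lift [FiniteDimensional ℂ EG] [FiniteDimensional ℂ EH]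
    (hH : IsHolSubgroup EG EH H) {E₀ H₀ Y : Type*} [NormedAddCommGroup E₀] [NormedSpace ℂ E₀]
    [TopologicalSpace H₀] [TopologicalSpace Y] [ChartedSpace H₀ Y] {I₀ : ModelWithCorners ℂ E₀ H₀}
    (u : Y → G) : ∃ k : Y → H, (∀ y, u y ∈ H → (k y : G) = u y) ∧
      ∀ y, ContMDiffAt I₀ 𝓘(ℂ, EG) ω u y → (∀ᶠ z in 𝓝 y, u z ∈ H) →
        ContMDiffAt I₀ 𝓘(ℂ, EH) ω k y := by
  classical
  have hk : ∀ y (h : u y ∈ H), ((if h : u y ∈ H then ⟨u y, h⟩ else 1 : H) : G) = u y := by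
    intro y h
    rw [dif_pos h]
  refine ⟨fun y => if h : u y ∈ H then ⟨u y, h⟩ else 1, hk, fun y hu hy => ?_⟩
  refine hH.contMDiffAt_of_coe (hu.congr_of_eventuallyEq ?_)
  filter_upwards [hy] with z hz
  exact hk z hz

variable [NormedAddCommGroup EX] [NormedSpace ℂ EX] [ChartedSpace EX (G ⧸ H)]

theorem tderiv_coset_comp (hX : IsHolSubmersion (EB := EX) 𝓘(ℂ, EG) (cosetProj H)) (a : G)
    (v : EG) : tderiv 𝓘(ℂ, EG) 𝓘(ℂ, EX) (fun x => cosetProj H (a * x)) 1 v =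
      tderiv 𝓘(ℂ, EG) 𝓘(ℂ, EX) (cosetProj H) a (leftTranslate EG a v) := by
  have := ContMDiffAt.tderiv_comp (f := fun x => a * x) (a := (1 : G))
    (hX.contMDiff.contMDiffAt) (contMDiff_mul_left (I := 𝓘(ℂ, EG)) (n := ω) _) v
  rw [mul_one] at this
  exact this

variable [IsManifold 𝓘(ℂ, EX) ω (G ⧸ H)] [FiniteDimensional ℂ EX]

theorem exists_coset_section (hX : IsHolSubmersion (EB := EX) 𝓘(ℂ, EG) (cosetProj H)) (a : G) :
    ∃ (s : G ⧸ H → G) (W : Set (G ⧸ H)), IsOpen W ∧ cosetProj H a ∈ W ∧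
      ContMDiffOn 𝓘(ℂ, EX) 𝓘(ℂ, EG) ω s W ∧ s (cosetProj H a) = a ∧
      ∀ x ∈ W, cosetProj H (s x) = x :=
  hX.contMDiff.contMDiffAt.exists_local_section (hX.surjective a)

variable [FiniteDimensional ℂ EG] [FiniteDimensional ℂ EH]

/-- The projection of a Lie group to a homogeneous space is a principal bundle. -/
theorem isPrincipalBundle_coset (hH : IsHolSubgroup EG EH H)
    (hX : IsHolSubmersion (EB := EX) 𝓘(ℂ, EG) (cosetProj H)) :
    IsPrincipalBundle (EP := EG) (EX := EX) (EK := EH) (cosetProj H) (cosetAct H) where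
  act_one := by simp
  act_mul := by simp [mul_assoc]
  proj_act := cosetProj_mul
  contMDiff_proj := hX.contMDiff
  contMDiff_act := contMDiff_fst.mul (hH.contMDiff.comp contMDiff_snd)
  locally_trivial := by
    intro x
    obtain ⟨a, rfl⟩ := QuotientGroup.mk_surjective x
    obtain ⟨s, W, hW, haW, hs, -, hsW⟩ := exists_coset_section hX a
    -- Here `κ` is the `H`-coordinate relative to the local section: `b = s(bH) κ(b)`. The
    -- trivialisation is `b ↦ (bH, κ b)`, with inverse `(x, h) ↦ s(x) h`.
    obtain ⟨κ, hκ, hκ'⟩ := hH.exists_lift (I₀ := 𝓘(ℂ, EG)) fun b : G => (s (cosetProj H b))⁻¹ * b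
    have hmem : ∀ b, cosetProj H b ∈ W → (s (cosetProj H b))⁻¹ * b ∈ H := fun b hb =>
      inv_mul_mem_of_cosetProj_eq (hsW _ hb)
    have hpo : IsOpen (cosetProj H ⁻¹' W) := hW.preimage hX.contMDiff.continuous
    have hκc : ContMDiffOn 𝓘(ℂ, EG) 𝓘(ℂ, EH) ω κ (cosetProj H ⁻¹' W) := by
      intro b hb
      refine (hκ' b ?_ ?_).contMDiffWithinAt
      · have h1 : ContMDiffAt 𝓘(ℂ, EG) 𝓘(ℂ, EG) ω (fun b => s (cosetProj H b)) b :=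
          ContMDiffAt.comp b (hs.contMDiffAt (hW.mem_nhds hb)) hX.contMDiff.contMDiffAt
        exact h1.inv.mul contMDiffAt_id
      · filter_upwards [hpo.mem_nhds hb] with c hc
        exact hmem c hc
    have hf : ContMDiffOn 𝓘(ℂ, EG) (𝓘(ℂ, EX).prod 𝓘(ℂ, EH)) ω
        (fun b => (cosetProj H b, κ b)) (cosetProj H ⁻¹' W) :=
      hX.contMDiff.contMDiffOn.prodMk hκc
    have hg : ContMDiffOn (𝓘(ℂ, EX).prod 𝓘(ℂ, EH)) 𝓘(ℂ, EG) ω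
        (fun q : (G ⧸ H) × H => s q.1 * (q.2 : G)) (W ×ˢ Set.univ) := by
      refine ContMDiffOn.mul ?_ ?_
      · exact hs.comp contMDiff_fst.contMDiffOn fun q hq => hq.1
      · exact (hH.contMDiff.comp contMDiff_snd).contMDiffOn
    refine ⟨W, ⟨⟨⟨fun b => (cosetProj H b, κ b), fun q => s q.1 * q.2, cosetProj H ⁻¹' W,
      W ×ˢ Set.univ, fun b hb => ⟨hb, trivial⟩, ?_, ?_, ?_⟩, hf.continuousOn, hg.continuousOn⟩,
      hpo, hW.prod isOpen_univ⟩, hW, haW, rfl, rfl, hf, hg, ?_⟩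
    · rintro ⟨x, h⟩ ⟨hx, -⟩
      change cosetProj H (s x * h) ∈ W
      rw [cosetProj_mul, hsW x hx]
      exact hx
    · intro b hb
      change s (cosetProj H b) * (κ b : G) = b
      rw [hκ b (hmem b hb), mul_inv_cancel_left]
    · rintro ⟨x, h⟩ ⟨hx, -⟩
      have e : cosetProj H (s x * h) = x := by rw [cosetProj_mul, hsW x hx]
      refine Prod.ext e (Subtype.ext ?_)
      change (κ (s x * h) : G) = h
      rw [hκ _ (hmem _ (by rw [e]; exact hx)), e, inv_mul_cancel_left]
    · intro b hb
      refine ⟨rfl, fun k => Subtype.ext ?_⟩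
      have hb' : cosetProj H b ∈ W := hb
      change (κ (b * k) : G) = (κ b : G) * k
      rw [hκ b (hmem b hb), hκ _ (hmem _ (by rw [cosetProj_mul]; exact hb)), cosetProj_mul,
        mul_assoc]

/-- Holomorphy of an equivariant function on `G` may be tested along any local map over `G/H`. -/
theorem contMDiffAt_assocFun_of_comp (hH : IsHolSubgroup EG EH H)
    {V : Type*} [AddCommGroup V] [Module ℂ V] [FiniteDimensional ℂ V] {ρ : Representation ℂ H V}
    (hρ : ρ.IsHol EH) (σ : ∀ x, assocFiber (cosetProj H) (cosetAct H) ρ x) {g : G → G} {a : G}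
    (hg : ContMDiffAt 𝓘(ℂ, EG) 𝓘(ℂ, EG) ω g a)
    (hga : ∀ᶠ b in 𝓝 a, cosetProj H (g b) = cosetProj H b)
    (h : ∀ ℓ : Module.Dual ℂ V,
      ContMDiffAt 𝓘(ℂ, EG) 𝓘(ℂ) ω (fun b => ℓ (assocFun σ (g b))) a) (ℓ : Module.Dual ℂ V) :
    ContMDiffAt 𝓘(ℂ, EG) 𝓘(ℂ) ω (fun b => ℓ (assocFun σ b)) a := by
  -- Since `b = g(b) κ(b)`, the value at `b` is `ρ(κ(b)⁻¹)` applied to the value at `g b`.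
  obtain ⟨κ, hκ, hκ'⟩ := hH.exists_lift (I₀ := 𝓘(ℂ, EG)) fun b : G => (g b)⁻¹ * b
  have hc : ContMDiffAt 𝓘(ℂ, EG) 𝓘(ℂ, EH) ω κ a := by
    refine hκ' a (hg.inv.mul contMDiffAt_id) ?_
    filter_upwards [hga] with b hb
    exact inv_mul_mem_of_cosetProj_eq hb
  refine (hρ.contMDiffAt hc.inv h ℓ).congr_of_eventuallyEq ?_
  filter_upwards [hga] with b hb
  have e : b = cosetAct H (g b) (κ b) := by
    change b = g b * (κ b : G)
    rw [hκ b (inv_mul_mem_of_cosetProj_eq hb), mul_inv_cancel_left]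
  rw [assocFun_act σ e hb.symm]

/-- Differentiate `b = s(bH) κ(b)` at `a` in the direction `w = dL_a v`, where `s(aH) = a` and `κ(a)
= 1`. The first factor contributes `ds(dπ w) = 0`, so `w = dL_a(dκ w)` with `dκ w ∈ 𝔥`, and `dL_a`
is injective. -/
theorem mem_range_lieIncl_of_tderiv_coset_eq_zero (hH : IsHolSubgroup EG EH H)
    (hX : IsHolSubmersion (EB := EX) 𝓘(ℂ, EG) (cosetProj H)) (a : G) (v : EG)
    (hv : tderiv 𝓘(ℂ, EG) 𝓘(ℂ, EX) (fun x => cosetProj H (a * x)) 1 v = 0) :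
    ∃ ξ : EH, (lieIncl EG EH H ξ : EG) = v := by
  obtain ⟨s, W, hW, haW, hs, hsa, hsW⟩ := exists_coset_section hX a
  rw [tderiv_coset_comp hX] at hv
  set w := leftTranslate EG a v with hw
  obtain ⟨κ, hκ, hκ'⟩ := hH.exists_lift (I₀ := 𝓘(ℂ, EG)) fun b : G => (s (cosetProj H b))⁻¹ * b
  have hmem : ∀ b, cosetProj H b ∈ W → (s (cosetProj H b))⁻¹ * b ∈ H := fun b hb =>
    inv_mul_mem_of_cosetProj_eq (hsW _ hb)
  have hev : ∀ᶠ b in 𝓝 a, cosetProj H b ∈ W :=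
    hX.contMDiff.continuous.continuousAt.eventually (hW.mem_nhds haW)
  have hsπ : ContMDiffAt 𝓘(ℂ, EG) 𝓘(ℂ, EG) ω (fun b => s (cosetProj H b)) a :=
    ContMDiffAt.comp a (hs.contMDiffAt (hW.mem_nhds haW)) hX.contMDiff.contMDiffAt
  have hκc : ContMDiffAt 𝓘(ℂ, EG) 𝓘(ℂ, EH) ω κ a :=
    hκ' a (hsπ.inv.mul contMDiffAt_id) (hev.mono hmem)
  have hκa : κ a = 1 := Subtype.ext (by rw [hκ a (hmem a haW), hsa]; simp)
  have hιc : ContMDiffAt 𝓘(ℂ, EG) 𝓘(ℂ, EG) ω (fun b => (κ b : G)) a :=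
    ContMDiffAt.comp a (g := (H.subtype : H → G)) hH.contMDiff.contMDiffAt hκc
  have e1 : tderiv 𝓘(ℂ, EG) 𝓘(ℂ, EG) (fun b => s (cosetProj H b) * (κ b : G)) a w = w := by
    have : (fun b => s (cosetProj H b) * (κ b : G)) =ᶠ[𝓝 a] fun b => b := by
      filter_upwards [hev] with b hb
      rw [hκ b (hmem b hb), mul_inv_cancel_left]
    rw [tderiv_congr this, tderiv_id]
    rfl
  have hm : ContMDiff (𝓘(ℂ, EG).prod 𝓘(ℂ, EG)) 𝓘(ℂ, EG) ω (fun p : G × G => p.1 * p.2) :=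
    contMDiff_mul 𝓘(ℂ, EG) ω
  have e2 := ContMDiffAt.tderiv_comp (f := fun b => (s (cosetProj H b), (κ b : G)))
    (hm (s (cosetProj H a), (κ a : G))) (hsπ.prodMk hιc) w
  have e3 : tderiv 𝓘(ℂ, EG) 𝓘(ℂ, EG) (fun b => s (cosetProj H b)) a w = 0 := by
    rw [ContMDiffAt.tderiv_comp (hs.contMDiffAt (hW.mem_nhds haW)) hX.contMDiff.contMDiffAt, hv,
      map_zero]
  have e4 : tderiv 𝓘(ℂ, EG) 𝓘(ℂ, EG) (fun b => (κ b : G)) a w =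
      lieIncl EG EH H (tderiv 𝓘(ℂ, EG) 𝓘(ℂ, EH) κ a w) := by
    have := ContMDiffAt.tderiv_comp (g := (H.subtype : H → G)) hH.contMDiff.contMDiffAt hκc w
    rw [hκa] at this
    exact this
  rw [ContMDiffAt.tderiv_prodMk hsπ hιc, ContMDiffAt.tderiv_prod (hm _), e3, map_zero, zero_add,
    e4, hκa, hsa] at e2
  refine ⟨tderiv 𝓘(ℂ, EG) 𝓘(ℂ, EH) κ a w, (leftTranslate EG a).injective ?_⟩
  exact e2.symm.trans e1

end Homogeneous

/-! ### The Atiyah sequence of `G → G/H`. -/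

section AtiyahCoset

open scoped Topology
open Filter

/-- The chain rule at the fixed point 1 of conjugation. It turns each equivariance claim about `Ad`
into an identity between maps of groups. -/
theorem tderiv_conj {EG G E₂ H₂ B : Type*} [NormedAddCommGroup EG] [NormedSpace ℂ EG]
    [TopologicalSpace G] [ChartedSpace EG G] [Group G] [LieGroup 𝓘(ℂ, EG) ω G]
    [NormedAddCommGroup E₂] [NormedSpace ℂ E₂] [TopologicalSpace H₂] [TopologicalSpace B]
    [ChartedSpace H₂ B] {I₂ : ModelWithCorners ℂ E₂ H₂} {F : G → B}
    (hF : ContMDiff 𝓘(ℂ, EG) I₂ ω F) (k : G) (ξ : GroupLieAlgebra 𝓘(ℂ, EG) G) :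
    tderiv 𝓘(ℂ, EG) I₂ F 1 (adRep EG G k ξ) =
      tderiv 𝓘(ℂ, EG) I₂ (fun x => F (k * x * k⁻¹)) 1 ξ := by
  have h1 : k * 1 * k⁻¹ = 1 := by simp
  have h := ContMDiffAt.tderiv_comp (f := fun x => k * x * k⁻¹) (a := (1 : G)) hF.contMDiffAt
    (conj_contMDiff (EG := EG) k).contMDiffAt ξ
  rw [h1] at h
  exact h.symm

variable {EG G EH EX : Type*}
  [NormedAddCommGroup EG] [NormedSpace ℂ EG] [TopologicalSpace G] [ChartedSpace EG G] [Group G]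
  [LieGroup 𝓘(ℂ, EG) ω G]
  {H : Subgroup G} [NormedAddCommGroup EH] [NormedSpace ℂ EH] [ChartedSpace EH H]

theorem leftTranslate_lieIncl (hH : IsHolSubgroup EG EH H) (a : G)
    (ξ : GroupLieAlgebra 𝓘(ℂ, EH) H) :
    leftTranslate EG a (lieIncl EG EH H ξ) =
      tderiv 𝓘(ℂ, EH) 𝓘(ℂ, EG) (fun h : H => a * (h : G)) 1 ξ :=
  (ContMDiffAt.tderiv_comp (g := fun y => a * y) (f := (H.subtype : H → G)) (a := (1 : H))
    (contMDiff_mul_left (I := 𝓘(ℂ, EG)) (n := ω) _) hH.contMDiff.contMDiffAt ξ).symm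

/-- Derivative at `x = 1` of `ah · h⁻¹xh = axh`. It makes the class of `dL_a ξ` depend only on `[a,
ξ]`. -/
theorem leftTranslate_mul_adRep (a : G) (h : G) (ξ : GroupLieAlgebra 𝓘(ℂ, EG) G) :
    leftTranslate EG (a * h) (adRep EG G h⁻¹ ξ) =
      tderiv 𝓘(ℂ, EG) 𝓘(ℂ, EG) (fun y => y * h) a (leftTranslate EG a ξ) := by
  have h1 := ContMDiffAt.tderiv_comp (g := fun y => y * h) (f := fun x => a * x) (a := (1 : G))
    (contMDiff_mul_right (I := 𝓘(ℂ, EG)) (n := ω) _)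
    (contMDiff_mul_left (I := 𝓘(ℂ, EG)) (n := ω) _) ξ
  rw [mul_one] at h1
  refine (tderiv_conj (contMDiff_mul_left (I := 𝓘(ℂ, EG)) (n := ω)) h⁻¹ ξ).trans (Eq.trans ?_ h1)
  simp only [mul_assoc, inv_inv, mul_inv_cancel_left]

variable [NormedAddCommGroup EX] [NormedSpace ℂ EX] [ChartedSpace EX (G ⧸ H)]

variable (EG EX H) in
/-- The map `ξ ↦ dπ (dL_a ξ)`. -/
def cosetDeriv (a : G) : GroupLieAlgebra 𝓘(ℂ, EG) G →ₗ[ℂ] EX where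
  toFun := tderiv 𝓘(ℂ, EG) 𝓘(ℂ, EX) (fun x => cosetProj H (a * x)) 1
  map_add' := map_add (tderiv 𝓘(ℂ, EG) 𝓘(ℂ, EX) (fun x => cosetProj H (a * x)) 1)
  map_smul' := map_smul (tderiv 𝓘(ℂ, EG) 𝓘(ℂ, EX) (fun x => cosetProj H (a * x)) 1)

theorem cosetDeriv_apply (hX : IsHolSubmersion (EB := EX) 𝓘(ℂ, EG) (cosetProj H)) (a : G)
    (v : GroupLieAlgebra 𝓘(ℂ, EG) G) : cosetDeriv EG EX H a v =
      tderiv 𝓘(ℂ, EG) 𝓘(ℂ, EX) (cosetProj H) a (leftTranslate EG a v) :=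
  tderiv_coset_comp hX a v

theorem contMDiff_cosetProj_mul (hX : IsHolSubmersion (EB := EX) 𝓘(ℂ, EG) (cosetProj H)) (a : G) :
    ContMDiff 𝓘(ℂ, EG) 𝓘(ℂ, EX) ω fun x => cosetProj H (a * x) :=
  hX.contMDiff.comp contMDiff_mul_left

/-- The maps `x ↦ ah(h⁻¹xh)H` and `x ↦ axH` coincide. -/
theorem cosetDeriv_mul_adRep (hX : IsHolSubmersion (EB := EX) 𝓘(ℂ, EG) (cosetProj H)) (a : G)
    (h : H) (ξ : GroupLieAlgebra 𝓘(ℂ, EG) G) :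
    cosetDeriv EG EX H (a * h) (adRep EG G (h : G)⁻¹ ξ) = cosetDeriv EG EX H a ξ := by
  refine (tderiv_conj (contMDiff_cosetProj_mul hX (a * h)) _ ξ).trans ?_
  have e : (fun x => cosetProj H (a * h * ((h : G)⁻¹ * x * (h : G)⁻¹⁻¹))) =
      fun x => cosetProj H (a * x) := by
    funext x
    rw [← cosetProj_mul (a * x) h]
    congr 1
    group
  rw [e]
  rfl

theorem cosetDeriv_surjective (hX : IsHolSubmersion (EB := EX) 𝓘(ℂ, EG) (cosetProj H)) (a : G) :
    Function.Surjective (cosetDeriv EG EX H a) := by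
  intro w
  obtain ⟨v, hv⟩ := hX.surjective a w
  refine ⟨(leftTranslate EG a).symm v, (cosetDeriv_apply hX a _).trans ?_⟩
  exact (congrArg (tderiv 𝓘(ℂ, EG) 𝓘(ℂ, EX) (cosetProj H) a)
    ((leftTranslate EG a).apply_symm_apply v)).trans hv

/-- The map `x ↦ axH` is constant on `H`. -/
theorem range_lieIncl_le_ker_cosetDeriv (hH : IsHolSubgroup EG EH H)
    (hX : IsHolSubmersion (EB := EX) 𝓘(ℂ, EG) (cosetProj H)) (a : G) :
    LinearMap.range (lieIncl EG EH H) ≤ LinearMap.ker (cosetDeriv EG EX H a) := by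
  rintro _ ⟨ξ, rfl⟩
  rw [LinearMap.mem_ker]
  have h := ContMDiffAt.tderiv_comp (f := (H.subtype : H → G)) (a := (1 : H))
    (contMDiff_cosetProj_mul hX a).contMDiffAt hH.contMDiff.contMDiffAt ξ
  refine h.symm.trans ?_
  have e : (fun x : H => cosetProj H (a * H.subtype x)) = fun _ => cosetProj H a := by
    funext x
    exact cosetProj_mul a x
  rw [e, tderiv_const]
  rfl

variable [LieGroup 𝓘(ℂ, EH) ω H] [IsManifold 𝓘(ℂ, EX) ω (G ⧸ H)] [FiniteDimensional ℂ EX]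
  [FiniteDimensional ℂ EG] [FiniteDimensional ℂ EH]

/-- The identification of `𝔤/𝔥` with the tangent space of `G/H` at `aH`, by `ξ ↦ dπ (dL_a ξ)`. -/
def cosetEquiv (hH : IsHolSubgroup EG EH H)
    (hX : IsHolSubmersion (EB := EX) 𝓘(ℂ, EG) (cosetProj H)) (a : G) :
    (GroupLieAlgebra 𝓘(ℂ, EG) G ⧸ LinearMap.range (lieIncl EG EH H)) ≃ₗ[ℂ] EX :=
  LinearEquiv.ofBijective
    ((LinearMap.range (lieIncl EG EH H)).liftQ (cosetDeriv EG EX H a)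
      (range_lieIncl_le_ker_cosetDeriv hH hX a)) (by
    constructor
    · rw [injective_iff_map_eq_zero]
      intro q hq
      obtain ⟨v, rfl⟩ := Submodule.mkQ_surjective _ q
      obtain ⟨ξ, hξ⟩ := mem_range_lieIncl_of_tderiv_coset_eq_zero hH hX a v hq
      exact (Submodule.Quotient.mk_eq_zero _).2 ⟨ξ, hξ⟩
    · intro w
      obtain ⟨v, hv⟩ := cosetDeriv_surjective hX a w
      exact ⟨Submodule.Quotient.mk v, hv⟩)

theorem cosetEquiv_mul (hH : IsHolSubgroup EG EH H)
    (hX : IsHolSubmersion (EB := EX) 𝓘(ℂ, EG) (cosetProj H)) (a : G) (h : H)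
    (q : GroupLieAlgebra 𝓘(ℂ, EG) G ⧸ LinearMap.range (lieIncl EG EH H)) :
    cosetEquiv hH hX (a * h) (isotropyRep hH h⁻¹ q) = cosetEquiv hH hX a q := by
  obtain ⟨v, rfl⟩ := Submodule.mkQ_surjective _ q
  exact cosetDeriv_mul_adRep hX a h v

/-- The identification of `G ×^H (𝔤/𝔥)` with the tangent bundle of `G/H` on fibres. -/
def cosetTangentEquiv (hH : IsHolSubgroup EG EH H)
    (hX : IsHolSubmersion (EB := EX) 𝓘(ℂ, EG) (cosetProj H)) (x : G ⧸ H) :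
    assocFiber (cosetProj H) (cosetAct H) (isotropyRep hH) x ≃ₗ[ℂ] EX :=
  ((isPrincipalBundle_coset hH hX).assocEval (isotropyRep hH) x ⟨x.out, cosetProj_out x⟩).trans
    (cosetEquiv hH hX x.out)

/-- The definition uses the representative `x.out`, which need not vary continuously. Holomorphy
requires the formula at every representative, in particular along local sections. -/
theorem cosetTangentEquiv_apply (hH : IsHolSubgroup EG EH H)
    (hX : IsHolSubmersion (EB := EX) 𝓘(ℂ, EG) (cosetProj H)) (x : G ⧸ H)
    (f : assocFiber (cosetProj H) (cosetAct H) (isotropyRep hH) x) (a : {a // cosetProj H a = x}) :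
    cosetTangentEquiv hH hX x f = cosetEquiv hH hX a.1 (f.1 a) := by
  obtain ⟨h, hh⟩ := (isPrincipalBundle_coset hH hX).exists_act_eq x.out a.1
    ((cosetProj_out x).trans a.2.symm)
  have h1 := f.2 ⟨x.out, cosetProj_out x⟩ a h hh.symm
  rw [h1, ← hh]
  exact (cosetEquiv_mul hH hX x.out h (f.1 ⟨x.out, cosetProj_out x⟩)).symm

/-- Work along a local section `s` of `π`. Forwards, lift the `𝔤/𝔥`-valued function linearly to `𝔤`
and push it forward by `x ↦ s(y)xH`. Backwards, push the field into `G` by `s`, translate it to 1 by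
`s(y)⁻¹` and reduce modulo `𝔥`; as `π ∘ s = id`, this inverts the former. -/
theorem isIso_cosetTangentEquiv (hH : IsHolSubgroup EG EH H)
    (hX : IsHolSubmersion (EB := EX) 𝓘(ℂ, EG) (cosetProj H)) :
    HolFamily.IsIso (assocBundle EG (cosetProj H) (cosetAct H) (isotropyRep hH))
      (tangentFamily (EX := EX)) (fun x => cosetTangentEquiv hH hX x) := by
  have hV : FiniteDimensional ℂ (GroupLieAlgebra 𝓘(ℂ, EG) G) :=
    inferInstanceAs (FiniteDimensional ℂ EG)
  have hcont := hX.contMDiff.continuous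
  let N := LinearMap.range (lieIncl EG EH H)
  constructor
  · intro U hU (σ : ∀ x, assocFiber (cosetProj H) (cosetAct H) (isotropyRep hH) x) hσ
    replace hσ := (assocBundle_isHolOn_iff hcont hU σ).1 hσ
    refine (tangentFamily_isHolOn_iff hU _).2 ?_
    intro x hx
    obtain ⟨L, hL⟩ := N.mkQ.exists_rightInverse_of_surjective N.range_mkQ
    obtain ⟨a, rfl⟩ := QuotientGroup.mk_surjective x
    obtain ⟨s, W, hW, haW, hs, hsa, hsW⟩ := exists_coset_section hX a
    have hsc := hs.contMDiffAt (hW.mem_nhds haW)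
    have h1 : ContMDiffAt 𝓘(ℂ, EX) 𝓘(ℂ, EG) ω
        (fun x => lieAlgebraModel EG G (L (assocFun σ (s x)))) (cosetProj H a) := by
      refine contMDiffAt_linearMap_of_forall_dual
        ((lieAlgebraModel EG G).toLinearMap ∘ₗ L) fun ℓ => ?_
      refine ContMDiffAt.comp _ (g := fun p => ℓ (assocFun σ p)) ?_ hsc
      rw [hsa]
      exact hσ a hx ℓ
    have hΨ : ContMDiff (𝓘(ℂ, EG).prod 𝓘(ℂ, EG)) 𝓘(ℂ, EX) ω
        (fun p : G × G => cosetProj H (p.1 * p.2)) := hX.contMDiff.comp (contMDiff_mul _ _)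
    refine (IsHolFieldAt.map_param hΨ hsc
      ((isHolFieldAt_const_iff (I₁ := 𝓘(ℂ, EG)) (a := (1 : G))).2 h1)).congr ?_ ?_
    · filter_upwards [hW.mem_nhds haW] with y hy
      rw [mul_one, hsW y hy]
    · filter_upwards [hW.mem_nhds haW] with y hy
      refine (cosetTangentEquiv_apply hH hX y (σ y) ⟨s y, hsW y hy⟩).trans ?_
      rw [← assocFun_eq]
      conv_lhs => rw [← LinearMap.id_apply (R := ℂ) (assocFun σ (s y)), ← hL]
      rfl
  · intro U hU (v : ∀ x, EX) hv
    replace hv := (tangentFamily_isHolOn_iff hU v).1 hv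
    refine (assocBundle_isHolOn_iff hcont hU _).2 ?_
    intro a ha ℓ
    obtain ⟨s, W, hW, haW, hs, hsa, hsW⟩ := exists_coset_section hX a
    have hsc := hs.contMDiffAt (hW.mem_nhds haW)
    set σ : ∀ x, assocFiber (cosetProj H) (cosetAct H) (isotropyRep hH) x :=
      fun x => (cosetTangentEquiv hH hX x).symm (v x) with hσ
    have hρ : (isotropyRep hH).IsHol EH :=
      (adRep_isHol.comp hH.contMDiff).quotient _ _
    -- The construction controls the equivariant function only on the image of `s`; equivariance
    -- extends holomorphy to a neighbourhood of `a`.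
    refine contMDiffAt_assocFun_of_comp hH hρ σ (g := fun b => s (cosetProj H b))
      (ContMDiffAt.comp a hsc hX.contMDiff.contMDiffAt) ?_ ?_ ℓ
    · filter_upwards [hcont.continuousAt.eventually (hW.mem_nhds haW)] with b hb
      exact hsW _ hb
    · intro ℓ
      refine ContMDiffAt.comp a (g := fun x => ℓ (assocFun σ (s x))) ?_ hX.contMDiff.contMDiffAt
      have hΨ : ContMDiff (𝓘(ℂ, EG).prod 𝓘(ℂ, EG)) 𝓘(ℂ, EG) ω
        (fun p : G × G => p.1⁻¹ * p.2) := contMDiff_fst.inv.mul contMDiff_snd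
      have h1 := IsHolFieldAt.map_param hΨ hsc ((hv _ ha).map hsc)
      have h2 := (isHolFieldAt_const_iff (a := (1 : G))).1 (h1.congr
        (Eventually.of_forall fun z => (inv_mul_cancel (s z)).symm)
        (Eventually.of_forall fun z => rfl))
      refine (contMDiffAt_clm_apply (LinearMap.toContinuousLinearMap (E := EG) (F' := ℂ)
        (ℓ ∘ₗ N.mkQ)) h2).congr_of_eventuallyEq ?_
      filter_upwards [hW.mem_nhds haW] with y hy
      refine congrArg ℓ ?_
      rw [assocFun_eq σ (hsW y hy)]
      apply (cosetEquiv hH hX (s y)).injective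
      rw [← cosetTangentEquiv_apply hH hX y (σ y) ⟨s y, hsW y hy⟩, hσ,
        LinearEquiv.apply_symm_apply]
      refine Eq.symm ((cosetDeriv_apply hX (s y) _).trans ?_)
      refine (congrArg (tderiv 𝓘(ℂ, EG) 𝓘(ℂ, EX) (cosetProj H) (s y))
        ((leftTranslate EG (s y)).apply_symm_apply _)).trans ?_
      rw [← ContMDiffAt.tderiv_comp hX.contMDiff.contMDiffAt (hs.contMDiffAt (hW.mem_nhds hy))]
      have e : (fun x => cosetProj H (s x)) =ᶠ[𝓝 y] fun x => x := by
        filter_upwards [hW.mem_nhds hy] with z hz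
        exact hsW z hz
      rw [tderiv_congr e, tderiv_id]
      rfl

/-- The identification of `G ×^H 𝔤` with the Atiyah bundle of `G → G/H` on fibres. -/
def cosetAtiyahEquiv (hH : IsHolSubgroup EG EH H)
    (hX : IsHolSubmersion (EB := EX) 𝓘(ℂ, EG) (cosetProj H)) (x : G ⧸ H) :
    assocFiber (cosetProj H) (cosetAct H) (adRestrict EG H) x ≃ₗ[ℂ]
      atiyahFiber EG (cosetProj H) (cosetAct H) x :=
  (((isPrincipalBundle_coset hH hX).assocEval (adRestrict EG H) x
    ⟨x.out, cosetProj_out x⟩).trans (leftTranslate EG x.out)).trans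
    ((isPrincipalBundle_coset hH hX).atiyahEval x ⟨x.out, cosetProj_out x⟩).symm

theorem cosetAtiyahEquiv_apply (hH : IsHolSubgroup EG EH H)
    (hX : IsHolSubmersion (EB := EX) 𝓘(ℂ, EG) (cosetProj H)) (x : G ⧸ H)
    (f : assocFiber (cosetProj H) (cosetAct H) (adRestrict EG H) x)
    (a : {a // cosetProj H a = x}) :
    ((cosetAtiyahEquiv hH hX x f).1 a : EG) = leftTranslate EG a.1 (f.1 a) := by
  have hP := isPrincipalBundle_coset hH hX
  obtain ⟨h, hh⟩ := hP.exists_act_eq x.out a.1 ((cosetProj_out x).trans a.2.symm)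
  have h0 : ((cosetAtiyahEquiv hH hX x f).1 ⟨x.out, cosetProj_out x⟩ : EG) =
      leftTranslate EG x.out (f.1 ⟨x.out, cosetProj_out x⟩) :=
    (hP.atiyahEval x ⟨x.out, cosetProj_out x⟩).apply_symm_apply _
  have h1 := f.2 ⟨x.out, cosetProj_out x⟩ a h hh.symm
  have h2 := (cosetAtiyahEquiv hH hX x f).2 ⟨x.out, cosetProj_out x⟩ a h hh.symm
  refine h2.trans ((congrArg (tderiv 𝓘(ℂ, EG) 𝓘(ℂ, EG) (fun y => cosetAct H y h) x.out) h0).trans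
    ((leftTranslate_mul_adRep x.out (h : G) _).symm.trans ?_))
  rw [h1, ← hh]
  rfl

/-- Both kinds of section live on `G` itself, so left translation by the point and by its inverse
suffices, without local sections. -/
theorem isIso_cosetAtiyahEquiv (hH : IsHolSubgroup EG EH H)
    (hX : IsHolSubmersion (EB := EX) 𝓘(ℂ, EG) (cosetProj H)) :
    HolFamily.IsIso (assocBundle EG (cosetProj H) (cosetAct H) (adRestrict EG H))
      (atiyahBundle (EP := EG) (cosetProj H) (cosetAct H)) (cosetAtiyahEquiv hH hX) := by
  have hV : FiniteDimensional ℂ (GroupLieAlgebra 𝓘(ℂ, EG) G) :=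
    inferInstanceAs (FiniteDimensional ℂ EG)
  have hcont := hX.contMDiff.continuous
  constructor
  · intro U hU (σ : ∀ x, assocFiber (cosetProj H) (cosetAct H) (adRestrict EG H) x) hσ
    replace hσ := (assocBundle_isHolOn_iff hcont hU σ).1 hσ
    refine (atiyahBundle_isHolOn_iff hcont hU _).2 ?_
    intro a ha
    have h1 : ContMDiffAt 𝓘(ℂ, EG) 𝓘(ℂ, EG) ω (fun x => lieAlgebraModel EG G (assocFun σ x)) a :=
      contMDiffAt_linearMap_of_forall_dual (lieAlgebraModel EG G).toLinearMap (hσ a ha)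
    refine (IsHolFieldAt.map_param (contMDiff_mul 𝓘(ℂ, EG) ω) contMDiffAt_id
      ((isHolFieldAt_const_iff (I₁ := 𝓘(ℂ, EG)) (a := (1 : G))).2 h1)).congr ?_ ?_
    · exact Eventually.of_forall fun z => (mul_one z).symm
    · exact Eventually.of_forall fun z => cosetAtiyahEquiv_apply hH hX _ (σ _) ⟨z, rfl⟩
  · intro U hU (v : ∀ x, atiyahFiber EG (cosetProj H) (cosetAct H) x) hv
    replace hv := (atiyahBundle_isHolOn_iff hcont hU v).1 hv
    refine (assocBundle_isHolOn_iff hcont hU _).2 ?_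
    intro a ha ℓ
    have hΨ : ContMDiff (𝓘(ℂ, EG).prod 𝓘(ℂ, EG)) 𝓘(ℂ, EG) ω
      (fun p : G × G => p.1⁻¹ * p.2) := contMDiff_fst.inv.mul contMDiff_snd
    have h1 := IsHolFieldAt.map_param hΨ contMDiffAt_id (hv a ha)
    have h2 := (isHolFieldAt_const_iff (a := (1 : G))).1 (h1.congr
      (Eventually.of_forall fun z => (inv_mul_cancel z).symm)
      (Eventually.of_forall fun z => rfl))
    refine (contMDiffAt_clm_apply (LinearMap.toContinuousLinearMap (E := EG) (F' := ℂ) ℓ)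
      h2).congr_of_eventuallyEq (Eventually.of_forall fun z => ?_)
    refine congrArg ℓ ?_
    apply (leftTranslate EG z).injective
    refine (cosetAtiyahEquiv_apply hH hX _ _ ⟨z, rfl⟩).symm.trans ?_
    refine Eq.trans ?_ ((leftTranslate EG z).apply_symm_apply _).symm
    exact congrArg (fun f : atiyahFiber EG (cosetProj H) (cosetAct H) (cosetProj H z) =>
      (f.1 ⟨z, rfl⟩ : EG)) ((cosetAtiyahEquiv hH hX (cosetProj H z)).apply_symm_apply _)

/-- The Atiyah sequence of `G → G/H` is the sequence associated to `0 → 𝔥 → 𝔤 → 𝔤/𝔥 → 0`. -/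
def cosetAtiyahIso (hH : IsHolSubgroup EG EH H)
    (hX : IsHolSubmersion (EB := EX) 𝓘(ℂ, EG) (cosetProj H)) :
    HolSeq.Iso (assocSeq EG (cosetProj H) (cosetAct H) (inclRep hH) (quotRep hH))
      (atiyahSeq (isPrincipalBundle_coset hH hX)) where
  left x := LinearEquiv.refl ℂ _
  mid := cosetAtiyahEquiv hH hX
  right x := cosetTangentEquiv hH hX x
  left_iso := ⟨fun _ _ _ h => h, fun _ _ _ h => h⟩
  mid_iso := isIso_cosetAtiyahEquiv hH hX
  right_iso := isIso_cosetTangentEquiv hH hX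
  comm_inc x f := by
    refine Subtype.ext (funext fun a => ?_)
    exact (cosetAtiyahEquiv_apply hH hX x _ a).trans (leftTranslate_lieIncl hH a.1 _)
  comm_proj x f := by
    refine (cosetTangentEquiv_apply hH hX x _ ⟨x.out, cosetProj_out x⟩).trans ?_
    refine Eq.trans ?_ (atiyahProj_eq (isPrincipalBundle_coset hH hX) x
      (cosetAtiyahEquiv hH hX x f) ⟨x.out, cosetProj_out x⟩).symm
    refine (cosetDeriv_apply hX x.out _).trans ?_
    exact congrArg (tderiv 𝓘(ℂ, EG) 𝓘(ℂ, EX) (cosetProj H) x.out)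
      (cosetAtiyahEquiv_apply hH hX x f ⟨x.out, cosetProj_out x⟩).symm

theorem isShortExact_coset_assocSeq (hH : IsHolSubgroup EG EH H)
    (hX : IsHolSubmersion (EB := EX) 𝓘(ℂ, EG) (cosetProj H)) :
    (assocSeq EG (cosetProj H) (cosetAct H) (inclRep hH) (quotRep hH)).IsShortExact (EX := EX) := by
  have hV : FiniteDimensional ℂ (GroupLieAlgebra 𝓘(ℂ, EG) G) :=
    inferInstanceAs (FiniteDimensional ℂ EG)
  have hV' : FiniteDimensional ℂ (GroupLieAlgebra 𝓘(ℂ, EH) H) :=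
    inferInstanceAs (FiniteDimensional ℂ EH)
  have hρ : (adRestrict EG H).IsHol EH := adRep_isHol.comp hH.contMDiff
  refine (isPrincipalBundle_coset hH hX).isShortExact_assocSeq adRep_isHol hρ
    (hρ.quotient _ _) _ _ (hH.injective 1) ?_ (Submodule.mkQ_surjective _)
  intro v
  exact Submodule.Quotient.mk_eq_zero (LinearMap.range (lieIncl EG EH H))

end AtiyahCoset

/-! ### Orbit maps, right translations and the relations defining `G^τ`. -/

section OrbitMaps

variable {EP P EX X EK K : Type*}
  [NormedAddCommGroup EP] [NormedSpace ℂ EP] [TopologicalSpace P] [ChartedSpace EP P]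
  [NormedAddCommGroup EX] [NormedSpace ℂ EX] [TopologicalSpace X] [ChartedSpace EX X]
  [NormedAddCommGroup EK] [NormedSpace ℂ EK] [TopologicalSpace K] [ChartedSpace EK K] [Group K]
  {π : P → X} {act : P → K → P}

/-- Followed by the group coordinate of a trivialisation, the orbit map is a left translation of
`K`, whose differential is injective. -/
theorem IsPrincipalBundle.tderiv_orbit_injective [LieGroup 𝓘(ℂ, EK) ω K]
    (h : IsPrincipalBundle (EP := EP) (EX := EX) (EK := EK) π act) (p : P) {η : EK}
    (hη : tderiv 𝓘(ℂ, EK) 𝓘(ℂ, EP) (fun k => act p k) 1 η = 0) : η = 0 := by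
  obtain ⟨U, φ, -, hx, hs, -, hφ1, -, hφ⟩ := h.locally_trivial (π p)
  have hp : p ∈ φ.source := by rw [hs]; exact hx
  have hp1 : act p 1 ∈ φ.source := by rwa [h.act_one]
  have h1 : ContMDiffAt 𝓘(ℂ, EP) 𝓘(ℂ, EK) ω (fun q => (φ q).2) (act p 1) :=
    contMDiffAt_snd.comp _ (hφ1.contMDiffAt (φ.open_source.mem_nhds hp1))
  have h2 := ContMDiffAt.tderiv_comp h1 (h.contMDiff_orbit p).contMDiffAt η
  rw [hη, map_zero] at h2
  simp only [(hφ p hp).2] at h2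
  exact (leftTranslate EK (φ p).2).map_eq_zero_iff.1 h2

end OrbitMaps

section RightTranslations

variable {EM M : Type*} [NormedAddCommGroup EM] [NormedSpace ℂ EM] [TopologicalSpace M]
  [ChartedSpace EM M] [Group M] [LieGroup 𝓘(ℂ, EM) ω M]

theorem rightInvariantField_surjective (b : M) (w : EM) :
    ∃ η : EM, tderiv 𝓘(ℂ, EM) 𝓘(ℂ, EM) (fun y => y * b) 1 η = w := by
  refine ⟨tderiv 𝓘(ℂ, EM) 𝓘(ℂ, EM) (fun y => y * b⁻¹) b w, ?_⟩
  have h := ContMDiffAt.tderiv_comp (g := fun y : M => y * b) (f := fun y => y * b⁻¹) (a := b)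
    (contMDiff_mul_right (I := 𝓘(ℂ, EM)) (n := ω) _)
    (contMDiff_mul_right (I := 𝓘(ℂ, EM)) (n := ω) _) w
  rw [mul_inv_cancel] at h
  rw [← h]
  simp only [inv_mul_cancel_right, tderiv_id]
  rfl

end RightTranslations

section ExtBasic

variable {G M : Type*} [Group G] [Group M] {H : Subgroup G} (τ : H →* M)

theorem extMk_surjective (p : ExtBundle τ) : ∃ a b, extMk τ (a, b) = p := by
  obtain ⟨⟨a, b⟩, h⟩ := Quotient.exists_rep p
  exact ⟨a, b, h⟩

theorem extMk_mul (a : G) (h : H) (b : M) : extMk τ (a * h, b) = extMk τ (a, τ h * b) :=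
  (Quotient.sound (s := extSetoid τ) ⟨h, by simp⟩).symm

theorem exists_of_extMk_eq {u v : G × M} (h : extMk τ u = extMk τ v) :
    ∃ k : H, v = (u.1 * k, (τ k)⁻¹ * u.2) :=
  Quotient.exact (s := extSetoid τ) h

theorem extProj_extMk (u : G × M) : extProj τ (extMk τ u) = cosetProj H u.1 := rfl

theorem extAct_extMk (u : G × M) (m : M) : extAct τ (extMk τ u) m = extMk τ (u.1, u.2 * m) := rfl

/-- Two points of the extension over the same point of the base differ by the action. -/
theorem extMk_mul_eq_extAct (a : G) (h : H) (b : M) :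
    extMk τ (a * h, b) = extAct τ (extMk τ (a, 1)) (τ h * b) := by
  rw [extMk_mul, extAct_extMk, one_mul]

end ExtBasic

/-! ### The principal bundle `G^τ` and the differential of `ρ`. -/

section Ext

open scoped Topology
open Filter

variable {EG G EH EX EM M EP : Type*}
  [NormedAddCommGroup EG] [NormedSpace ℂ EG] [TopologicalSpace G] [ChartedSpace EG G] [Group G]
  [LieGroup 𝓘(ℂ, EG) ω G]
  {H : Subgroup G} [NormedAddCommGroup EH] [NormedSpace ℂ EH] [ChartedSpace EH H]
  [NormedAddCommGroup EM] [NormedSpace ℂ EM] [TopologicalSpace M] [ChartedSpace EM M] [Group M]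
  [LieGroup 𝓘(ℂ, EM) ω M] {τ : H →* M}
  [NormedAddCommGroup EP] [NormedSpace ℂ EP] [ChartedSpace EP (ExtBundle τ)]

theorem contMDiff_extMk_mul
    (hQ : IsHolSubmersion (EB := EP) (𝓘(ℂ, EG).prod 𝓘(ℂ, EM)) (extMk τ)) (a : G) (b : M) :
    ContMDiff (𝓘(ℂ, EG).prod 𝓘(ℂ, EM)) 𝓘(ℂ, EP) ω
      fun q : G × M => extMk τ (a * q.1, q.2 * b) :=
  hQ.contMDiff.comp ((contMDiff_const.mul contMDiff_fst).prodMk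
    (contMDiff_snd.mul contMDiff_const))

omit [LieGroup 𝓘(ℂ, EM) ω M] in
theorem contMDiff_extMk_left
    (hQ : IsHolSubmersion (EB := EP) (𝓘(ℂ, EG).prod 𝓘(ℂ, EM)) (extMk τ)) (a : G) (b : M) :
    ContMDiff 𝓘(ℂ, EG) 𝓘(ℂ, EP) ω fun x : G => extMk τ (a * x, b) :=
  hQ.contMDiff.comp (contMDiff_mul_left.prodMk contMDiff_const)

omit [LieGroup 𝓘(ℂ, EG) ω G] in
theorem contMDiff_extMk_right
    (hQ : IsHolSubmersion (EB := EP) (𝓘(ℂ, EG).prod 𝓘(ℂ, EM)) (extMk τ)) (a : G) (b : M) :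
    ContMDiff 𝓘(ℂ, EM) 𝓘(ℂ, EP) ω fun y : M => extMk τ (a, y * b) :=
  hQ.contMDiff.comp (contMDiff_const.prodMk contMDiff_mul_right)

variable (EG EM EP τ) in
/-- The map `(ξ, η) ↦ dρ (dL_a ξ, dR_b η)`, where `ρ` is the projection to the extension. -/
def twistedDeriv (a : G) (b : M) :
    (GroupLieAlgebra 𝓘(ℂ, EG) G × GroupLieAlgebra 𝓘(ℂ, EM) M) →ₗ[ℂ] EP where
  toFun v := tderiv (𝓘(ℂ, EG).prod 𝓘(ℂ, EM)) 𝓘(ℂ, EP)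
    (fun q : G × M => extMk τ (a * q.1, q.2 * b)) (1, 1) v
  map_add' := map_add (tderiv (𝓘(ℂ, EG).prod 𝓘(ℂ, EM)) 𝓘(ℂ, EP)
    (fun q : G × M => extMk τ (a * q.1, q.2 * b)) (1, 1))
  map_smul' := map_smul (tderiv (𝓘(ℂ, EG).prod 𝓘(ℂ, EM)) 𝓘(ℂ, EP)
    (fun q : G × M => extMk τ (a * q.1, q.2 * b)) (1, 1))

/-- Equivariance and the kernel can then be computed in each factor separately. -/
theorem twistedDeriv_eq_add
    (hQ : IsHolSubmersion (EB := EP) (𝓘(ℂ, EG).prod 𝓘(ℂ, EM)) (extMk τ)) (a : G) (b : M)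
    (v : GroupLieAlgebra 𝓘(ℂ, EG) G × GroupLieAlgebra 𝓘(ℂ, EM) M) :
    twistedDeriv EG EM EP τ a b v =
      tderiv 𝓘(ℂ, EG) 𝓘(ℂ, EP) (fun x : G => extMk τ (a * x, b)) 1 v.1 +
        tderiv 𝓘(ℂ, EM) 𝓘(ℂ, EP) (fun y : M => extMk τ (a, y * b)) 1 v.2 := by
  have h := ContMDiffAt.tderiv_prod (contMDiff_extMk_mul hQ a b (1, 1)) v
  simp only [mul_one, one_mul] at h
  exact h

theorem twistedDeriv_apply
    (hQ : IsHolSubmersion (EB := EP) (𝓘(ℂ, EG).prod 𝓘(ℂ, EM)) (extMk τ)) (a : G) (b : M)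
    (v : GroupLieAlgebra 𝓘(ℂ, EG) G × GroupLieAlgebra 𝓘(ℂ, EM) M) :
    twistedDeriv EG EM EP τ a b v = tderiv (𝓘(ℂ, EG).prod 𝓘(ℂ, EM)) 𝓘(ℂ, EP) (extMk τ) (a, b)
      (tderiv 𝓘(ℂ, EG) 𝓘(ℂ, EG) (fun x => a * x) 1 v.1,
        tderiv 𝓘(ℂ, EM) 𝓘(ℂ, EM) (fun y => y * b) 1 v.2) := by
  rw [twistedDeriv_eq_add hQ, ContMDiffAt.tderiv_prod (hQ.contMDiff (a, b))]
  have h1 := ContMDiffAt.tderiv_comp (g := fun x => extMk τ (x, b)) (f := fun x => a * x)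
    (a := (1 : G)) (hQ.contMDiff.comp (contMDiff_id.prodMk contMDiff_const)).contMDiffAt
    (contMDiff_mul_left (I := 𝓘(ℂ, EG)) (n := ω) _) v.1
  have h2 := ContMDiffAt.tderiv_comp (g := fun y => extMk τ (a, y)) (f := fun y => y * b)
    (a := (1 : M)) (hQ.contMDiff.comp (contMDiff_const.prodMk contMDiff_id)).contMDiffAt
    (contMDiff_mul_right (I := 𝓘(ℂ, EM)) (n := ω) _) v.2
  rw [mul_one] at h1
  rw [one_mul] at h2
  exact congrArg₂ (fun v w : EP => v + w) h1 h2

theorem twistedDeriv_surjective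
    (hQ : IsHolSubmersion (EB := EP) (𝓘(ℂ, EG).prod 𝓘(ℂ, EM)) (extMk τ)) (a : G) (b : M) :
    Function.Surjective (twistedDeriv EG EM EP τ a b) := by
  intro w
  obtain ⟨⟨v₁, v₂⟩, hv⟩ := hQ.surjective (a, b) w
  obtain ⟨η, hη⟩ := rightInvariantField_surjective b v₂
  refine ⟨((leftTranslate EG a).symm v₁, η), (twistedDeriv_apply hQ a b _).trans ?_⟩
  refine (congrArg (tderiv (𝓘(ℂ, EG).prod 𝓘(ℂ, EM)) 𝓘(ℂ, EP) (extMk τ) (a, b))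
    (Prod.ext ((leftTranslate EG a).apply_symm_apply v₁) hη)).trans hv

/-- In the two factors this is `[ah · h⁻¹xh, b] = [ax, τ(h)b]` and `[ah, τ(h)⁻¹yτ(h)b] = [a,
yτ(h)b]`. -/
theorem twistedDeriv_mul_adRep
    (hQ : IsHolSubmersion (EB := EP) (𝓘(ℂ, EG).prod 𝓘(ℂ, EM)) (extMk τ)) (a : G) (b : M) (h : H)
    (v : GroupLieAlgebra 𝓘(ℂ, EG) G × GroupLieAlgebra 𝓘(ℂ, EM) M) :
    twistedDeriv EG EM EP τ (a * h) b (adRep EG G (h : G)⁻¹ v.1, adRep EM M (τ h)⁻¹ v.2) =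
      twistedDeriv EG EM EP τ a (τ h * b) v := by
  rw [twistedDeriv_eq_add hQ, twistedDeriv_eq_add hQ]
  refine congrArg₂ (fun v w : EP => v + w)
    ((tderiv_conj (contMDiff_extMk_left hQ (a * h) b) _ v.1).trans ?_)
    ((tderiv_conj (contMDiff_extMk_right hQ (a * h) b) _ v.2).trans ?_)
  · have e : (fun x : G => extMk τ (a * h * ((h : G)⁻¹ * x * (h : G)⁻¹⁻¹), b)) =
        fun x => extMk τ (a * x, τ h * b) := by
      funext x
      rw [← extMk_mul]
      congr 2
      group
    rw [e]
  · have e : (fun y : M => extMk τ (a * h, (τ h)⁻¹ * y * (τ h)⁻¹⁻¹ * b)) =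
        fun y => extMk τ (a, y * (τ h * b)) := by
      funext y
      rw [extMk_mul]
      congr 2
      group
    rw [e]

/-- Differentiating `[ah, b] = [a, τ(h)b]` at `h = 1` shows that `(ξ, 0)` and `(0, dτ ξ)` have the
same image; the sign in `twistedIncl` makes them cancel. -/
theorem range_twistedIncl_le_ker_twistedDeriv (hH : IsHolSubgroup EG EH H)
    (hτ : ContMDiff 𝓘(ℂ, EH) 𝓘(ℂ, EM) ω τ)
    (hQ : IsHolSubmersion (EB := EP) (𝓘(ℂ, EG).prod 𝓘(ℂ, EM)) (extMk τ)) (a : G) (b : M) :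
    LinearMap.range (twistedIncl EG EH EM τ) ≤ LinearMap.ker (twistedDeriv EG EM EP τ a b) := by
  rintro _ ⟨ξ, rfl⟩
  rw [LinearMap.mem_ker]
  have h1 := ContMDiffAt.tderiv_comp (f := (H.subtype : H → G)) (a := (1 : H))
    (contMDiff_extMk_left hQ a b).contMDiffAt hH.contMDiff.contMDiffAt ξ
  have h2 := ContMDiffAt.tderiv_comp (f := (τ : H → M)) (a := (1 : H))
    (contMDiff_extMk_right hQ a b).contMDiffAt hτ.contMDiffAt ξ
  have e : (fun h : H => extMk τ (a * H.subtype h, b)) = fun h => extMk τ (a, τ h * b) := by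
    funext h
    exact extMk_mul τ a h b
  rw [e, h2, map_one, map_one] at h1
  refine (twistedDeriv_eq_add hQ a b _).trans ?_
  refine (congrArg₂ (fun v w : EP => v + w) h1.symm
    (map_neg (tderiv 𝓘(ℂ, EM) 𝓘(ℂ, EP) (fun y : M => extMk τ (a, y * b)) 1)
      (lieMap (EK := EH) (EG := EM) τ ξ))).trans ?_
  exact add_neg_cancel _

variable [FiniteDimensional ℂ EP] [IsManifold 𝓘(ℂ, EP) ω (ExtBundle τ)]

theorem exists_ext_section
    (hQ : IsHolSubmersion (EB := EP) (𝓘(ℂ, EG).prod 𝓘(ℂ, EM)) (extMk τ)) (u : G × M) :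
    ∃ (t : ExtBundle τ → G × M) (W : Set (ExtBundle τ)), IsOpen W ∧ extMk τ u ∈ W ∧
      ContMDiffOn 𝓘(ℂ, EP) (𝓘(ℂ, EG).prod 𝓘(ℂ, EM)) ω t W ∧ t (extMk τ u) = u ∧
      ∀ p ∈ W, extMk τ (t p) = p :=
  hQ.contMDiff.contMDiffAt.exists_local_section (hQ.surjective u)

theorem contMDiffAt_of_comp_extMk
    (hQ : IsHolSubmersion (EB := EP) (𝓘(ℂ, EG).prod 𝓘(ℂ, EM)) (extMk τ))
    {E₃ H₃ C : Type*} [NormedAddCommGroup E₃] [NormedSpace ℂ E₃] [TopologicalSpace H₃]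
    [TopologicalSpace C] [ChartedSpace H₃ C] {I₃ : ModelWithCorners ℂ E₃ H₃} {u : G × M}
    {f : ExtBundle τ → C}
    (hf : ContMDiffAt (𝓘(ℂ, EG).prod 𝓘(ℂ, EM)) I₃ ω (fun u => f (extMk τ u)) u) :
    ContMDiffAt 𝓘(ℂ, EP) I₃ ω f (extMk τ u) :=
  ContMDiffAt.of_comp_submersion hQ.contMDiff.contMDiffAt (hQ.surjective u) hf

theorem contMDiff_extAct
    (hQ : IsHolSubmersion (EB := EP) (𝓘(ℂ, EG).prod 𝓘(ℂ, EM)) (extMk τ)) :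
    ContMDiff (𝓘(ℂ, EP).prod 𝓘(ℂ, EM)) 𝓘(ℂ, EP) ω
      fun q : ExtBundle τ × M => extAct τ q.1 q.2 := by
  rintro ⟨p, m⟩
  obtain ⟨a, b, rfl⟩ := extMk_surjective τ p
  obtain ⟨t, W, hW, hpW, ht, -, htW⟩ := exists_ext_section hQ (a, b)
  have h1 : ContMDiffAt (𝓘(ℂ, EP).prod 𝓘(ℂ, EM)) (𝓘(ℂ, EG).prod 𝓘(ℂ, EM)) ω
      (fun q : ExtBundle τ × M => t q.1) (extMk τ (a, b), m) :=
    ContMDiffAt.comp _ (ht.contMDiffAt (hW.mem_nhds hpW)) contMDiffAt_fst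
  have h2 : ContMDiffAt (𝓘(ℂ, EP).prod 𝓘(ℂ, EM)) 𝓘(ℂ, EP) ω
      (fun q : ExtBundle τ × M => extMk τ ((t q.1).1, (t q.1).2 * q.2)) (extMk τ (a, b), m) :=
    ContMDiffAt.comp _ hQ.contMDiff.contMDiffAt
      ((contMDiffAt_fst.comp _ h1).prodMk ((contMDiffAt_snd.comp _ h1).mul contMDiffAt_snd))
  refine h2.congr_of_eventuallyEq ?_
  have h3 : ∀ᶠ q : ExtBundle τ × M in 𝓝 (extMk τ (a, b), m), q.1 ∈ W :=
    continuousAt_fst.eventually (hW.mem_nhds hpW)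
  filter_upwards [h3] with q hq
  rw [← extAct_extMk, htW _ hq]

variable [NormedAddCommGroup EX] [NormedSpace ℂ EX] [ChartedSpace EX (G ⧸ H)]
  [LieGroup 𝓘(ℂ, EH) ω H] [IsManifold 𝓘(ℂ, EX) ω (G ⧸ H)] [FiniteDimensional ℂ EX]
  [FiniteDimensional ℂ EG] [FiniteDimensional ℂ EH]

/-- The extension of structure group of `G → G/H` is a principal bundle. -/
theorem isPrincipalBundle_ext (hH : IsHolSubgroup EG EH H)
    (hX : IsHolSubmersion (EB := EX) 𝓘(ℂ, EG) (cosetProj H))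
    (hτ : ContMDiff 𝓘(ℂ, EH) 𝓘(ℂ, EM) ω τ)
    (hQ : IsHolSubmersion (EB := EP) (𝓘(ℂ, EG).prod 𝓘(ℂ, EM)) (extMk τ)) :
    IsPrincipalBundle (EP := EP) (EX := EX) (EK := EM) (extProj τ) (extAct τ) := by
  have hproj : ContMDiff 𝓘(ℂ, EP) 𝓘(ℂ, EX) ω (extProj τ) := by
    intro p
    obtain ⟨a, b, rfl⟩ := extMk_surjective τ p
    exact contMDiffAt_of_comp_extMk hQ (hX.contMDiff.comp contMDiff_fst).contMDiffAt
  refine ⟨?_, ?_, ?_, hproj, contMDiff_extAct hQ, ?_⟩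
  · intro p
    obtain ⟨a, b, rfl⟩ := extMk_surjective τ p
    rw [extAct_extMk, mul_one]
  · intro p k l
    obtain ⟨a, b, rfl⟩ := extMk_surjective τ p
    rw [extAct_extMk, extAct_extMk, extAct_extMk, mul_assoc]
  · intro p k
    obtain ⟨a, b, rfl⟩ := extMk_surjective τ p
    rfl
  intro x
  obtain ⟨a, rfl⟩ := QuotientGroup.mk_surjective x
  obtain ⟨s, W, hW, haW, hs, -, hsW⟩ := exists_coset_section hX a
  obtain ⟨κ, hκ, hκ'⟩ := hH.exists_lift (I₀ := 𝓘(ℂ, EG)) fun b : G => (s (cosetProj H b))⁻¹ * b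
  have hmem : ∀ b, cosetProj H b ∈ W → (s (cosetProj H b))⁻¹ * b ∈ H := fun b hb =>
    inv_mul_mem_of_cosetProj_eq (hsW _ hb)
  have hκ2 : ∀ b, cosetProj H b ∈ W → s (cosetProj H b) * (κ b : G) = b := fun b hb => by
    rw [hκ b (hmem b hb), mul_inv_cancel_left]
  have hκc : ∀ b, cosetProj H b ∈ W → ContMDiffAt 𝓘(ℂ, EG) 𝓘(ℂ, EH) ω κ b := by
    intro b hb
    refine hκ' b ?_ ?_
    · have h1 : ContMDiffAt 𝓘(ℂ, EG) 𝓘(ℂ, EG) ω (fun b => s (cosetProj H b)) b :=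
        ContMDiffAt.comp b (hs.contMDiffAt (hW.mem_nhds hb)) hX.contMDiff.contMDiffAt
      exact h1.inv.mul contMDiffAt_id
    · filter_upwards [hX.contMDiff.continuous.continuousAt.eventually (hW.mem_nhds hb)] with c hc
      exact hmem c hc
  -- Arbitrary representatives define the fibre coordinate `β [a, b] = τ(κ a) b`. It is independent
  -- of them, as `κ(ak) = κ(a)k` compensates `τ(k)⁻¹`, and its holomorphy is checked after composing
  -- with `ρ`.
  choose o₁ o₂ ho using extMk_surjective τ
  let β : ExtBundle τ → M := fun p => τ (κ (o₁ p)) * o₂ p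
  have hβ : ∀ a b, cosetProj H a ∈ W → β (extMk τ (a, b)) = τ (κ a) * b := by
    intro a b ha
    obtain ⟨k, hk⟩ := exists_of_extMk_eq τ (ho (extMk τ (a, b))).symm
    obtain ⟨hk1, hk2⟩ := Prod.ext_iff.1 hk
    change τ (κ (o₁ (extMk τ (a, b)))) * o₂ (extMk τ (a, b)) = _
    dsimp only at hk1 hk2
    have hak : cosetProj H (a * k) = cosetProj H a := cosetProj_mul a k
    have e : κ (a * k) = κ a * k := by
      apply Subtype.ext
      rw [Subgroup.coe_mul, hκ _ (hmem _ (by rwa [hak])), hκ _ (hmem _ ha), hak, mul_assoc]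
    rw [hk1, hk2, e, map_mul]
    group
  have hβc : ∀ p, extProj τ p ∈ W → ContMDiffAt 𝓘(ℂ, EP) 𝓘(ℂ, EM) ω β p := by
    intro p hp
    obtain ⟨a, b, rfl⟩ := extMk_surjective τ p
    have ha : cosetProj H a ∈ W := hp
    refine contMDiffAt_of_comp_extMk hQ ?_
    have h1 : ContMDiffAt (𝓘(ℂ, EG).prod 𝓘(ℂ, EM)) 𝓘(ℂ, EM) ω
        (fun u : G × M => τ (κ u.1) * u.2) (a, b) := by
      refine ContMDiffAt.mul ?_ contMDiffAt_snd
      exact ContMDiffAt.comp _ hτ.contMDiffAt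
        (ContMDiffAt.comp (a, b) (hκc a ha) contMDiffAt_fst)
    refine h1.congr_of_eventuallyEq ?_
    have h2 : ∀ᶠ u : G × M in 𝓝 (a, b), cosetProj H u.1 ∈ W :=
      (hX.contMDiff.continuous.comp continuous_fst).continuousAt.eventually (hW.mem_nhds ha)
    filter_upwards [h2] with u hu
    exact hβ u.1 u.2 hu
  have hpo : IsOpen (extProj τ ⁻¹' W) := hW.preimage hproj.continuous
  have hf : ContMDiffOn 𝓘(ℂ, EP) (𝓘(ℂ, EX).prod 𝓘(ℂ, EM)) ω
      (fun p => (extProj τ p, β p)) (extProj τ ⁻¹' W) :=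
    hproj.contMDiffOn.prodMk fun p hp => (hβc p hp).contMDiffWithinAt
  have hg : ContMDiffOn (𝓘(ℂ, EX).prod 𝓘(ℂ, EM)) 𝓘(ℂ, EP) ω
      (fun q : (G ⧸ H) × M => extMk τ (s q.1, q.2)) (W ×ˢ Set.univ) :=
    hQ.contMDiff.comp_contMDiffOn ((hs.comp contMDiff_fst.contMDiffOn fun q hq => hq.1).prodMk
      contMDiff_snd.contMDiffOn)
  refine ⟨W, ⟨⟨⟨fun p => (extProj τ p, β p), fun q => extMk τ (s q.1, q.2), extProj τ ⁻¹' W,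
    W ×ˢ Set.univ, fun b hb => ⟨hb, trivial⟩, ?_, ?_, ?_⟩, hf.continuousOn, hg.continuousOn⟩,
    hpo, hW.prod isOpen_univ⟩, hW, haW, rfl, rfl, hf, hg, ?_⟩
  · rintro ⟨x, m⟩ ⟨hx, -⟩
    change cosetProj H (s x) ∈ W
    rw [hsW x hx]
    exact hx
  · intro p hp
    obtain ⟨a, b, rfl⟩ := extMk_surjective τ p
    have ha : cosetProj H a ∈ W := hp
    change extMk τ (s (cosetProj H a), β (extMk τ (a, b))) = extMk τ (a, b)
    rw [hβ a b ha, ← extMk_mul, hκ2 a ha]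
  · rintro ⟨x, m⟩ ⟨hx, -⟩
    have hx' : cosetProj H (s x) = x := hsW x hx
    refine Prod.ext hx' ?_
    change β (extMk τ (s x, m)) = m
    have e : κ (s x) = 1 := by
      apply Subtype.ext
      rw [hκ _ (hmem _ (by rw [hx']; exact hx)), hx', inv_mul_cancel]
      rfl
    rw [hβ _ _ (by rw [hx']; exact hx), e, map_one, one_mul]
  · intro p hp
    refine ⟨rfl, fun k => ?_⟩
    obtain ⟨a, b, rfl⟩ := extMk_surjective τ p
    have ha : cosetProj H a ∈ W := hp
    change β (extMk τ (a, b * k)) = β (extMk τ (a, b)) * k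
    rw [hβ a _ ha, hβ a _ ha, mul_assoc]

end Ext

/-! ### The Atiyah sequence of `G^τ`. -/

section AtiyahExt

open scoped Topology
open Filter

variable {EG G EH EX EM M EP : Type*}
  [NormedAddCommGroup EG] [NormedSpace ℂ EG] [TopologicalSpace G] [ChartedSpace EG G] [Group G]
  [LieGroup 𝓘(ℂ, EG) ω G]
  {H : Subgroup G} [NormedAddCommGroup EH] [NormedSpace ℂ EH] [ChartedSpace EH H]
  [NormedAddCommGroup EM] [NormedSpace ℂ EM] [TopologicalSpace M] [ChartedSpace EM M] [Group M]
  [LieGroup 𝓘(ℂ, EM) ω M] {τ : H →* M}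
  [NormedAddCommGroup EP] [NormedSpace ℂ EP] [ChartedSpace EP (ExtBundle τ)]
  [FiniteDimensional ℂ EP] [IsManifold 𝓘(ℂ, EP) ω (ExtBundle τ)]
  [NormedAddCommGroup EX] [NormedSpace ℂ EX] [ChartedSpace EX (G ⧸ H)]
  [LieGroup 𝓘(ℂ, EH) ω H] [IsManifold 𝓘(ℂ, EX) ω (G ⧸ H)] [FiniteDimensional ℂ EX]
  [FiniteDimensional ℂ EG] [FiniteDimensional ℂ EH]

theorem tderiv_extProj_twistedDeriv (hH : IsHolSubgroup EG EH H)
    (hX : IsHolSubmersion (EB := EX) 𝓘(ℂ, EG) (cosetProj H))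
    (hτ : ContMDiff 𝓘(ℂ, EH) 𝓘(ℂ, EM) ω τ)
    (hQ : IsHolSubmersion (EB := EP) (𝓘(ℂ, EG).prod 𝓘(ℂ, EM)) (extMk τ)) (a : G) (b : M)
    (v : GroupLieAlgebra 𝓘(ℂ, EG) G × GroupLieAlgebra 𝓘(ℂ, EM) M) :
    tderiv 𝓘(ℂ, EP) 𝓘(ℂ, EX) (extProj τ) (extMk τ (a, b)) (twistedDeriv EG EM EP τ a b v) =
      cosetDeriv EG EX H a v.1 := by
  have h1 := ContMDiffAt.tderiv_comp (a := ((1, 1) : G × M))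
    (isPrincipalBundle_ext hH hX hτ hQ).contMDiff_proj.contMDiffAt
    (contMDiff_extMk_mul hQ a b).contMDiffAt v
  simp only [mul_one, one_mul] at h1
  have h2 := ContMDiffAt.tderiv_prod (E₁ := EG) (E₂ := EM)
    (f := fun q : G × M => cosetProj H (a * q.1)) (p := (1, 1)) ((contMDiff_cosetProj_mul hX a).comp
      (contMDiff_fst (I := 𝓘(ℂ, EG)) (J := 𝓘(ℂ, EM)) (N := M))).contMDiffAt v
  simp only [tderiv_const] at h2
  exact h1.symm.trans (h2.trans (add_zero _))

/-- Right multiplication by `m` sends `[ax, yb]` to `[ax, y(bm)]`: trivialising `M` by right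
translations leaves `(ξ, η)` unchanged. -/
theorem tderiv_extAct_twistedDeriv (hH : IsHolSubgroup EG EH H)
    (hX : IsHolSubmersion (EB := EX) 𝓘(ℂ, EG) (cosetProj H))
    (hτ : ContMDiff 𝓘(ℂ, EH) 𝓘(ℂ, EM) ω τ)
    (hQ : IsHolSubmersion (EB := EP) (𝓘(ℂ, EG).prod 𝓘(ℂ, EM)) (extMk τ)) (a : G) (b m : M)
    (v : GroupLieAlgebra 𝓘(ℂ, EG) G × GroupLieAlgebra 𝓘(ℂ, EM) M) :
    tderiv 𝓘(ℂ, EP) 𝓘(ℂ, EP) (fun p => extAct τ p m) (extMk τ (a, b))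
      (twistedDeriv EG EM EP τ a b v) = twistedDeriv EG EM EP τ a (b * m) v := by
  have h1 := ContMDiffAt.tderiv_comp (a := ((1, 1) : G × M))
    ((isPrincipalBundle_ext hH hX hτ hQ).contMDiff_act_right m).contMDiffAt
    (contMDiff_extMk_mul hQ a b).contMDiffAt v
  simp only [mul_one, one_mul, extAct_extMk, mul_assoc] at h1
  exact h1.symm

/-- Derivative of `[a, b] · b⁻¹yb = [a, yb]` at `y = 1`; this is where `Ad_{b⁻¹}` enters. -/
theorem tderiv_extAct_orbit (hH : IsHolSubgroup EG EH H)
    (hX : IsHolSubmersion (EB := EX) 𝓘(ℂ, EG) (cosetProj H))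
    (hτ : ContMDiff 𝓘(ℂ, EH) 𝓘(ℂ, EM) ω τ)
    (hQ : IsHolSubmersion (EB := EP) (𝓘(ℂ, EG).prod 𝓘(ℂ, EM)) (extMk τ)) (a : G) (b : M)
    (η : GroupLieAlgebra 𝓘(ℂ, EM) M) :
    tderiv 𝓘(ℂ, EM) 𝓘(ℂ, EP) (fun m => extAct τ (extMk τ (a, b)) m) 1 (adRep EM M b⁻¹ η) =
      twistedDeriv EG EM EP τ a b (0, η) := by
  refine (tderiv_conj ((isPrincipalBundle_ext hH hX hτ hQ).contMDiff_orbit _) b⁻¹ η).trans ?_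
  refine Eq.trans ?_ (twistedDeriv_eq_add hQ a b (0, η)).symm
  simp only [extAct_extMk, mul_assoc, inv_inv, mul_inv_cancel_left]
  exact (zero_add _).symm.trans (congrArg₂ (fun v w : EP => v + w)
    (map_zero (tderiv 𝓘(ℂ, EG) 𝓘(ℂ, EP) (fun x : G => extMk τ (a * x, b)) 1)).symm rfl)

/-- Projecting to `X` puts the first component in `𝔥`. Subtracting the corresponding `(ξ, -dτ ξ)`
leaves a vector `(0, η)`, whose image is tangent to an `M`-orbit; injectivity of the orbit
differential gives `Ad_{b⁻¹} η = 0`, so `η = 0`. -/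
theorem mem_range_twistedIncl_of_twistedDeriv_eq_zero (hH : IsHolSubgroup EG EH H)
    (hX : IsHolSubmersion (EB := EX) 𝓘(ℂ, EG) (cosetProj H))
    (hτ : ContMDiff 𝓘(ℂ, EH) 𝓘(ℂ, EM) ω τ)
    (hQ : IsHolSubmersion (EB := EP) (𝓘(ℂ, EG).prod 𝓘(ℂ, EM)) (extMk τ)) (a : G) (b : M)
    (v : GroupLieAlgebra 𝓘(ℂ, EG) G × GroupLieAlgebra 𝓘(ℂ, EM) M)
    (hv : twistedDeriv EG EM EP τ a b v = 0) :
    v ∈ LinearMap.range (twistedIncl EG EH EM τ) := by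
  have h1 : cosetDeriv EG EX H a v.1 = 0 := by
    rw [← tderiv_extProj_twistedDeriv hH hX hτ hQ a b v, hv, map_zero]
  obtain ⟨ξ, hξ⟩ := mem_range_lieIncl_of_tderiv_coset_eq_zero hH hX a v.1 h1
  set w := v - twistedIncl EG EH EM τ ξ with hw
  have hw0 : twistedDeriv EG EM EP τ a b w = 0 := by
    rw [hw, map_sub, hv, range_twistedIncl_le_ker_twistedDeriv hH hτ hQ a b ⟨ξ, rfl⟩, sub_zero]
  have hw1 : w = (0, w.2) := by
    refine Prod.ext ?_ rfl
    change v.1 - lieIncl EG EH H ξ = 0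
    exact sub_eq_zero.2 hξ.symm
  have h2 := tderiv_extAct_orbit hH hX hτ hQ a b w.2
  rw [← hw1, hw0] at h2
  have h3 := (isPrincipalBundle_ext hH hX hτ hQ).tderiv_orbit_injective _ h2
  have h4 : w.2 = 0 := by
    have h5 : adRep EM M b (adRep EM M b⁻¹ w.2) = w.2 := by
      rw [← Module.End.mul_apply, ← map_mul, mul_inv_cancel, map_one]
      rfl
    rw [← h5]
    exact (congrArg (adRep EM M b) h3).trans (map_zero _)
  refine ⟨ξ, (sub_eq_zero.1 ?_).symm⟩
  rw [← hw, hw1, h4]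
  rfl

/-- The identification of `(𝔤 ⊕ 𝔪)/𝔥` with the tangent space of the extension at `[a, b]`, by
`(ξ, η) ↦ dρ (dL_a ξ, dR_b η)`. -/
def twistedEquiv (hH : IsHolSubgroup EG EH H)
    (hX : IsHolSubmersion (EB := EX) 𝓘(ℂ, EG) (cosetProj H))
    (hτ : ContMDiff 𝓘(ℂ, EH) 𝓘(ℂ, EM) ω τ)
    (hQ : IsHolSubmersion (EB := EP) (𝓘(ℂ, EG).prod 𝓘(ℂ, EM)) (extMk τ)) (a : G) (b : M) :
    ((GroupLieAlgebra 𝓘(ℂ, EG) G × GroupLieAlgebra 𝓘(ℂ, EM) M) ⧸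
      LinearMap.range (twistedIncl EG EH EM τ)) ≃ₗ[ℂ] EP :=
  LinearEquiv.ofBijective
    ((LinearMap.range (twistedIncl EG EH EM τ)).liftQ (twistedDeriv EG EM EP τ a b)
      (range_twistedIncl_le_ker_twistedDeriv hH hτ hQ a b)) (by
    constructor
    · rw [injective_iff_map_eq_zero]
      intro q hq
      obtain ⟨v, rfl⟩ := Submodule.mkQ_surjective _ q
      exact (Submodule.Quotient.mk_eq_zero _).2
        (mem_range_twistedIncl_of_twistedDeriv_eq_zero hH hX hτ hQ a b v hq)
    · intro w
      obtain ⟨v, hv⟩ := twistedDeriv_surjective hQ a b w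
      exact ⟨Submodule.Quotient.mk v, hv⟩)

/-- Since `[ah, b] = [a, 1] · τ(h)b`, the change of representative by `H` and the action of `M` have
to be compared together. -/
theorem twistedEquiv_mul (hH : IsHolSubgroup EG EH H)
    (hX : IsHolSubmersion (EB := EX) 𝓘(ℂ, EG) (cosetProj H))
    (hτ : ContMDiff 𝓘(ℂ, EH) 𝓘(ℂ, EM) ω τ)
    (hQ : IsHolSubmersion (EB := EP) (𝓘(ℂ, EG).prod 𝓘(ℂ, EM)) (extMk τ)) (a : G) (b : M) (h : H)
    (q : (GroupLieAlgebra 𝓘(ℂ, EG) G × GroupLieAlgebra 𝓘(ℂ, EM) M) ⧸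
      LinearMap.range (twistedIncl EG EH EM τ)) :
    twistedEquiv hH hX hτ hQ (a * h) b (twistedRep hH hτ h⁻¹ q) =
      tderiv 𝓘(ℂ, EP) 𝓘(ℂ, EP) (fun p => extAct τ p (τ h * b)) (extMk τ (a, 1))
        (twistedEquiv hH hX hτ hQ a 1 q) := by
  obtain ⟨v, rfl⟩ := Submodule.mkQ_surjective _ q
  have h1 := tderiv_extAct_twistedDeriv hH hX hτ hQ a 1 (τ h * b) v
  rw [one_mul] at h1
  refine Eq.trans ?_ h1.symm
  refine Eq.trans ?_ (twistedDeriv_mul_adRep hQ a b h v)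
  change twistedDeriv EG EM EP τ (a * h) b (adRep EG G (h⁻¹ : H) v.1, adRep EM M (τ h⁻¹) v.2) = _
  rw [map_inv]
  rfl

/-- The identification of `G ×^H 𝔪` with the adjoint bundle of the extension on fibres. -/
def extAdjointEquiv (hH : IsHolSubgroup EG EH H)
    (hX : IsHolSubmersion (EB := EX) 𝓘(ℂ, EG) (cosetProj H))
    (hτ : ContMDiff 𝓘(ℂ, EH) 𝓘(ℂ, EM) ω τ)
    (hQ : IsHolSubmersion (EB := EP) (𝓘(ℂ, EG).prod 𝓘(ℂ, EM)) (extMk τ)) (x : G ⧸ H) :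
    assocFiber (cosetProj H) (cosetAct H) (adPull EM τ) x ≃ₗ[ℂ]
      assocFiber (extProj τ) (extAct τ) (adRep EM M) x :=
  ((isPrincipalBundle_coset hH hX).assocEval (adPull EM τ) x ⟨x.out, cosetProj_out x⟩).trans
    ((isPrincipalBundle_ext hH hX hτ hQ).assocEval (adRep EM M) x
      ⟨extMk τ (x.out, 1), cosetProj_out x⟩).symm

theorem extAdjointEquiv_apply (hH : IsHolSubgroup EG EH H)
    (hX : IsHolSubmersion (EB := EX) 𝓘(ℂ, EG) (cosetProj H))
    (hτ : ContMDiff 𝓘(ℂ, EH) 𝓘(ℂ, EM) ω τ)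
    (hQ : IsHolSubmersion (EB := EP) (𝓘(ℂ, EG).prod 𝓘(ℂ, EM)) (extMk τ)) (x : G ⧸ H)
    (f : assocFiber (cosetProj H) (cosetAct H) (adPull EM τ) x) (a : G) (ha : cosetProj H a = x)
    (b : M) :
    (extAdjointEquiv hH hX hτ hQ x f).1 ⟨extMk τ (a, b), ha⟩ = adRep EM M b⁻¹ (f.1 ⟨a, ha⟩) := by
  have hP := isPrincipalBundle_ext hH hX hτ hQ
  obtain ⟨h, rfl⟩ := (isPrincipalBundle_coset hH hX).exists_act_eq x.out a
    ((cosetProj_out x).trans ha.symm)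
  have h0 : (extAdjointEquiv hH hX hτ hQ x f).1 ⟨extMk τ (x.out, 1), cosetProj_out x⟩ =
      f.1 ⟨x.out, cosetProj_out x⟩ :=
    (hP.assocEval (adRep EM M) x ⟨extMk τ (x.out, 1), cosetProj_out x⟩).apply_symm_apply _
  have h1 := f.2 ⟨x.out, cosetProj_out x⟩ ⟨_, ha⟩ h rfl
  -- The reference point `[x.out, 1]` reaches `[x.out h, b]` by the action of `τ(h)b`; its factor
  -- `τ(h)` is absorbed by the equivariance of `f`, leaving `Ad_{b⁻¹}`.
  have h2 := (extAdjointEquiv hH hX hτ hQ x f).2 ⟨extMk τ (x.out, 1), cosetProj_out x⟩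
    ⟨extMk τ (x.out * h, b), ha⟩ (τ h * b) (extMk_mul_eq_extAct τ x.out h b)
  refine h2.trans ?_
  rw [h0, h1, mul_inv_rev, map_mul, ← map_inv]
  rfl

/-- The identification of `G ×^H (𝔤 ⊕ 𝔪)/𝔥` with the Atiyah bundle of the extension on fibres. -/
def extAtiyahEquiv (hH : IsHolSubgroup EG EH H)
    (hX : IsHolSubmersion (EB := EX) 𝓘(ℂ, EG) (cosetProj H))
    (hτ : ContMDiff 𝓘(ℂ, EH) 𝓘(ℂ, EM) ω τ)
    (hQ : IsHolSubmersion (EB := EP) (𝓘(ℂ, EG).prod 𝓘(ℂ, EM)) (extMk τ)) (x : G ⧸ H) :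
    assocFiber (cosetProj H) (cosetAct H) (twistedRep hH hτ) x ≃ₗ[ℂ]
      atiyahFiber EP (extProj τ) (extAct τ) x :=
  (((isPrincipalBundle_coset hH hX).assocEval (twistedRep hH hτ) x
    ⟨x.out, cosetProj_out x⟩).trans (twistedEquiv hH hX hτ hQ x.out 1)).trans
    ((isPrincipalBundle_ext hH hX hτ hQ).atiyahEval x
      ⟨extMk τ (x.out, 1), cosetProj_out x⟩).symm

theorem extAtiyahEquiv_apply (hH : IsHolSubgroup EG EH H)
    (hX : IsHolSubmersion (EB := EX) 𝓘(ℂ, EG) (cosetProj H))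
    (hτ : ContMDiff 𝓘(ℂ, EH) 𝓘(ℂ, EM) ω τ)
    (hQ : IsHolSubmersion (EB := EP) (𝓘(ℂ, EG).prod 𝓘(ℂ, EM)) (extMk τ)) (x : G ⧸ H)
    (f : assocFiber (cosetProj H) (cosetAct H) (twistedRep hH hτ) x) (a : G)
    (ha : cosetProj H a = x) (b : M) :
    ((extAtiyahEquiv hH hX hτ hQ x f).1 ⟨extMk τ (a, b), ha⟩ : EP) =
      twistedEquiv hH hX hτ hQ a b (f.1 ⟨a, ha⟩) := by
  have hP := isPrincipalBundle_ext hH hX hτ hQ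
  obtain ⟨h, rfl⟩ := (isPrincipalBundle_coset hH hX).exists_act_eq x.out a
    ((cosetProj_out x).trans ha.symm)
  have h0 : ((extAtiyahEquiv hH hX hτ hQ x f).1 ⟨extMk τ (x.out, 1), cosetProj_out x⟩ : EP) =
      twistedEquiv hH hX hτ hQ x.out 1 (f.1 ⟨x.out, cosetProj_out x⟩) :=
    (hP.atiyahEval x ⟨extMk τ (x.out, 1), cosetProj_out x⟩).apply_symm_apply _
  have h1 := f.2 ⟨x.out, cosetProj_out x⟩ ⟨_, ha⟩ h rfl
  have h2 := (extAtiyahEquiv hH hX hτ hQ x f).2 ⟨extMk τ (x.out, 1), cosetProj_out x⟩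
    ⟨extMk τ (x.out * h, b), ha⟩ (τ h * b) (extMk_mul_eq_extAct τ x.out h b)
  refine h2.trans ((congrArg (tderiv 𝓘(ℂ, EP) 𝓘(ℂ, EP) (fun p => extAct τ p (τ h * b))
    (extMk τ (x.out, 1))) h0).trans ?_)
  rw [h1]
  exact (twistedEquiv_mul hH hX hτ hQ x.out b h _).symm

variable [FiniteDimensional ℂ EM]

/-- Forwards, holomorphy is tested on `G × M`, where the function is `Ad_{b⁻¹}` of the given one.
Backwards, restrict to the points `[a, 1]`. -/
theorem isIso_extAdjointEquiv (hH : IsHolSubgroup EG EH H)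
    (hX : IsHolSubmersion (EB := EX) 𝓘(ℂ, EG) (cosetProj H))
    (hτ : ContMDiff 𝓘(ℂ, EH) 𝓘(ℂ, EM) ω τ)
    (hQ : IsHolSubmersion (EB := EP) (𝓘(ℂ, EG).prod 𝓘(ℂ, EM)) (extMk τ)) :
    HolFamily.IsIso (assocBundle EG (cosetProj H) (cosetAct H) (adPull EM τ))
      (assocBundle EP (extProj τ) (extAct τ) (adRep EM M)) (extAdjointEquiv hH hX hτ hQ) := by
  have hV : FiniteDimensional ℂ (GroupLieAlgebra 𝓘(ℂ, EM) M) :=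
    inferInstanceAs (FiniteDimensional ℂ EM)
  have hcont := hX.contMDiff.continuous
  have hcont' := (isPrincipalBundle_ext hH hX hτ hQ).contMDiff_proj.continuous
  constructor
  · intro U hU (σ : ∀ x, assocFiber (cosetProj H) (cosetAct H) (adPull EM τ) x) hσ
    replace hσ := (assocBundle_isHolOn_iff hcont hU σ).1 hσ
    refine (assocBundle_isHolOn_iff hcont' hU _).2 ?_
    intro p hp ℓ
    obtain ⟨a, b, rfl⟩ := extMk_surjective τ p
    refine contMDiffAt_of_comp_extMk hQ ?_
    have h1 : ContMDiffAt (𝓘(ℂ, EG).prod 𝓘(ℂ, EM)) 𝓘(ℂ) ω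
        (fun u : G × M => ℓ (adRep EM M u.2⁻¹ (assocFun σ u.1))) (a, b) := by
      refine adRep_isHol.contMDiffAt contMDiffAt_snd.inv (fun ℓ => ?_) ℓ
      exact ContMDiffAt.comp (a, b) (g := fun x => ℓ (assocFun σ x)) (hσ a hp ℓ) contMDiffAt_fst
    refine h1.congr_of_eventuallyEq (Eventually.of_forall fun u => congrArg ℓ ?_)
    exact extAdjointEquiv_apply hH hX hτ hQ _ _ u.1 rfl u.2
  · intro U hU (F : ∀ x, assocFiber (extProj τ) (extAct τ) (adRep EM M) x) hF
    replace hF := (assocBundle_isHolOn_iff hcont' hU F).1 hF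
    refine (assocBundle_isHolOn_iff hcont hU _).2 ?_
    intro a ha ℓ
    have h1 : ContMDiffAt 𝓘(ℂ, EG) 𝓘(ℂ) ω (fun b => ℓ (assocFun F (extMk τ (b, 1)))) a :=
      ContMDiffAt.comp a (g := fun p => ℓ (assocFun F p)) (hF (extMk τ (a, 1)) ha ℓ)
        (hQ.contMDiff.comp (contMDiff_id.prodMk contMDiff_const)).contMDiffAt
    refine h1.congr_of_eventuallyEq (Eventually.of_forall fun b => congrArg ℓ ?_)
    have h2 := extAdjointEquiv_apply hH hX hτ hQ (cosetProj H b)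
      ((extAdjointEquiv hH hX hτ hQ (cosetProj H b)).symm (F _)) b rfl 1
    rw [LinearEquiv.apply_symm_apply, inv_one, map_one] at h2
    exact h2.symm

/-- The argument for `Θ_X` with a local section `t` of `ρ` in place of one of `π`, and the
translations `(x, y) ↦ (ax, yb)` of `G × M` in place of left translations. -/
theorem isIso_extAtiyahEquiv (hH : IsHolSubgroup EG EH H)
    (hX : IsHolSubmersion (EB := EX) 𝓘(ℂ, EG) (cosetProj H))
    (hτ : ContMDiff 𝓘(ℂ, EH) 𝓘(ℂ, EM) ω τ)
    (hQ : IsHolSubmersion (EB := EP) (𝓘(ℂ, EG).prod 𝓘(ℂ, EM)) (extMk τ)) :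
    HolFamily.IsIso (assocBundle EG (cosetProj H) (cosetAct H) (twistedRep hH hτ))
      (atiyahBundle (EP := EP) (extProj τ) (extAct τ)) (extAtiyahEquiv hH hX hτ hQ) := by
  have hV : FiniteDimensional ℂ (GroupLieAlgebra 𝓘(ℂ, EG) G) :=
    inferInstanceAs (FiniteDimensional ℂ EG)
  have hV' : FiniteDimensional ℂ (GroupLieAlgebra 𝓘(ℂ, EM) M) :=
    inferInstanceAs (FiniteDimensional ℂ EM)
  have hcont := hX.contMDiff.continuous
  have hcont' := (isPrincipalBundle_ext hH hX hτ hQ).contMDiff_proj.continuous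
  let N := LinearMap.range (twistedIncl EG EH EM τ)
  constructor
  · intro U hU (σ : ∀ x, assocFiber (cosetProj H) (cosetAct H) (twistedRep hH hτ) x) hσ
    replace hσ := (assocBundle_isHolOn_iff hcont hU σ).1 hσ
    refine (atiyahBundle_isHolOn_iff hcont' hU _).2 ?_
    intro p hp
    obtain ⟨L, hL⟩ := N.mkQ.exists_rightInverse_of_surjective N.range_mkQ
    obtain ⟨a, b, rfl⟩ := extMk_surjective τ p
    obtain ⟨t, W, hW, hpW, ht, hta, htW⟩ := exists_ext_section hQ (a, b)
    have htc := ht.contMDiffAt (hW.mem_nhds hpW)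
    let D : (GroupLieAlgebra 𝓘(ℂ, EG) G × GroupLieAlgebra 𝓘(ℂ, EM) M) ≃ₗ[ℂ] EG × EM :=
      (lieAlgebraModel EG G).prodCongr (lieAlgebraModel EM M)
    have h1 : ContMDiffAt 𝓘(ℂ, EP) 𝓘(ℂ, EG × EM) ω
        (fun p => D (L (assocFun σ (t p).1))) (extMk τ (a, b)) := by
      refine contMDiffAt_linearMap_of_forall_dual (D.toLinearMap ∘ₗ L) fun ℓ => ?_
      refine ContMDiffAt.comp _ (g := fun c => ℓ (assocFun σ c)) ?_ (contMDiffAt_fst.comp _ htc)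
      rw [hta]
      exact hσ a hp ℓ
    have hΨ : ContMDiff ((𝓘(ℂ, EG).prod 𝓘(ℂ, EM)).prod (𝓘(ℂ, EG).prod 𝓘(ℂ, EM))) 𝓘(ℂ, EP) ω
        (fun w : (G × M) × (G × M) => extMk τ (w.1.1 * w.2.1, w.2.2 * w.1.2)) :=
      hQ.contMDiff.comp (((contMDiff_fst.comp contMDiff_fst).mul
        (contMDiff_fst.comp contMDiff_snd)).prodMk ((contMDiff_snd.comp contMDiff_snd).mul
        (contMDiff_snd.comp contMDiff_fst)))
    refine (IsHolFieldAt.map_param hΨ htc ((isHolFieldAt_const_iff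
      (I₁ := 𝓘(ℂ, EG).prod 𝓘(ℂ, EM)) (a := ((1, 1) : G × M))).2 h1)).congr ?_ ?_
    · filter_upwards [hW.mem_nhds hpW] with q hq
      rw [mul_one, one_mul]
      exact (htW q hq).symm
    · filter_upwards [hW.mem_nhds hpW] with q hq
      have hq' : cosetProj H (t q).1 = extProj τ q :=
        (extProj_extMk τ (t q)).symm.trans (congrArg (extProj τ) (htW q hq))
      have h2 : ∀ (r : ExtBundle τ) (hr : extProj τ r = extProj τ q), r = q →
          (((extAtiyahEquiv hH hX hτ hQ (extProj τ q)) (σ (extProj τ q))).1 ⟨q, rfl⟩ : EP) =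
          ((extAtiyahEquiv hH hX hτ hQ (extProj τ q)) (σ (extProj τ q))).1 ⟨r, hr⟩ := by
        rintro r hr rfl
        rfl
      refine (h2 (extMk τ (t q)) hq' (htW q hq)).trans ?_
      refine (extAtiyahEquiv_apply hH hX hτ hQ _ _ (t q).1 hq' (t q).2).trans ?_
      rw [← assocFun_eq]
      conv_lhs => rw [← LinearMap.id_apply (R := ℂ) (assocFun σ (t q).1), ← hL]
      rfl
  · intro U hU (v : ∀ x, atiyahFiber EP (extProj τ) (extAct τ) x) hv
    replace hv := (atiyahBundle_isHolOn_iff hcont' hU v).1 hv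
    refine (assocBundle_isHolOn_iff hcont hU _).2 ?_
    intro a ha ℓ
    obtain ⟨t, W, hW, hpW, ht, hta, htW⟩ := exists_ext_section hQ (a, 1)
    have hj : ContMDiff 𝓘(ℂ, EG) 𝓘(ℂ, EP) ω fun c : G => extMk τ (c, 1) :=
      hQ.contMDiff.comp (contMDiff_id.prodMk contMDiff_const)
    have hTc : ContMDiffAt 𝓘(ℂ, EG) (𝓘(ℂ, EG).prod 𝓘(ℂ, EM)) ω
        (fun c : G => t (extMk τ (c, 1))) a :=
      ContMDiffAt.comp a (ht.contMDiffAt (hW.mem_nhds hpW)) hj.contMDiffAt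
    have hev : ∀ᶠ c in 𝓝 a, extMk τ (c, 1) ∈ W :=
      hj.continuous.continuousAt.eventually (hW.mem_nhds hpW)
    have hcp : ∀ c, extMk τ (c, 1) ∈ W → cosetProj H (t (extMk τ (c, 1))).1 = cosetProj H c :=
      fun c hc => congrArg (extProj τ) (htW _ hc)
    set σ : ∀ x, assocFiber (cosetProj H) (cosetAct H) (twistedRep hH hτ) x :=
      fun x => (extAtiyahEquiv hH hX hτ hQ x).symm (v x) with hσ
    have hρ : (twistedRep hH hτ).IsHol EH :=
      ((adRep_isHol.comp hH.contMDiff).prod (adRep_isHol.comp hτ)).quotient _ _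
    -- Lifting the field at `[c, 1]` by `t` gives the value at the first component of `t [c, 1]`,
    -- which may differ from `c` but has the same coset.
    refine contMDiffAt_assocFun_of_comp hH hρ σ (g := fun c => (t (extMk τ (c, 1))).1)
      (contMDiffAt_fst.comp a hTc) (hev.mono hcp) ?_ ℓ
    intro ℓ
    have hΨ : ContMDiff ((𝓘(ℂ, EG).prod 𝓘(ℂ, EM)).prod (𝓘(ℂ, EG).prod 𝓘(ℂ, EM)))
        (𝓘(ℂ, EG).prod 𝓘(ℂ, EM)) ω
        (fun w : (G × M) × (G × M) => (w.1.1⁻¹ * w.2.1, w.2.2 * w.1.2⁻¹)) :=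
      (((contMDiff_fst.comp contMDiff_fst).inv.mul
        (contMDiff_fst.comp contMDiff_snd)).prodMk ((contMDiff_snd.comp contMDiff_snd).mul
        (contMDiff_snd.comp contMDiff_fst).inv))
    have h0 : IsHolFieldAt 𝓘(ℂ, EG) 𝓘(ℂ, EP) (fun c : G => extMk τ (c, 1))
        (fun c => atiyahField v (extMk τ (c, 1))) a :=
      IsHolFieldAt.comp (s := fun c : G => extMk τ (c, 1)) (hv (extMk τ (a, 1)) ha) hj.contMDiffAt
    have h1 := IsHolFieldAt.map_param hΨ hTc (h0.map (ht.contMDiffAt (hW.mem_nhds hpW)))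
    have h2 := (isHolFieldAt_const_iff (I₁ := 𝓘(ℂ, EG).prod 𝓘(ℂ, EM)) (a := ((1, 1) : G × M))).1
      (h1.congr (Eventually.of_forall fun z => by simp) (Eventually.of_forall fun z => rfl))
    refine (contMDiffAt_clm_apply (LinearMap.toContinuousLinearMap (E := EG × EM) (F' := ℂ)
      (ℓ ∘ₗ N.mkQ)) h2).congr_of_eventuallyEq ?_
    filter_upwards [hev] with c hc
    refine congrArg ℓ ?_
    rw [assocFun_eq σ (hcp c hc)]
    apply (twistedEquiv hH hX hτ hQ (t (extMk τ (c, 1))).1 (t (extMk τ (c, 1))).2).injective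
    rw [← extAtiyahEquiv_apply hH hX hτ hQ, hσ, LinearEquiv.apply_symm_apply]
    have h3 : ∀ (r : ExtBundle τ) (hr : extProj τ r = cosetProj H c), r = extMk τ (c, 1) →
        ((v (cosetProj H c)).1 ⟨r, hr⟩ : EP) = atiyahField v (extMk τ (c, 1)) := by
      rintro r hr rfl
      rfl
    refine (h3 (extMk τ (t (extMk τ (c, 1)))) (hcp c hc) (htW _ hc)).trans ?_
    set p := extMk τ (c, 1)
    -- Translating `dt(v)` to `(1, 1)` and back is the identity, so the class found maps to
    -- `dρ(dt(v)) = v`.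
    have h4 := ContMDiffAt.tderiv_comp (f := fun w : G × M => ((t p).1⁻¹ * w.1, w.2 * (t p).2⁻¹))
      (a := t p) (contMDiff_extMk_mul hQ (t p).1 (t p).2).contMDiffAt
      ((contMDiff_const.mul contMDiff_fst).prodMk
        (contMDiff_snd.mul contMDiff_const)).contMDiffAt
      (tderiv 𝓘(ℂ, EP) (𝓘(ℂ, EG).prod 𝓘(ℂ, EM)) t p (atiyahField v p))
    simp only [mul_inv_cancel_left, inv_mul_cancel_right, inv_mul_cancel, mul_inv_cancel] at h4
    refine Eq.trans ?_ h4
    have h5 := ContMDiffAt.tderiv_comp (hQ.contMDiff (t p)) (ht.contMDiffAt (hW.mem_nhds hc))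
      (atiyahField v p)
    refine Eq.trans ?_ h5
    have e : (fun x => extMk τ (t x)) =ᶠ[𝓝 p] fun x => x := by
      filter_upwards [hW.mem_nhds hc] with z hz
      exact htW z hz
    rw [tderiv_congr e, tderiv_id]
    rfl

/-- The Atiyah sequence of the extension of structure group of `G → G/H` is the sequence associated
to `0 → 𝔪 → (𝔤 ⊕ 𝔪)/𝔥 → 𝔤/𝔥 → 0`. -/
def extAtiyahIso (hH : IsHolSubgroup EG EH H)
    (hX : IsHolSubmersion (EB := EX) 𝓘(ℂ, EG) (cosetProj H))
    (hτ : ContMDiff 𝓘(ℂ, EH) 𝓘(ℂ, EM) ω τ)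
    (hQ : IsHolSubmersion (EB := EP) (𝓘(ℂ, EG).prod 𝓘(ℂ, EM)) (extMk τ)) :
    HolSeq.Iso (assocSeq EG (cosetProj H) (cosetAct H) (twistedInc hH hτ) (twistedProj hH hτ))
      (atiyahSeq (isPrincipalBundle_ext hH hX hτ hQ)) where
  left := extAdjointEquiv hH hX hτ hQ
  mid := extAtiyahEquiv hH hX hτ hQ
  right x := cosetTangentEquiv hH hX x
  left_iso := isIso_extAdjointEquiv hH hX hτ hQ
  mid_iso := isIso_extAtiyahEquiv hH hX hτ hQ
  right_iso := isIso_cosetTangentEquiv hH hX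
  comm_inc x f := by
    refine Subtype.ext (funext ?_)
    rintro ⟨p, hp⟩
    obtain ⟨a, b, rfl⟩ := extMk_surjective τ p
    refine (extAtiyahEquiv_apply hH hX hτ hQ x _ a hp b).trans ?_
    refine (tderiv_extAct_orbit hH hX hτ hQ a b (f.1 ⟨a, hp⟩)).symm.trans ?_
    exact congrArg (tderiv 𝓘(ℂ, EM) 𝓘(ℂ, EP) (fun m => extAct τ (extMk τ (a, b)) m) 1)
      (extAdjointEquiv_apply hH hX hτ hQ x f a hp b).symm
  comm_proj x f := by
    refine (cosetTangentEquiv_apply hH hX x _ ⟨x.out, cosetProj_out x⟩).trans ?_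
    refine Eq.trans ?_ (atiyahProj_eq (isPrincipalBundle_ext hH hX hτ hQ) x
      (extAtiyahEquiv hH hX hτ hQ x f) ⟨extMk τ (x.out, 1), cosetProj_out x⟩).symm
    refine Eq.trans ?_ (congrArg (tderiv 𝓘(ℂ, EP) 𝓘(ℂ, EX) (extProj τ) (extMk τ (x.out, 1)))
      (extAtiyahEquiv_apply hH hX hτ hQ x f x.out (cosetProj_out x) 1)).symm
    change cosetEquiv hH hX x.out (twistedProj hH hτ (f.1 ⟨x.out, cosetProj_out x⟩)) = _
    obtain ⟨v, hv⟩ := Submodule.mkQ_surjective _ (f.1 ⟨x.out, cosetProj_out x⟩)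
    rw [← hv]
    exact (tderiv_extProj_twistedDeriv hH hX hτ hQ x.out 1 v).symm

/-- If `(0, η) = (ξ, -dτ ξ)` then `ξ = 0`, because `H → G` is an immersion, and so `η = 0`; this is
injectivity. -/
theorem isShortExact_ext_assocSeq (hH : IsHolSubgroup EG EH H)
    (hX : IsHolSubmersion (EB := EX) 𝓘(ℂ, EG) (cosetProj H))
    (hτ : ContMDiff 𝓘(ℂ, EH) 𝓘(ℂ, EM) ω τ) :
    (assocSeq EG (cosetProj H) (cosetAct H)
      (twistedInc hH hτ) (twistedProj hH hτ)).IsShortExact (EX := EX) := by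
  have hV : FiniteDimensional ℂ (GroupLieAlgebra 𝓘(ℂ, EG) G) :=
    inferInstanceAs (FiniteDimensional ℂ EG)
  have hV' : FiniteDimensional ℂ (GroupLieAlgebra 𝓘(ℂ, EM) M) :=
    inferInstanceAs (FiniteDimensional ℂ EM)
  have hG : (adRestrict EG H).IsHol EH := adRep_isHol.comp hH.contMDiff
  have hM : (adPull EM τ).IsHol EH := adRep_isHol.comp hτ
  refine (isPrincipalBundle_coset hH hX).isShortExact_assocSeq hM
    ((hG.prod hM).quotient _ _) (hG.quotient _ _) _ _ ?_ ?_ ?_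
  · refine (injective_iff_map_eq_zero (twistedInc hH hτ).toLinearMap).2 ?_
    intro η hη
    obtain ⟨ξ, hξ⟩ := (Submodule.Quotient.mk_eq_zero _).1 hη
    have h1 : lieIncl EG EH H ξ = 0 := congrArg Prod.fst hξ
    have h2 : -lieMap (EK := EH) (EG := EM) τ ξ = η := congrArg Prod.snd hξ
    have h3 : ξ = 0 := hH.injective 1 (h1.trans (map_zero (lieIncl EG EH H)).symm)
    rw [← h2, h3, map_zero, neg_zero]
  · intro q
    obtain ⟨v, rfl⟩ := Submodule.mkQ_surjective _ q
    constructor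
    · intro hv
      obtain ⟨ξ, hξ⟩ := (Submodule.Quotient.mk_eq_zero (LinearMap.range (lieIncl EG EH H))).1 hv
      -- When `v.1` is the image of `ξ`, subtracting `(ξ, -dτ ξ)` from `v` leaves `(0, v.2 + dτ ξ)`.
      refine ⟨v.2 + lieMap (EK := EH) (EG := EM) τ ξ, ?_⟩
      refine (Submodule.Quotient.eq _).2 ⟨-ξ, ?_⟩
      rw [map_neg]
      refine Prod.ext ?_ ?_
      · change -lieIncl EG EH H ξ = 0 - v.1
        rw [hξ, zero_sub]
        rfl
      · change -(-lieMap (EK := EH) (EG := EM) τ ξ) =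
          v.2 + lieMap (EK := EH) (EG := EM) τ ξ - v.2
        rw [neg_neg, add_sub_cancel_left]
    · rintro ⟨η, hη⟩
      rw [← hη]
      exact map_zero (LinearMap.range (lieIncl EG EH H)).mkQ
  · intro q
    obtain ⟨ξ, rfl⟩ := Submodule.mkQ_surjective _ q
    exact ⟨Submodule.Quotient.mk (ξ, 0), rfl⟩

end AtiyahExt

end

theorem lemma4p1
    {EG G EH EX : Type*}
    [NormedAddCommGroup EG] [NormedSpace ℂ EG] [FiniteDimensional ℂ EG]
    [TopologicalSpace G] [ChartedSpace EG G] [Group G] [LieGroup 𝓘(ℂ, EG) ω G]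
    -- a closed complex Lie subgroup `H` of `G`
    (H : Subgroup G) (hHclosed : IsClosed (H : Set G))
    [NormedAddCommGroup EH] [NormedSpace ℂ EH] [FiniteDimensional ℂ EH]
    [ChartedSpace EH H] [LieGroup 𝓘(ℂ, EH) ω H] (hH : IsHolSubgroup EG EH H)
    -- the complex structure of `X = G/H`
    [NormedAddCommGroup EX] [NormedSpace ℂ EX] [FiniteDimensional ℂ EX]
    [ChartedSpace EX (G ⧸ H)] [IsManifold 𝓘(ℂ, EX) ω (G ⧸ H)]
    (hX : IsHolSubmersion (EB := EX) 𝓘(ℂ, EG) (cosetProj H)) :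
    -- the Atiyah sequence of `G_H`
    (∃ hP : IsPrincipalBundle (EP := EG) (EX := EX) (EK := EH) (cosetProj H) (cosetAct H),
      (assocSeq EG (cosetProj H) (cosetAct H) (inclRep hH) (quotRep hH)).IsShortExact (EX := EX) ∧
      (atiyahSeq hP).IsShortExact (EX := EX) ∧
      ∃ Φ : HolSeq.Iso
          (assocSeq EG (cosetProj H) (cosetAct H) (inclRep hH) (quotRep hH)) (atiyahSeq hP),
        (∀ x f, Φ.left x f = f) ∧
        (∀ (x : G ⧸ H) (f : assocFiber (cosetProj H) (cosetAct H) (adRestrict EG H) x) (a : G)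
          (ha : cosetProj H a = x),
          (Φ.mid x f : atiyahFiber EG (cosetProj H) (cosetAct H) x).1 ⟨a, ha⟩ =
            mulInvariantVectorField (f.1 ⟨a, ha⟩) a) ∧
        (∀ (x : G ⧸ H) (f : assocFiber (cosetProj H) (cosetAct H) (isotropyRep hH) x) (a : G)
          (ha : cosetProj H a = x) (ξ : GroupLieAlgebra 𝓘(ℂ, EG) G),
          f.1 ⟨a, ha⟩ = Submodule.Quotient.mk ξ →
          (Φ.right x f : EX) =
            mfderiv 𝓘(ℂ, EG) 𝓘(ℂ, EX) (cosetProj H) a (mulInvariantVectorField ξ a))) ∧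
    -- the Atiyah sequence of `G^τ`
    ∀ {EM M EP : Type*}
      [NormedAddCommGroup EM] [NormedSpace ℂ EM] [FiniteDimensional ℂ EM]
      [TopologicalSpace M] [ChartedSpace EM M] [Group M] [LieGroup 𝓘(ℂ, EM) ω M]
      (τ : H →* M) (hτ : ContMDiff 𝓘(ℂ, EH) 𝓘(ℂ, EM) ω τ)
      -- the complex structure of `G^τ = (G × M)/H`
      [NormedAddCommGroup EP] [NormedSpace ℂ EP] [FiniteDimensional ℂ EP]
      [ChartedSpace EP (ExtBundle τ)] [IsManifold 𝓘(ℂ, EP) ω (ExtBundle τ)]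
      (_ : IsHolSubmersion (EB := EP) (𝓘(ℂ, EG).prod 𝓘(ℂ, EM)) (extMk τ)),
      ∃ hP : IsPrincipalBundle (EP := EP) (EX := EX) (EK := EM) (extProj τ) (extAct τ),
        (assocSeq EG (cosetProj H) (cosetAct H)
          (twistedInc hH hτ) (twistedProj hH hτ)).IsShortExact (EX := EX) ∧
        (atiyahSeq hP).IsShortExact (EX := EX) ∧
        ∃ Φ : HolSeq.Iso
            (assocSeq EG (cosetProj H) (cosetAct H) (twistedInc hH hτ) (twistedProj hH hτ))
            (atiyahSeq hP),
          (∀ (x : G ⧸ H) (f : assocFiber (cosetProj H) (cosetAct H) (adPull EM τ) x) (a : G)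
            (ha : cosetProj H a = x) (b : M),
            (Φ.left x f : assocFiber (extProj τ) (extAct τ) (adRep EM M) x).1
              ⟨extMk τ (a, b), ha⟩ = adRep EM M b⁻¹ (f.1 ⟨a, ha⟩)) ∧
          (∀ (x : G ⧸ H) (f : assocFiber (cosetProj H) (cosetAct H) (twistedRep hH hτ) x) (a : G)
            (ha : cosetProj H a = x) (b : M)
            (ξ : GroupLieAlgebra 𝓘(ℂ, EG) G) (η : GroupLieAlgebra 𝓘(ℂ, EM) M),
            f.1 ⟨a, ha⟩ = Submodule.Quotient.mk (ξ, η) →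
            (Φ.mid x f : atiyahFiber EP (extProj τ) (extAct τ) x).1 ⟨extMk τ (a, b), ha⟩ =
              mfderiv (𝓘(ℂ, EG).prod 𝓘(ℂ, EM)) 𝓘(ℂ, EP) (extMk τ) (a, b)
                (mulInvariantVectorField ξ a, rightInvariantField η b)) ∧
          (∀ (x : G ⧸ H) (f : assocFiber (cosetProj H) (cosetAct H) (isotropyRep hH) x) (a : G)
            (ha : cosetProj H a = x) (ξ : GroupLieAlgebra 𝓘(ℂ, EG) G),
            f.1 ⟨a, ha⟩ = Submodule.Quotient.mk ξ →
            (Φ.right x f : EX) =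
              mfderiv 𝓘(ℂ, EG) 𝓘(ℂ, EX) (cosetProj H) a (mulInvariantVectorField ξ a)) := by
  -- Both Atiyah sequences end in `Θ_X` with the same identification, so this formula serves twice.
  have right : ∀ (x : G ⧸ H) (f : assocFiber (cosetProj H) (cosetAct H) (isotropyRep hH) x) (a : G)
      (ha : cosetProj H a = x) (ξ : GroupLieAlgebra 𝓘(ℂ, EG) G),
      f.1 ⟨a, ha⟩ = Submodule.Quotient.mk ξ →
      (cosetTangentEquiv hH hX x f : EX) =
        mfderiv 𝓘(ℂ, EG) 𝓘(ℂ, EX) (cosetProj H) a (mulInvariantVectorField ξ a) :=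
    fun x f a ha ξ hξ => (cosetTangentEquiv_apply hH hX x f ⟨a, ha⟩).trans
      ((congrArg (cosetEquiv hH hX a) hξ).trans (cosetDeriv_apply hX a ξ))
  refine ⟨⟨isPrincipalBundle_coset hH hX, isShortExact_coset_assocSeq hH hX,
    (isShortExact_coset_assocSeq hH hX).of_iso (cosetAtiyahIso hH hX), cosetAtiyahIso hH hX,
    fun _ _ => rfl, fun x f a ha => cosetAtiyahEquiv_apply hH hX x f ⟨a, ha⟩, right⟩, ?_⟩
  intro EM M EP _ _ _ _ _ _ _ τ hτ _ _ _ _ _ hQ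
  exact ⟨isPrincipalBundle_ext hH hX hτ hQ, isShortExact_ext_assocSeq hH hX hτ,
    (isShortExact_ext_assocSeq hH hX hτ).of_iso (extAtiyahIso hH hX hτ hQ),
    extAtiyahIso hH hX hτ hQ, extAdjointEquiv_apply hH hX hτ hQ,
    fun x f a ha b ξ η hξ => (extAtiyahEquiv_apply hH hX hτ hQ x f a ha b).trans
      ((congrArg (twistedEquiv hH hX hτ hQ a b) hξ).trans (twistedDeriv_apply hQ a b (ξ, η))),
    right⟩
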